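/- **Setting.** Let $R>0$, $r>R$, $a>0$, $d>R$, $k>0$, $M>0$ and let $N\ge 1$ be an integer. Write $\mathbf x=(x,y,z)$, $\Omega=\{\mathbf x\in\mathbb R^3:|x|,|y|,|z|<R\}$, $\Gamma=\{|x|,|y|<R,\ z=-R\}$, $\mathbf x_\alpha=(\alpha,0,-d)$ and $\mu_\lambda(z)=e^{2\lambda(z-r)^2}$. Let $\{\Psi_n\}_{n\ge0}$ be the Gram–Schmidt orthonormalization in $L^2(-a,a)$ of the functions $\alpha^n e^\alpha$, $n=0,1,\dots$, and let $S_N=(s_{mn})_{m,n=0}^{N-1}$ with $s_{mn}=\int_{-a}^a\Psi_n'\Psi_m\,d\alpha$. Put $$\tilde{\mathbf x}_\alpha=\frac{ik(\mathbf x-\mathbf x_\alpha)}{|\mathbf x-\mathbf x_\alpha|}-\frac{\mathbf x-\mathbf x_\alpha}{|\mathbf x-\mathbf x_\alpha|^2},\qquad \hat{\mathbf x}_\alpha=\partial_\alpha\tilde{\mathbf x}_\alpha .$$ For $V=(v_0,\dots,v_{N-1}):\Omega\to\mathbb C^N$ let $L(V)=\Delta V+S_N^{-1}f(\nabla V)$,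 where for $0\le m\le N-1$ (with bilinear dot products) $$f_m=2\sum_{n,l=0}^{N-1}\nabla v_n\cdot\nabla v_l\int_{-a}^a\Psi_m\Psi_n\Psi_l'\,d\alpha+2\sum_{n=0}^{N-1}\int_{-a}^a\Psi_m\Psi_n'\,\nabla v_n\cdot\tilde{\mathbf x}_\alpha\,d\alpha+2\sum_{n=0}^{N-1}\int_{-a}^a\Psi_m\Psi_n\,\hat{\mathbf x}_\alpha\cdot\nabla v_n\,d\alpha .$$ Identify $\mathbb C^N$ with $\mathbb R^{2N}$, and let $H^s_{2N}(\Omega)$ be the real Hilbert space of functions $\Omega\to\mathbb R^{2N}$ with norm $\|V\|_{H^s_{2N}}^2=\sum_{|\beta|\le s}\|\partial^\beta V\|_{L^2(\Omega)}^2$. For $V\in H^3_{2N}(\Omega)$ and $\lambda,\gamma>0$ let $$J_{\lambda,\gamma}(V)=e^{-2\lambda(R+r)^2}\int_\Omega|L(V)|^2\mu_\lambda(z)\,d\mathbf x+\gamma\|V\|^2_{H^3_{2N}(\Omega)} .$$ Let $$B_0(2M)=\{W\in H^3_{2N}(\Omega):\ \|W\|_{H^3_{2N}(\Omega)}<2M,\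 W|_{\partial\Omega}=0,\ W_z|_\Gamma=0\},$$ and let $\overline{B_0(2M)}$ be its closure in $H^3_{2N}(\Omega)$. For $G\in H^3_{2N}(\Omega)$ let $I_{\lambda,\gamma}(W)=J_{\lambda,\gamma}(W+G)$. **Corollary 5.1.** There is a number $\lambda_3>1$ depending only on $M,N,R,r,a,d,k$ such that for every $\lambda\ge\lambda_3$ there is a constant $C_1>0$, depending only on $M,N,R,r,a,d,k$ and $\lambda$, with the following property. For every $\gamma>0$ and every $G\in H^3_{2N}(\Omega)$ with $\|G\|_{H^3_{2N}(\Omega)}<M$: 1. at every $W\in\overline{B_0(2M)}$ the integral in $J_{\lambda,\gamma}(W+G)$ is finite and $I_{\lambda,\gamma}$ is Fréchet differentiable; 2. for all $W^{(1)},W^{(2)}\in\overline{B_0(2M)}$, $$I_{\lambda,\gamma}(W^{(2)})-I_{\lambda,\gamma}(W^{(1)})-I_{\lambda,\gamma}'(W^{(1)})(W^{(2)}-W^{(1)})\ \ge\ C_1\|W^{(2)}-W^{(1)}\|^2_{H^2_{2N}(\Omega)}+\gamma\|W^{(2)}-W^{(1)}\|^2_{H^3_{2N}(\Omega)};$$ 3.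 in particular, $I_{\lambda,\gamma}$ is strictly convex on $\overline{B_0(2M)}$. -/

import Mathlib

open MeasureTheory Set
open scoped ContDiff

noncomputable section

namespace ConvexCIP

/-- Points of the physical space `ℝ³`; the coordinates `0, 1, 2` are `x, y, z`. -/
abbrev Pt : Type := EuclideanSpace ℝ (Fin 3)

/-- Values of the vector functions: `ℂ^N`, identified as a real Hilbert space with `ℝ^{2N}`
through `W = Re W + i Im W ↔ (Re W, Im W)`. -/
abbrev Val (N : ℕ) : Type := EuclideanSpace ℂ (Fin N)

/-! ### Geometry -/

/-- The open cube `Ω = {|x|, |y|, |z| < R}`. -/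
def cube (R : ℝ) : Set Pt := {x | ∀ i, |x i| < R}

/-- The lower face `Γ = {|x|, |y| < R, z = -R}`. -/
def lowerFace (R : ℝ) : Set Pt := {x | |x 0| < R ∧ |x 1| < R ∧ x 2 = -R}

/-- Lebesgue measure on the cube. -/
abbrev cubeMeasure (R : ℝ) : Measure Pt := volume.restrict (cube R)

/-! ### The Sobolev space `H³(Ω; ℂ^N)` -/

/-- Multi-indices `β ∈ ℕ³` with `|β| = β₀ + β₁ + β₂ ≤ m`. -/
abbrev MultiIndex (m : ℕ) : Type := {β : Fin 3 → Fin (m + 1) // ∑ i, (β i : ℕ) ≤ m}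

/-- The order `|β|`. -/
def MultiIndex.order {m : ℕ} (β : MultiIndex m) : ℕ := ∑ i, (β.1 i : ℕ)

/-- The multi-index `0`. -/
def MultiIndex.zero : MultiIndex 3 := ⟨0, by decide⟩

/-- The multi-index of `∂_i`. -/
def MultiIndex.first (i : Fin 3) : MultiIndex 3 := ⟨Pi.single i 1, by revert i; decide⟩

/-- The multi-index of `∂_i²`. -/
def MultiIndex.second (i : Fin 3) : MultiIndex 3 := ⟨Pi.single i 2, by revert i; decide⟩

/-- Classical partial derivative of a scalar function. -/
def partialD (i : Fin 3) (φ : Pt → ℝ) : Pt → ℝ :=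
  fun x => fderiv ℝ φ x (EuclideanSpace.single i 1)

/-- The classical derivative `∂^β φ = ∂_x^{β₀} ∂_y^{β₁} ∂_z^{β₂} φ`. -/
def multiD {m : ℕ} (β : MultiIndex m) (φ : Pt → ℝ) : Pt → ℝ :=
  (partialD 0)^[β.1 0] ((partialD 1)^[β.1 1] ((partialD 2)^[β.1 2] φ))

/-- Test functions: `φ ∈ C_c^∞(Ω)`. -/
structure IsTest (R : ℝ) (φ : Pt → ℝ) : Prop where
  smooth : ContDiff ℝ ∞ φ
  compact : HasCompactSupport φ
  support : tsupport φ ⊆ cube R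

/-- `g` is the weak derivative `∂^β u` on the cube. -/
def IsWeakDeriv {N m : ℕ} (R : ℝ) (β : MultiIndex m) (u g : Pt → Val N) : Prop :=
  ∀ φ : Pt → ℝ, IsTest R φ →
    ∫ x in cube R, multiD β φ x • u x = (-1 : ℝ) ^ β.order • ∫ x in cube R, φ x • g x

/-- `L²(Ω; ℂ^N)`. -/
abbrev L2 (N : ℕ) (R : ℝ) : Type := Lp (Val N) 2 (cubeMeasure R)

/-- The Hilbert sum of copies of `L²(Ω; ℂ^N)`, one for each derivative of order at most `3`. -/
abbrev Jets (N : ℕ) (R : ℝ) : Type := PiLp 2 (fun _ : MultiIndex 3 => L2 N R)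

lemma contDiff_partialD (i : Fin 3) {φ : Pt → ℝ} (h : ContDiff ℝ ∞ φ) :
    ContDiff ℝ ∞ (partialD i φ) :=
  (h.fderiv_right (m := ∞) (by simp)).clm_apply contDiff_const

lemma hasCompactSupport_partialD (i : Fin 3) {φ : Pt → ℝ} (h : HasCompactSupport φ) :
    HasCompactSupport (partialD i φ) :=
  h.fderiv_apply ℝ _

lemma iterate_partialD (i : Fin 3) (n : ℕ) {φ : Pt → ℝ}
    (h : ContDiff ℝ ∞ φ ∧ HasCompactSupport φ) :
    ContDiff ℝ ∞ ((partialD i)^[n] φ) ∧ HasCompactSupport ((partialD i)^[n] φ) := by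
  induction n with
  | zero => simpa using h
  | succ n ih =>
    rw [Function.iterate_succ_apply']
    exact ⟨contDiff_partialD i ih.1, hasCompactSupport_partialD i ih.2⟩

lemma multiD_regular {m : ℕ} (β : MultiIndex m) {R : ℝ} {φ : Pt → ℝ} (h : IsTest R φ) :
    Continuous (multiD β φ) ∧ HasCompactSupport (multiD β φ) := by
  have := iterate_partialD 0 (β.1 0) (iterate_partialD 1 (β.1 1)
    (iterate_partialD 2 (β.1 2) ⟨h.smooth, h.compact⟩))
  exact ⟨this.1.continuous, this.2⟩

lemma integrable_smul_L2 {N : ℕ} {R : ℝ} {ψ : Pt → ℝ} (hc : Continuous ψ)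
    (hs : HasCompactSupport ψ) (u : L2 N R) :
    Integrable (fun x => ψ x • u x) (cubeMeasure R) := by
  have hu : LocallyIntegrable (u : Pt → Val N) (cubeMeasure R) :=
    (Lp.memLp u).locallyIntegrable (by norm_num)
  exact hu.integrable_smul_left_of_hasCompactSupport hc hs

/-- The Sobolev space `H³(Ω; ℂ^N) ≅ H³_{2N}(Ω)`. An element `U` is the family `(∂^β u)_{|β| ≤ 3}`
of the square-integrable weak derivatives of `u = U 0`, and its norm is
`(∑_{|β| ≤ 3} ‖∂^β u‖²_{L²})^{1/2}`. -/
def H3 (N : ℕ) (R : ℝ) : Submodule ℝ (Jets N R) where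
  carrier := {U | ∀ β, IsWeakDeriv R β (U MultiIndex.zero) (U β)}
  add_mem' := by
    intro U V hU hV β φ hφ
    have hr := multiD_regular β hφ
    have e1 : ∀ γ, (((U + V) γ : L2 N R) : Pt → Val N) =ᵐ[cubeMeasure R]
        fun x => U γ x + V γ x := fun γ => Lp.coeFn_add (U γ) (V γ)
    have hL : ∫ x in cube R, multiD β φ x • (U + V) MultiIndex.zero x =
        (∫ x in cube R, multiD β φ x • U MultiIndex.zero x) +
          ∫ x in cube R, multiD β φ x • V MultiIndex.zero x := by
      rw [← integral_add (integrable_smul_L2 hr.1 hr.2 _) (integrable_smul_L2 hr.1 hr.2 _)]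
      refine integral_congr_ae ?_
      filter_upwards [e1 MultiIndex.zero] with x hx
      rw [hx, smul_add]
    have hR : ∫ x in cube R, φ x • (U + V) β x =
        (∫ x in cube R, φ x • U β x) + ∫ x in cube R, φ x • V β x := by
      rw [← integral_add (integrable_smul_L2 hφ.smooth.continuous hφ.compact _)
        (integrable_smul_L2 hφ.smooth.continuous hφ.compact _)]
      refine integral_congr_ae ?_
      filter_upwards [e1 β] with x hx
      rw [hx, smul_add]
    rw [hL, hR, hU β φ hφ, hV β φ hφ, smul_add]
  zero_mem' := by
    intro β φ _
    have e1 : ((0 : L2 N R) : Pt → Val N) =ᵐ[cubeMeasure R] 0 := Lp.coeFn_zero _ _ _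
    have h0 : ∀ ψ : Pt → ℝ, ∫ x in cube R, ψ x • (0 : L2 N R) x = 0 := by
      intro ψ
      rw [← integral_zero Pt (Val N) (μ := cubeMeasure R)]
      refine integral_congr_ae ?_
      filter_upwards [e1] with x hx
      rw [hx]; simp
    have := h0 (multiD β φ)
    have h' := h0 φ
    simp only [PiLp.zero_apply]
    rw [this, h', smul_zero]
  smul_mem' := by
    intro c U hU β φ hφ
    have e1 : ∀ γ, (((c • U) γ : L2 N R) : Pt → Val N) =ᵐ[cubeMeasure R]
        fun x => c • U γ x := fun γ => Lp.coeFn_smul c (U γ)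
    have h0 : ∀ (ψ : Pt → ℝ) (γ), ∫ x in cube R, ψ x • (c • U) γ x =
        c • ∫ x in cube R, ψ x • U γ x := by
      intro ψ γ
      rw [← integral_smul]
      refine integral_congr_ae ?_
      filter_upwards [e1 γ] with x hx
      rw [hx, smul_comm]
    rw [h0, h0, hU β φ hφ, smul_comm]

/-- The function `∂^β U` (as an element of `L²`). -/
def wD {N : ℕ} {R : ℝ} (β : MultiIndex 3) (U : H3 N R) : L2 N R := (U : Jets N R) β

/-- The `H²(Ω)` norm `(∑_{|β| ≤ 2} ‖∂^β U‖²_{L²})^{1/2}` of an element of `H³(Ω)`. -/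
def normH2 {N : ℕ} {R : ℝ} (U : H3 N R) : ℝ :=
  Real.sqrt (∑ β : MultiIndex 3 with β.order ≤ 2, ‖wD β U‖ ^ 2)

/-- `u = 0` on `S ⊆ closure Ω`, for `u ∈ L²(Ω)` with a representative that is continuous up to the
boundary (by `H³(Ω) ⊂ C¹(closure Ω)` functions in `H³` and their first derivatives are such). -/
def VanishesOn {N : ℕ} {R : ℝ} (u : L2 N R) (S : Set Pt) : Prop :=
  ∃ f : Pt → Val N, ContinuousOn f (closure (cube R)) ∧ f =ᵐ[cubeMeasure R] u ∧ ∀ x ∈ S, f x = 0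

/-- The ball `B₀(ρ) = {W ∈ H³ : ‖W‖ < ρ, W = 0 on ∂Ω, W_z = 0 on Γ}`. -/
def ballZero (N : ℕ) (R ρ : ℝ) : Set (H3 N R) :=
  {W | ‖W‖ < ρ ∧ VanishesOn (wD MultiIndex.zero W) (frontier (cube R)) ∧
    VanishesOn (wD (MultiIndex.first 2) W) (lowerFace R)}

/-! ### The orthonormal basis in the source variable -/

/-- The scalar product of `L²(-a, a)`. -/
def ip (a : ℝ) (f g : ℝ → ℝ) : ℝ := ∫ α in (-a)..a, f α * g α

/-- Gram–Schmidt orthogonalization in `L²(-a, a)` of the functions `αⁿ e^α`, `n = 0, 1, …`. -/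
def gs (a : ℝ) (n : ℕ) : ℝ → ℝ := fun α =>
  α ^ n * Real.exp α -
    ∑ i : Fin n, ip a (fun s => s ^ n * Real.exp s) (gs a i) / ip a (gs a i) (gs a i) * gs a i α
termination_by n
decreasing_by all_goals exact i.2

/-- The orthonormal functions `Ψ_n`. -/
def Psi (a : ℝ) (n : ℕ) : ℝ → ℝ := fun α => gs a n α / Real.sqrt (ip a (gs a n) (gs a n))

/-- The matrix `S_N = (s_{mn})`, `s_{mn} = ⟨Ψ_n', Ψ_m⟩`. -/
def SN (N : ℕ) (a : ℝ) : Matrix (Fin N) (Fin N) ℝ :=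
  Matrix.of fun m n => ip a (deriv (Psi a n)) (Psi a m)

/-! ### The quasilinear operator -/

/-- The source position `x_α = (α, 0, -d)`. -/
def src (d α : ℝ) : Pt := !₂[α, 0, -d]

/-- `x̃_α = ∇ log u₀(x, α) = ik (x - x_α)/|x - x_α| - (x - x_α)/|x - x_α|²`. -/
def xTilde (k d α : ℝ) (x : Pt) (i : Fin 3) : ℂ :=
  Complex.I * k * ((x - src d α) i / ‖x - src d α‖ : ℝ) -
    ((x - src d α) i / ‖x - src d α‖ ^ 2 : ℝ)

/-- `x̂_α = ∂_α x̃_α`, written out. -/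
def xHat (k d α : ℝ) (x : Pt) (i : Fin 3) : ℂ :=
  Complex.I * k / ((‖x - src d α‖ ^ 3 : ℝ) : ℂ) *
      ((![-(x 1) ^ 2 - (x 2 + d) ^ 2, (x 0 - α) * x 1, (x 0 - α) * (x 2 + d)] i : ℝ) : ℂ) -
    1 / ((‖x - src d α‖ ^ 4 : ℝ) : ℂ) *
      ((![(x 0 - α) ^ 2 - (x 1) ^ 2 - (x 2 + d) ^ 2, 2 * (x 0 - α) * x 1,
        2 * (x 0 - α) * (x 2 + d)] i : ℝ) : ℂ)

/-- The nonlinearity `f_m` at the point `x`, where `p i n` stands for `∂_i v_n(x)`. The dot products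
are bilinear (no complex conjugation). -/
def fNonlin (N : ℕ) (a k d : ℝ) (x : Pt) (p : Fin 3 → Val N) (m : Fin N) : ℂ :=
  2 * (∑ n : Fin N, ∑ l : Fin N, (∑ i, p i n * p i l) *
      ((∫ α in (-a)..a, Psi a m α * Psi a n α * deriv (Psi a l) α : ℝ) : ℂ)) +
  2 * (∑ n : Fin N, (∫ α in (-a)..a,
      ((Psi a m α * deriv (Psi a n) α : ℝ) : ℂ) * (∑ i, p i n * xTilde k d α x i))) +
  2 * (∑ n : Fin N, (∫ α in (-a)..a,
      ((Psi a m α * Psi a n α : ℝ) : ℂ) * (∑ i, xHat k d α x i * p i n)))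

/-- `K = S_N⁻¹ f`. -/
def KNonlin (N : ℕ) (a k d : ℝ) (x : Pt) (p : Fin 3 → Val N) : Val N :=
  WithLp.toLp 2 (((SN N a)⁻¹.map Complex.ofReal).mulVec (fNonlin N a k d x p))

/-- `L(V)(x) = ΔV(x) + K(∇V(x))`. -/
def LOp {N : ℕ} {R : ℝ} (a k d : ℝ) (V : H3 N R) (x : Pt) : Val N :=
  (∑ i, wD (MultiIndex.second i) V x) + KNonlin N a k d x (fun i => wD (MultiIndex.first i) V x)

/-! ### The functional -/

/-- The Carleman weight `μ_λ(z) = exp(2 λ (z - r)²)`. -/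
def carleman (r lam z : ℝ) : ℝ := Real.exp (2 * lam * (z - r) ^ 2)

/-- `J_{λ,γ}(V) = e^{-2λ(R+r)²} ∫_Ω |L(V)|² μ_λ(z) dx + γ ‖V‖²_{H³}`. -/
def JFun {N : ℕ} {R : ℝ} (a k d r lam γ : ℝ) (V : H3 N R) : ℝ :=
  Real.exp (-2 * lam * (R + r) ^ 2) *
      (∫ x in cube R, ‖LOp a k d V x‖ ^ 2 * carleman r lam (x 2)) +
    γ * ‖V‖ ^ 2

/-- The shifted functional `I_{λ,γ}(W) = J_{λ,γ}(W + G)`. -/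
def IFun {N : ℕ} {R : ℝ} (a k d r lam γ : ℝ) (G W : H3 N R) : ℝ :=
  JFun a k d r lam γ (W + G)

end ConvexCIP

end

open ConvexCIP

namespace ConvexCIP

open Filter Topology

/-! ### The cube -/

/-! The functional is a quartic polynomial in W. On the cube the nonlinearity is a linear form in ∇V
with bounded coefficients plus a fixed quadratic form (`exists_KNonlin_eq`), and V ↦ ∇V is bounded
from H³ into L⁴. Hence L(V) = S V + Q(V, V) with S linear and Q bilinear, both bounded into L²
(`exists_operators`). Integrability and differentiability follow at once, and the second-order
remainder is an exact algebraic expression (`exists_hasFDerivAt_quartic`). With V = W₁ + G and h =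
W₂ - W₁ its integrand is at least μ_λ (½|Δh|² - C₀(1 + |ΔV| + |∇V|² + |∇h|²)|∇h|²), by
`half_norm_sq_sub_le`.

The negative term is absorbed for large λ by a Carleman estimate. Put X = ∫|Δh|²μ_λ and v =
e^{λ(z-r)²}h. Up to constants X bounds λ∫|∇v|², λ³∫v² and λ⁻¹∫|D²v|² (`carleman_lower_order`,
`carleman_second_order`). The coefficient g of |∇h|² need not be bounded, since ΔV is only in H¹,
but its L⁴ norm is controlled by M (`exists_lowerCoeff_bound`). For s = ∂_i v or s = λv one has
‖s‖²_{L²} ≲ X/λ and ‖s‖²_{H¹} ≲ λX. Hölder gives ∫ g s² ≤ ‖g‖₄‖s‖₄‖s‖₂, and the Gagliardo–Nirenberg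
inequality ‖s‖₄⁴ ≤ C‖s‖₂‖s‖³_{H¹} turns this into a bound of order λ^{-1/4}X (`exists_absorption`,
`exists_carleman_absorption`). At least X/4 survives (`exists_remainder_lower_bound`), and for fixed
λ it dominates the H² norm of h (`exists_sobolev_two_le`).

The Carleman estimate comes from integrating by parts over the cube. The function h vanishes on the
whole boundary and ∂_z h on the lower face; the one remaining boundary term, on the upper face, has
a good sign because z < r there (`integral_lower_face_le`).

No trace operator is used. A boundary condition is expressed by enlarging the class of test
functions in a weak derivative (`HasWD`): if ∂_i f = g also holds against functions that do not
vanish near a face orthogonal to the i-th axis, then f is zero on that face. Such identities are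
stable under H³ limits, so they pass to the closure of the ball. Integration by parts between two
weakly differentiable functions, and the Sobolev inequalities, are obtained by a mollification
combined with a dilation, which yields functions smooth on the whole space (`partialD_moll`,
`HasWD.integral_mul_add`). -/

lemma isOpen_cube (R : ℝ) : IsOpen (cube R) := by
  have : cube R = ⋂ i : Fin 3, {x : Pt | |x i| < R} := by ext; simp [cube]
  rw [this]
  exact isOpen_iInter_of_finite fun i => isOpen_lt (by fun_prop) continuous_const

lemma measurableSet_cube (R : ℝ) : MeasurableSet (cube R) := (isOpen_cube R).measurableSet

lemma norm_le_of_mem_cube {R : ℝ} {x : Pt} (hx : x ∈ cube R) : ‖x‖ ≤ 2 * R := by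
  have hR : 0 ≤ R := (abs_nonneg _).trans (hx 0).le
  rw [EuclideanSpace.norm_eq, Fin.sum_univ_three]
  refine Real.sqrt_le_iff.2 ⟨by positivity, ?_⟩
  have h : ∀ i, ‖x i‖ ^ 2 ≤ R ^ 2 := fun i => by
    have := (hx i).le
    rw [Real.norm_eq_abs]
    gcongr
  nlinarith [h 0, h 1, h 2]

lemma isBounded_cube (R : ℝ) : Bornology.IsBounded (cube R) :=
  (Metric.isBounded_closedBall (x := (0 : Pt)) (r := 2 * R)).subset fun x hx => by
    simpa using norm_le_of_mem_cube hx

lemma isCompact_closure_cube (R : ℝ) : IsCompact (closure (cube R)) :=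
  (isBounded_cube R).isCompact_closure

instance isFiniteMeasure_cubeMeasure (R : ℝ) : IsFiniteMeasure (cubeMeasure R) :=
  ⟨by simpa using (isBounded_cube R).measure_lt_top⟩

lemma ae_mem_cube (R : ℝ) : ∀ᵐ x ∂cubeMeasure R, x ∈ cube R :=
  ae_restrict_mem (measurableSet_cube R)

lemma exists_bound_on_cube (R : ℝ) {w : Pt → ℝ} (hw : Continuous w) :
    ∃ C, 0 ≤ C ∧ ∀ x ∈ cube R, |w x| ≤ C := by
  obtain ⟨C, hC⟩ := (isCompact_closure_cube R).exists_bound_of_continuousOn hw.continuousOn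
  exact ⟨max C 0, le_max_right _ _, fun x hx => (hC x (subset_closure hx)).trans (le_max_left _ _)⟩

lemma memLp_bounded_mul {R : ℝ} {p : ENNReal} {w f : Pt → ℝ} {C : ℝ}
    (hw : AEStronglyMeasurable w (cubeMeasure R)) (hC : ∀ x ∈ cube R, |w x| ≤ C)
    (hf : MemLp f p (cubeMeasure R)) : MemLp (fun x => w x * f x) p (cubeMeasure R) := by
  refine hf.of_le_mul (c := C) (hw.mul hf.1) ?_
  filter_upwards [ae_mem_cube R] with x hx
  rw [norm_mul]
  exact mul_le_mul_of_nonneg_right (hC x hx) (norm_nonneg _)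

lemma memLp_continuous_mul {R : ℝ} {p : ENNReal} {w f : Pt → ℝ} (hw : Continuous w)
    (hf : MemLp f p (cubeMeasure R)) : MemLp (fun x => w x * f x) p (cubeMeasure R) := by
  obtain ⟨C, -, hC⟩ := exists_bound_on_cube R hw
  exact memLp_bounded_mul hw.aestronglyMeasurable hC hf

lemma memLp_of_continuous (R : ℝ) (p : ENNReal) {w : Pt → ℝ} (hw : Continuous w) :
    MemLp w p (cubeMeasure R) := by
  simpa using memLp_continuous_mul hw (memLp_const (1 : ℝ) (p := p) (μ := cubeMeasure R))

lemma integrable_mul_L2 {R : ℝ} {f g : Pt → ℝ} (hf : MemLp f 2 (cubeMeasure R))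
    (hg : MemLp g 2 (cubeMeasure R)) : Integrable (fun x => f x * g x) (cubeMeasure R) :=
  hf.integrable_mul hg

lemma integrable_continuous_mul {R : ℝ} {w f : Pt → ℝ} (hw : Continuous w)
    (hf : MemLp f 2 (cubeMeasure R)) : Integrable (fun x => w x * f x) (cubeMeasure R) :=
  (memLp_of_continuous R 2 hw).integrable_mul hf

/-! ### Classical partial derivatives -/

lemma differentiable_of_smooth {φ : Pt → ℝ} (h : ContDiff ℝ ∞ φ) : Differentiable ℝ φ :=
  h.differentiable (by simp)

lemma partialD_mul {φ ψ : Pt → ℝ} (hφ : Differentiable ℝ φ) (hψ : Differentiable ℝ ψ) (i : Fin 3)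
    (x : Pt) : partialD i (fun y => φ y * ψ y) x =
      φ x * partialD i ψ x + partialD i φ x * ψ x := by
  simp only [partialD]
  rw [fderiv_fun_mul (hφ x) (hψ x)]
  simp [mul_comm]

lemma partialD_coord {χ : ℝ → ℝ} (hχ : Differentiable ℝ χ) (σ : ℝ) (l i : Fin 3) (x : Pt) :
    partialD i (fun y : Pt => χ (σ * y l)) x = if i = l then σ * deriv χ (σ * x l) else 0 := by
  simp only [partialD]
  have h1 : HasFDerivAt (fun y : Pt => σ * y l) (σ • (EuclideanSpace.proj l : Pt →L[ℝ] ℝ)) x :=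
    (EuclideanSpace.proj l : Pt →L[ℝ] ℝ).hasFDerivAt.const_mul σ
  have h2 := ((hχ (σ * x l)).hasDerivAt.comp_hasFDerivAt x h1)
  have h3 : fderiv ℝ (fun y : Pt => χ (σ * y l)) x = _ := h2.fderiv
  rw [h3]
  by_cases h : i = l <;> simp [h, mul_comm]

lemma partialD_comm {φ : Pt → ℝ} (h : ContDiff ℝ ∞ φ) (i j : Fin 3) :
    partialD i (partialD j φ) = partialD j (partialD i φ) := by
  funext x
  have hs : IsSymmSndFDerivAt ℝ φ x := h.contDiffAt.isSymmSndFDerivAt (by simpa using (ENat.LEInfty.out : (2 : WithTop ℕ∞) ≤ ∞))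
  have hd : DifferentiableAt ℝ (fderiv ℝ φ) x :=
    ((h.fderiv_right (m := ∞) (by simp)).differentiable (by simp)) x
  have key : ∀ a b : Fin 3, partialD a (partialD b φ) x =
      fderiv ℝ (fderiv ℝ φ) x (EuclideanSpace.single a 1) (EuclideanSpace.single b 1) := by
    intro a b
    have e : partialD b φ = fun y => fderiv ℝ φ y (EuclideanSpace.single b 1) := rfl
    rw [partialD, e, fderiv_clm_apply hd (differentiableAt_const _)]
    simp
  rw [key, key, hs.eq]

lemma tsupport_partialD_subset (i : Fin 3) (φ : Pt → ℝ) :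
    tsupport (partialD i φ) ⊆ tsupport φ := by
  refine (closure_mono ?_).trans (tsupport_fderiv_subset ℝ)
  intro x hx h
  exact hx (by simp [partialD, h])

/-! ### Weak derivatives with boundary conditions -/

/-- `g` is the weak derivative `∂_i f` on the cube, tested against all smooth functions supported
in `U`. For `U = cube R` this is the usual weak derivative; for larger `U` it also says that `f`
vanishes on the part of the faces orthogonal to the `i`-th axis that lies in `U`. -/
structure HasWD (R : ℝ) (U : Set Pt) (i : Fin 3) (f g : Pt → ℝ) : Prop where
  memf : MemLp f 2 (cubeMeasure R)
  memg : MemLp g 2 (cubeMeasure R)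
  ibp : ∀ ψ : Pt → ℝ, ContDiff ℝ ∞ ψ → HasCompactSupport ψ → tsupport ψ ⊆ U →
    ∫ x in cube R, partialD i ψ x * f x = -∫ x in cube R, ψ x * g x

variable {R : ℝ} {U V : Set Pt} {i j : Fin 3} {f g f' g' : Pt → ℝ}

lemma HasWD.mono (h : HasWD R U i f g) (hVU : V ⊆ U) : HasWD R V i f g :=
  ⟨h.memf, h.memg, fun ψ h1 h2 h3 => h.ibp ψ h1 h2 (h3.trans hVU)⟩

lemma HasWD.add (h : HasWD R U i f g) (h' : HasWD R U i f' g') :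
    HasWD R U i (fun x => f x + f' x) (fun x => g x + g' x) := by
  refine ⟨h.memf.add h'.memf, h.memg.add h'.memg, fun ψ h1 h2 h3 => ?_⟩
  have hc := (contDiff_partialD i h1).continuous
  simp only [mul_add]
  rw [integral_add (integrable_continuous_mul hc h.memf) (integrable_continuous_mul hc h'.memf),
    integral_add (integrable_continuous_mul h1.continuous h.memg)
      (integrable_continuous_mul h1.continuous h'.memg), h.ibp ψ h1 h2 h3, h'.ibp ψ h1 h2 h3]
  ring

/-- The product rule. Multiplying by a smooth function supported in `U` enlarges the class of test
functions. -/
lemma HasWD.smooth_mul' {w : Pt → ℝ} (hw : ContDiff ℝ ∞ w) (hU : V ∩ tsupport w ⊆ U)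
    (h : HasWD R U i f g) :
    HasWD R V i (fun x => w x * f x) (fun x => w x * g x + partialD i w x * f x) := by
  have hwc := hw.continuous
  have hw' := (contDiff_partialD i hw).continuous
  refine ⟨memLp_continuous_mul hwc h.memf,
    (memLp_continuous_mul hwc h.memg).add (memLp_continuous_mul hw' h.memf), fun ψ h1 h2 h3 => ?_⟩
  have hp := (contDiff_partialD i h1).continuous
  have := h.ibp (fun x => ψ x * w x) (h1.mul hw) h2.mul_right
    ((subset_inter (tsupport_mul_subset_left.trans h3) tsupport_mul_subset_right).trans hU)
  have e1 : ∀ x, partialD i (fun x => ψ x * w x) x * f x =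
      ψ x * partialD i w x * f x + partialD i ψ x * w x * f x := fun x => by
    rw [partialD_mul (differentiable_of_smooth h1) (differentiable_of_smooth hw)]; ring
  have e2 : ∀ x, ψ x * (w x * g x + partialD i w x * f x) =
      ψ x * w x * g x + ψ x * partialD i w x * f x := fun x => by ring
  have e3 : ∀ x, partialD i ψ x * (w x * f x) = partialD i ψ x * w x * f x := fun x => by ring
  simp only [e1] at this
  simp only [e2, e3]
  rw [integral_add (integrable_continuous_mul (w := fun x => ψ x * partialD i w x)
      (h1.continuous.mul hw') h.memf)
    (integrable_continuous_mul (w := fun x => partialD i ψ x * w x) (hp.mul hwc) h.memf)] at this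
  rw [integral_add (integrable_continuous_mul (w := fun x => ψ x * w x)
      (h1.continuous.mul hwc) h.memg)
    (integrable_continuous_mul (w := fun x => ψ x * partialD i w x) (h1.continuous.mul hw') h.memf)]
  linarith

lemma HasWD.smooth_mul {w : Pt → ℝ} (hw : ContDiff ℝ ∞ w) (h : HasWD R U i f g) :
    HasWD R U i (fun x => w x * f x) (fun x => w x * g x + partialD i w x * f x) :=
  h.smooth_mul' hw inter_subset_left

lemma HasWD.const_mul (c : ℝ) (h : HasWD R U i f g) :
    HasWD R U i (fun x => c * f x) (fun x => c * g x) := by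
  have := h.smooth_mul (w := fun _ => c) contDiff_const
  simpa [partialD] using this

lemma HasWD.congr (h : HasWD R U i f g) (hf : f =ᵐ[cubeMeasure R] f')
    (hg : g =ᵐ[cubeMeasure R] g') : HasWD R U i f' g' := by
  refine ⟨h.memf.ae_eq hf, h.memg.ae_eq hg, fun ψ h1 h2 h3 => ?_⟩
  have e1 : ∫ x in cube R, partialD i ψ x * f' x = ∫ x in cube R, partialD i ψ x * f x :=
    integral_congr_ae (by filter_upwards [hf] with x hx; rw [hx])
  have e2 : ∫ x in cube R, ψ x * g' x = ∫ x in cube R, ψ x * g x :=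
    integral_congr_ae (by filter_upwards [hg] with x hx; rw [hx])
  rw [e1, e2, h.ibp ψ h1 h2 h3]

/-! ### Cutoffs near a face -/

/-- A smooth cutoff, equal to `1` for `t ≤ R - 2/n` and to `0` for `t ≥ R - 1/n`. -/
noncomputable def faceCutoff (R : ℝ) (n : ℕ) (t : ℝ) : ℝ := Real.smoothTransition (n * (R - t) - 1)

lemma faceCutoff_contDiff (R : ℝ) (n : ℕ) : ContDiff ℝ ∞ (faceCutoff R n) :=
  Real.smoothTransition.contDiff.comp (by fun_prop)

lemma faceCutoff_nonneg (R : ℝ) (n : ℕ) (t : ℝ) : 0 ≤ faceCutoff R n t :=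
  Real.smoothTransition.nonneg _

lemma faceCutoff_le_one (R : ℝ) (n : ℕ) (t : ℝ) : faceCutoff R n t ≤ 1 :=
  Real.smoothTransition.le_one _

lemma faceCutoff_antitone (R : ℝ) (n : ℕ) : Antitone (faceCutoff R n) := by
  intro s t hst
  refine Real.smoothTransition.monotone ?_
  have : (0 : ℝ) ≤ n := by positivity
  nlinarith

lemma faceCutoff_tendsto {R t : ℝ} (ht : t < R) :
    Tendsto (fun n => faceCutoff R n t) atTop (𝓝 1) := by
  refine tendsto_const_nhds.congr' ?_
  obtain ⟨n₀, hn₀⟩ := exists_nat_gt (2 / (R - t))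
  filter_upwards [eventually_ge_atTop n₀] with n hn
  refine (Real.smoothTransition.one_of_one_le ?_).symm
  have h1 : (n₀ : ℝ) ≤ n := by exact_mod_cast hn
  have h2 : 0 < R - t := by linarith
  rw [div_lt_iff₀ h2] at hn₀
  nlinarith

lemma deriv_faceCutoff (R : ℝ) (n : ℕ) (t : ℝ) :
    deriv (faceCutoff R n) t = -n * deriv Real.smoothTransition (n * (R - t) - 1) := by
  have h1 : HasDerivAt (fun t : ℝ => n * (R - t) - 1) (-n : ℝ) t := by
    simpa using (((hasDerivAt_id t).const_sub R).const_mul (n : ℝ)).sub_const 1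
  have h2 := ((Real.smoothTransition.contDiff (n := 1)).differentiable (by simp)
    (n * (R - t) - 1)).hasDerivAt
  have := (h2.comp t h1).deriv
  rw [mul_comm]
  exact this

lemma deriv_smoothTransition_eq_zero {t : ℝ} (ht : t < 0 ∨ 1 < t) :
    deriv Real.smoothTransition t = 0 := by
  rcases ht with ht | ht
  · have : Real.smoothTransition =ᶠ[𝓝 t] fun _ => 0 := by
      filter_upwards [Iio_mem_nhds ht] with s hs
      exact Real.smoothTransition.zero_of_nonpos (le_of_lt hs)
    rw [this.deriv_eq]; simp
  · have : Real.smoothTransition =ᶠ[𝓝 t] fun _ => 1 := by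
      filter_upwards [Ioi_mem_nhds ht] with s hs
      exact Real.smoothTransition.one_of_one_le (le_of_lt hs)
    rw [this.deriv_eq]; simp

lemma exists_bound_deriv_smoothTransition :
    ∃ C, 0 ≤ C ∧ ∀ t, |deriv Real.smoothTransition t| ≤ C := by
  have hc : Continuous (deriv Real.smoothTransition) :=
    (Real.smoothTransition.contDiff (n := 1)).continuous_deriv (by simp)
  obtain ⟨C, hC⟩ := (isCompact_Icc (a := (0 : ℝ)) (b := 1)).exists_bound_of_continuousOn
    hc.continuousOn
  refine ⟨max C 0, le_max_right _ _, fun t => ?_⟩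
  by_cases ht : t ∈ Icc (0 : ℝ) 1
  · exact (hC t ht).trans (le_max_left _ _)
  · rw [deriv_smoothTransition_eq_zero, abs_zero]
    · exact le_max_right _ _
    · simp only [mem_Icc, not_and_or, not_le] at ht
      exact ht

lemma coordCutoff_contDiff (R σ : ℝ) (n : ℕ) (l : Fin 3) :
    ContDiff ℝ ∞ (fun x : Pt => faceCutoff R n (σ * x l)) :=
  (faceCutoff_contDiff R n).comp (by fun_prop)

lemma tsupport_coordCutoff (R σ : ℝ) {n : ℕ} (hn : 0 < n) (l : Fin 3) :
    tsupport (fun x : Pt => faceCutoff R n (σ * x l)) ⊆ {x | σ * x l < R} := by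
  have h1 : (0 : ℝ) < n := by exact_mod_cast hn
  have hcl : IsClosed {x : Pt | 1 ≤ n * (R - σ * x l)} :=
    isClosed_le continuous_const (by fun_prop)
  refine (closure_minimal ?_ hcl).trans ?_
  · intro x hx
    by_contra h
    simp only [mem_ofPred_eq, not_le] at h
    exact hx (Real.smoothTransition.zero_of_nonpos (by linarith))
  · intro x hx
    simp only [mem_ofPred_eq] at hx ⊢
    nlinarith

/-- Bounded convergence for multipliers tending to `1` on the cube. -/
lemma tendsto_integral_cutoff_mul {h : Pt → ℝ} (hh : Integrable h (cubeMeasure R))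
    {c : ℕ → Pt → ℝ} (hc : ∀ n, Continuous (c n)) (hb : ∀ n x, |c n x| ≤ 1)
    (hlim : ∀ x ∈ cube R, Tendsto (fun n => c n x) atTop (𝓝 1)) :
    Tendsto (fun n => ∫ x in cube R, c n x * h x) atTop (𝓝 (∫ x in cube R, h x)) := by
  refine tendsto_integral_of_dominated_convergence (fun x => ‖h x‖)
    (fun n => (hc n).aestronglyMeasurable.mul hh.1) hh.norm (fun n => ?_) ?_
  · filter_upwards with x
    rw [norm_mul]
    exact mul_le_of_le_one_left (norm_nonneg _) (hb n x)
  · filter_upwards [ae_mem_cube R] with x hx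
    simpa using (hlim x hx).mul_const (h x)

lemma coordCutoff_abs_le (R σ : ℝ) (n : ℕ) (l : Fin 3) (x : Pt) :
    |faceCutoff R n (σ * x l)| ≤ 1 := by
  rw [abs_of_nonneg (faceCutoff_nonneg _ _ _)]
  exact faceCutoff_le_one _ _ _

lemma lt_of_mem_cube {σ : ℝ} (hσ : σ = 1 ∨ σ = -1) {x : Pt} (hx : x ∈ cube R) (l : Fin 3) :
    σ * x l < R := by
  have := abs_lt.1 (hx l)
  rcases hσ with rfl | rfl <;> linarith

lemma coordCutoff_tendsto {σ : ℝ} (hσ : σ = 1 ∨ σ = -1) {x : Pt} (hx : x ∈ cube R) (l : Fin 3) :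
    Tendsto (fun n => faceCutoff R n (σ * x l)) atTop (𝓝 1) :=
  faceCutoff_tendsto (lt_of_mem_cube hσ hx l)

/-- The faces parallel to the `i`-th axis impose no restriction on test functions for `∂_i`. -/
lemma HasWD.remove_parallel_face {σ : ℝ} (hσ : σ = 1 ∨ σ = -1) {l : Fin 3} (hl : i ≠ l)
    (h : HasWD R (V ∩ {x | σ * x l < R}) i f g) : HasWD R V i f g := by
  refine ⟨h.memf, h.memg, fun ψ h1 h2 h3 => ?_⟩
  have hp := (contDiff_partialD i h1).continuous
  have hkey : ∀ n : ℕ, 0 < n →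
      ∫ x in cube R, faceCutoff R n (σ * x l) * (partialD i ψ x * f x) =
        -∫ x in cube R, faceCutoff R n (σ * x l) * (ψ x * g x) := by
    intro n hn
    -- The cutoff depends on the l-th coordinate only, so ∂_i never falls on it and no boundary term
    -- can arise in the limit.
    have := h.ibp (fun x => faceCutoff R n (σ * x l) * ψ x) ((coordCutoff_contDiff R σ n l).mul h1)
      h2.mul_left (subset_inter (tsupport_mul_subset_right.trans h3)
        (tsupport_mul_subset_left.trans (tsupport_coordCutoff R σ hn l)))
    simp only [partialD_mul (differentiable_of_smooth (coordCutoff_contDiff R σ n l))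
      (differentiable_of_smooth h1),
      partialD_coord ((faceCutoff_contDiff R n).differentiable (by simp)), if_neg hl,
      zero_mul, add_zero, mul_assoc] at this
    exact this
  have t1 := tendsto_integral_cutoff_mul (integrable_continuous_mul hp h.memf)
    (c := fun n x => faceCutoff R n (σ * x l)) (fun n => (coordCutoff_contDiff R σ n l).continuous)
    (fun n x => coordCutoff_abs_le R σ n l x) (fun x hx => coordCutoff_tendsto hσ hx l)
  have t2 := (tendsto_integral_cutoff_mul (integrable_continuous_mul h1.continuous h.memg)
    (c := fun n x => faceCutoff R n (σ * x l)) (fun n => (coordCutoff_contDiff R σ n l).continuous)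
    (fun n x => coordCutoff_abs_le R σ n l x) (fun x hx => coordCutoff_tendsto hσ hx l)).neg
  refine tendsto_nhds_unique t1 (t2.congr' ?_)
  filter_upwards [eventually_gt_atTop 0] with n hn
  exact (hkey n hn).symm

end ConvexCIP

/-! ### Removing faces on which a function vanishes. -/

namespace ConvexCIP

open Filter Topology

variable {R : ℝ} {U V : Set Pt} {i j : Fin 3} {f g f' g' : Pt → ℝ}

/-- The cube is open and star-shaped about 0: t x lies inside for 0 < t < 1, and t x → x. -/
lemma mem_closure_cube (hR : 0 < R) {x : Pt} (hx : ∀ l, |x l| ≤ R) : x ∈ closure (cube R) := by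
  have h1 : Tendsto (fun t : ℝ => t • x) (𝓝[<] 1) (𝓝 x) := by
    have : Tendsto (fun t : ℝ => t • x) (𝓝 1) (𝓝 ((1 : ℝ) • x)) := by
      apply Continuous.tendsto; fun_prop
    rw [one_smul] at this
    exact this.mono_left nhdsWithin_le_nhds
  refine mem_closure_of_tendsto h1 ?_
  filter_upwards [Ioo_mem_nhdsLT (show (0 : ℝ) < 1 by norm_num)] with t ht
  intro l
  have h2 := hx l
  have : |(t • x) l| = t * |x l| := by
    simp [abs_mul, abs_of_pos ht.1]
  rw [this]
  nlinarith [ht.1, ht.2, abs_nonneg (x l)]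

lemma volume_box_le (lo hi : Fin 3 → ℝ) :
    (volume : Measure Pt) {x | ∀ l, x l ∈ Icc (lo l) (hi l)} =
      ∏ l, ENNReal.ofReal (hi l - lo l) := by
  rw [← Real.volume_Icc_pi (a := lo) (b := hi), ← (EuclideanSpace.volume_preserving_symm_measurableEquiv_toLp
    (Fin 3)).measure_preimage measurableSet_Icc.nullMeasurableSet]
  congr 1
  ext x
  simp [Pi.le_def, forall_and]

/-- The derivative of the n-th cutoff has size n and lives on a strip of width 2/n; a volume linear
in the width keeps its integral bounded. -/
lemma measureReal_strip_le (hR : 0 < R) {σ : ℝ} (hσ : σ = 1 ∨ σ = -1) (i : Fin 3) {δ : ℝ}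
    (hδ : 0 ≤ δ) :
    (cubeMeasure R).real {x | R - σ * x i ≤ δ} ≤ (2 * R) ^ 2 * δ := by
  have hsub : {x : Pt | R - σ * x i ≤ δ} ∩ cube R ⊆ {x : Pt | ∀ l, x l ∈
      Icc (if l = i then (if σ = 1 then R - δ else -R) else -R)
        (if l = i then (if σ = 1 then R else -R + δ) else R)} := by
    rintro x ⟨hx, hc⟩ l
    have hl := abs_lt.1 (hc l)
    simp only [mem_ofPred_eq] at hx
    by_cases h : l = i
    · subst h
      rcases hσ with rfl | rfl
      · simp; constructor <;> linarith
      · norm_num; constructor <;> linarith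
    · simp only [h, if_false, mem_Icc]
      exact ⟨hl.1.le, hl.2.le⟩
  have hm : MeasurableSet {x : Pt | R - σ * x i ≤ δ} :=
    measurableSet_le (by fun_prop) measurable_const
  have h1 : cubeMeasure R {x | R - σ * x i ≤ δ} ≤ ENNReal.ofReal ((2 * R) ^ 2 * δ) := by
    rw [Measure.restrict_apply hm]
    refine (measure_mono hsub).trans ?_
    rw [volume_box_le, ENNReal.ofReal_mul (by positivity), pow_two,
      ENNReal.ofReal_mul (by positivity)]
    have e1 : ∀ l, ENNReal.ofReal ((if l = i then (if σ = 1 then R else -R + δ) else R) -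
        (if l = i then (if σ = 1 then R - δ else -R) else -R)) =
        if l = i then ENNReal.ofReal δ else ENNReal.ofReal (2 * R) := by
      intro l
      by_cases hl : l = i
      · rcases hσ with rfl | rfl
        · simp [hl]
        · norm_num [hl]
      · simp [hl, two_mul]
    rw [Finset.prod_congr rfl fun l _ => e1 l]
    refine le_of_eq ?_
    fin_cases i <;> simp [Fin.prod_univ_three] <;> ring
  rw [measureReal_def]
  exact ENNReal.toReal_le_of_le_ofReal (by positivity) h1

/-- `F` is uniformly continuous on the compact closure, and the point at which it is assumed to
vanish is the foot of the perpendicular from x to the face, at distance R - σ x_i. -/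
lemma uniformly_small_near_face (hR : 0 < R) {σ : ℝ} (hσ : σ = 1 ∨ σ = -1) {F : Pt → ℝ}
    (hF : ContinuousOn F (closure (cube R)))
    (h0 : ∀ x ∈ cube R, F (x + (σ * R - x i) • EuclideanSpace.single i 1) = 0) {ε : ℝ}
    (hε : 0 < ε) : ∃ δ > 0, ∀ x ∈ cube R, R - σ * x i ≤ δ → |F x| ≤ ε := by
  have hu := (isCompact_closure_cube R).uniformContinuousOn_of_continuous hF
  obtain ⟨δ, hδ, h⟩ := Metric.uniformContinuousOn_iff.1 hu ε hε
  refine ⟨δ / 2, half_pos hδ, fun x hx hxi => ?_⟩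
  have hσ2 : |σ| = 1 := by rcases hσ with rfl | rfl <;> simp
  have hy : x + (σ * R - x i) • EuclideanSpace.single i 1 ∈ closure (cube R) := by
    refine mem_closure_cube hR fun l => ?_
    by_cases hl : l = i
    · subst hl
      simp [abs_mul, hσ2, abs_of_pos hR]
    · simpa [hl] using (hx l).le
  have hd : dist x (x + (σ * R - x i) • EuclideanSpace.single i 1) < δ := by
    rw [dist_eq_norm, sub_add_cancel_left, norm_neg, norm_smul]
    have hxl := lt_of_mem_cube hσ hx i
    have : |σ * R - x i| = R - σ * x i := by
      rcases hσ with rfl | rfl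
      · rw [abs_of_pos] <;> linarith
      · rw [abs_of_neg] <;> linarith
    simp [this]
    linarith
  have := h x (subset_closure hx) _ hy hd
  rw [h0 x hx, dist_zero_right] at this
  exact this.le

/-- A face on which `f` vanishes imposes no restriction on test functions. -/
lemma HasWD.remove_face (hR : 0 < R) {σ : ℝ} (hσ : σ = 1 ∨ σ = -1)
    (h : HasWD R (V ∩ {x | σ * x i < R}) i f g) {F : Pt → ℝ}
    (hF : ContinuousOn F (closure (cube R))) (hFf : F =ᵐ[cubeMeasure R] f)
    (h0 : ∀ x ∈ cube R, F (x + (σ * R - x i) • EuclideanSpace.single i 1) = 0) :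
    HasWD R V i f g := by
  refine ⟨h.memf, h.memg, fun ψ h1 h2 h3 => ?_⟩
  have hp := (contDiff_partialD i h1).continuous
  have hσ2 : |σ| = 1 := by rcases hσ with rfl | rfl <;> simp
  have hint : ∀ n, Integrable (fun x => σ * deriv (faceCutoff R n) (σ * x i) * ψ x * f x)
      (cubeMeasure R) := fun n => by
    have hc : Continuous (deriv (faceCutoff R n)) :=
      (faceCutoff_contDiff R n).continuous_deriv (by simp)
    exact integrable_continuous_mul (w := fun x => σ * deriv (faceCutoff R n) (σ * x i) * ψ x)
      (by have := h1.continuous; fun_prop) h.memf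
  have hkey : ∀ n : ℕ, 0 < n →
      (∫ x in cube R, faceCutoff R n (σ * x i) * (partialD i ψ x * f x)) +
        (∫ x in cube R, σ * deriv (faceCutoff R n) (σ * x i) * ψ x * f x) =
        -∫ x in cube R, faceCutoff R n (σ * x i) * (ψ x * g x) := by
    intro n hn
    have := h.ibp (fun x => faceCutoff R n (σ * x i) * ψ x) ((coordCutoff_contDiff R σ n i).mul h1)
      h2.mul_left (subset_inter (tsupport_mul_subset_right.trans h3)
        (tsupport_mul_subset_left.trans (tsupport_coordCutoff R σ hn i)))
    simp only [partialD_mul (differentiable_of_smooth (coordCutoff_contDiff R σ n i))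
      (differentiable_of_smooth h1),
      partialD_coord ((faceCutoff_contDiff R n).differentiable (by simp)), if_true,
      mul_assoc, add_mul] at this
    rw [← integral_add, ← this]
    · simp only [mul_assoc]
    · exact integrable_continuous_mul (coordCutoff_contDiff R σ n i).continuous
        (memLp_continuous_mul hp h.memf)
    · exact hint n
  have t1 := tendsto_integral_cutoff_mul (integrable_continuous_mul hp h.memf)
    (c := fun n x => faceCutoff R n (σ * x i)) (fun n => (coordCutoff_contDiff R σ n i).continuous)
    (fun n x => coordCutoff_abs_le R σ n i x) (fun x hx => coordCutoff_tendsto hσ hx i)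
  have t2 := (tendsto_integral_cutoff_mul (integrable_continuous_mul h1.continuous h.memg)
    (c := fun n x => faceCutoff R n (σ * x i)) (fun n => (coordCutoff_contDiff R σ n i).continuous)
    (fun n x => coordCutoff_abs_le R σ n i x) (fun x hx => coordCutoff_tendsto hσ hx i)).neg
  -- The term in which ∂_i hits the cutoff disappears: the derivative is at most C n, the strip
  -- carrying it has volume O(1/n), and f is uniformly small there because it vanishes on the face.
  have t3 : Tendsto (fun n : ℕ => ∫ x in cube R, σ * deriv (faceCutoff R n) (σ * x i) * ψ x * f x)
      atTop (𝓝 0) := by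
    obtain ⟨C, hC0, hC⟩ := exists_bound_deriv_smoothTransition
    obtain ⟨B, hB0, hB⟩ := exists_bound_on_cube R h1.continuous
    -- The bound for derivative times test function times strip volume, with the factors n and 1/n
    -- cancelled; the 1 makes it positive, so that ε / (2K) makes sense.
    set K := C * B * ((2 * R) ^ 2 * 2) + 1 with hK
    have hK0 : 0 < K := by positivity
    rw [Metric.tendsto_atTop]
    intro ε hε
    obtain ⟨δ, hδ, hs⟩ := uniformly_small_near_face hR hσ hF h0 (ε := ε / (2 * K)) (by positivity)
    obtain ⟨n₀, hn₀⟩ := exists_nat_gt (2 / δ)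
    refine ⟨n₀ + 1, fun n hn => ?_⟩
    have hn1 : (n₀ : ℝ) + 1 ≤ n := by exact_mod_cast hn
    have hnpos : (0 : ℝ) < n := lt_of_lt_of_le (by positivity) hn1
    have hnδ : 2 / (n : ℝ) ≤ δ := by
      rw [div_lt_iff₀ hδ] at hn₀
      rw [div_le_iff₀ hnpos]
      nlinarith
    rw [dist_zero_right]
    have hm : MeasurableSet {x : Pt | R - σ * x i ≤ 2 / n} :=
      measurableSet_le (by fun_prop) measurable_const
    have hb : ‖∫ x in cube R, σ * deriv (faceCutoff R n) (σ * x i) * ψ x * f x‖ ≤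
        ∫ x in cube R, indicator {x : Pt | R - σ * x i ≤ 2 / n}
          (fun _ => n * C * B * (ε / (2 * K))) x := by
      refine norm_integral_le_of_norm_le ((integrable_const _).indicator hm) ?_
      filter_upwards [ae_mem_cube R, hFf] with x hx hxf
      rw [deriv_faceCutoff, norm_mul, norm_mul, norm_mul, norm_mul, Real.norm_eq_abs, hσ2, one_mul,
        ← hxf, norm_neg]
      by_cases hxs : x ∈ {x : Pt | R - σ * x i ≤ 2 / n}
      · rw [indicator_of_mem hxs]
        have a1 := hs x hx ((show R - σ * x i ≤ 2 / n from hxs).trans hnδ)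
        have a2 := hB x hx
        have a3 := hC (n * (R - σ * x i) - 1)
        simp only [Real.norm_eq_abs, Nat.abs_cast]
        gcongr
      · rw [indicator_of_notMem hxs, deriv_smoothTransition_eq_zero]
        · simp
        · right
          simp only [mem_ofPred_eq, not_le] at hxs
          rw [div_lt_iff₀ hnpos] at hxs
          nlinarith
    refine hb.trans_lt ?_
    rw [integral_indicator_const _ hm, smul_eq_mul]
    calc (cubeMeasure R).real {x : Pt | R - σ * x i ≤ 2 / n} * (n * C * B * (ε / (2 * K)))
        ≤ ((2 * R) ^ 2 * (2 / n)) * (n * C * B * (ε / (2 * K))) := by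
          gcongr
          exact measureReal_strip_le hR hσ i (by positivity)
      _ = (C * B * ((2 * R) ^ 2 * 2)) * (ε / (2 * K)) := by field_simp
      _ ≤ K * (ε / (2 * K)) := by gcongr; linarith
      _ = ε / 2 := by field_simp
      _ < ε := by linarith
  have t4 := t1.add t3
  rw [add_zero] at t4
  refine tendsto_nhds_unique t4 (t2.congr' ?_)
  filter_upwards [eventually_gt_atTop 0] with n hn
  exact (hkey n hn).symm

lemma cube_eq (R : ℝ) : cube R = ⋂ l : Fin 3, ({x | (1 : ℝ) * x l < R} ∩ {x | (-1 : ℝ) * x l < R}) := by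
  ext x
  simp only [cube, mem_ofPred_eq, mem_iInter, mem_inter_iff, abs_lt]
  exact forall_congr' fun l => ⟨fun h => ⟨by linarith, by linarith⟩, fun h => ⟨by linarith, by linarith⟩⟩

/-- A weak derivative `∂_i` can be tested by functions which vanish near the two faces orthogonal to
the `i`-th axis only. -/
lemma HasWD.to_slab (h : HasWD R (cube R) i f g) :
    HasWD R ({x | (1 : ℝ) * x i < R} ∩ {x | (-1 : ℝ) * x i < R}) i f g := by
  have key : ∀ a b c : Fin 3, a ≠ b → a ≠ c → (∀ l, l = a ∨ l = b ∨ l = c) →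
      HasWD R (cube R) a f g →
      HasWD R ({x | (1 : ℝ) * x a < R} ∩ {x | (-1 : ℝ) * x a < R}) a f g := by
    intro a b c hab hac hall h
    refine (HasWD.remove_parallel_face (σ := 1) (l := b) (Or.inl rfl) hab
      (HasWD.remove_parallel_face (σ := -1) (l := b) (Or.inr rfl) hab
      (HasWD.remove_parallel_face (σ := 1) (l := c) (Or.inl rfl) hac
      (HasWD.remove_parallel_face (σ := -1) (l := c) (Or.inr rfl) hac
      (h.mono ?_)))))
    rintro x ⟨⟨⟨⟨⟨h1, h2⟩, h3⟩, h4⟩, h5⟩, h6⟩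
    rw [cube_eq]
    refine mem_iInter.2 fun l => ?_
    rcases hall l with rfl | rfl | rfl
    exacts [⟨h1, h2⟩, ⟨h3, h4⟩, ⟨h5, h6⟩]
  fin_cases i
  · exact key 0 1 2 (by decide) (by decide) (by decide) h
  · exact key 1 0 2 (by decide) (by decide) (by decide) h
  · exact key 2 0 1 (by decide) (by decide) (by decide) h

/-- Zero boundary values survive differentiation along the face. -/
lemma HasWD.tangential (hij : i ≠ j) (h : HasWD R univ i f g) (hf : HasWD R (cube R) j f f')
    (hg : HasWD R (cube R) j g g') : HasWD R univ i f' g' := by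
  refine HasWD.remove_parallel_face (σ := 1) (Or.inl rfl) hij
    (HasWD.remove_parallel_face (σ := -1) (Or.inr rfl) hij
      ⟨hf.memg, hg.memg, fun ψ h1 h2 h3 => ?_⟩)
  rw [univ_inter] at h3
  have hp := contDiff_partialD i h1
  -- Now ψ vanishes near both faces orthogonal to the j-th axis, so ∂_j can be moved freely on f and
  -- on g. The link is the identity for f tested with ∂_jψ, since ∂_i and ∂_j commute on ψ.
  have e1 := hf.to_slab.ibp (partialD i ψ) hp (hasCompactSupport_partialD i h2)
    ((tsupport_partialD_subset i ψ).trans h3)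
  have e2 := hg.to_slab.ibp ψ h1 h2 h3
  have e3 := h.ibp (partialD j ψ) (contDiff_partialD j h1) (hasCompactSupport_partialD j h2)
    (subset_univ _)
  rw [partialD_comm h1] at e3
  linarith

end ConvexCIP

namespace ConvexCIP

open Filter Topology

variable {R : ℝ} {U V : Set Pt} {i j : Fin 3} {f g f' g' : Pt → ℝ}

/-! ### Mollification up to the boundary -/

/-- The mollification parameter. -/
noncomputable def mollEps (n : ℕ) : ℝ := 1 / (n + 2)

lemma mollEps_pos (n : ℕ) : 0 < mollEps n := by unfold mollEps; positivity

/-- Keeps the dilation factor 1 - ε at least 1/2, which bounds the Jacobian of x ↦ (1 - ε)x. -/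
lemma mollEps_le (n : ℕ) : mollEps n ≤ 1 / 2 := by
  unfold mollEps
  have : (0 : ℝ) ≤ n := by positivity
  gcongr
  linarith

lemma tendsto_mollEps : Tendsto mollEps atTop (𝓝 0) := by
  have h := tendsto_one_div_add_atTop_nhds_zero_nat (𝕜 := ℝ)
  refine ((tendsto_add_atTop_iff_nat 1).2 h).congr fun n => ?_
  simp only [mollEps]
  push_cast
  ring_nf

/-- The bump function of the mollifier. -/
noncomputable def mollBump (hR : 0 < R) (n : ℕ) : ContDiffBump (0 : Pt) where
  rIn := mollEps n * R / 4
  rOut := mollEps n * R / 2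
  rIn_pos := by have := mollEps_pos n; positivity
  rIn_lt_rOut := by have := mul_pos (mollEps_pos n) hR; linarith

/-- The mollifying kernel. -/
noncomputable def mollKernel (hR : 0 < R) (n : ℕ) : Pt → ℝ := (mollBump hR n).normed volume

lemma mollKernel_contDiff (hR : 0 < R) (n : ℕ) : ContDiff ℝ ∞ (mollKernel hR n) :=
  (mollBump hR n).contDiff_normed

lemma mollKernel_continuous (hR : 0 < R) (n : ℕ) : Continuous (mollKernel hR n) :=
  (mollKernel_contDiff hR n).continuous

lemma mollKernel_nonneg (hR : 0 < R) (n : ℕ) (x : Pt) : 0 ≤ mollKernel hR n x :=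
  (mollBump hR n).nonneg_normed x

lemma mollKernel_compact (hR : 0 < R) (n : ℕ) : HasCompactSupport (mollKernel hR n) :=
  (mollBump hR n).hasCompactSupport_normed

lemma integral_mollKernel (hR : 0 < R) (n : ℕ) : ∫ x, mollKernel hR n x = 1 :=
  (mollBump hR n).integral_normed

lemma tsupport_mollKernel (hR : 0 < R) (n : ℕ) :
    tsupport (mollKernel hR n) = Metric.closedBall 0 (mollEps n * R / 2) :=
  (mollBump hR n).tsupport_normed_eq

lemma mollKernel_eq_zero (hR : 0 < R) (n : ℕ) {x : Pt} (hx : mollEps n * R / 2 < ‖x‖) :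
    mollKernel hR n x = 0 := by
  refine image_eq_zero_of_notMem_tsupport ?_
  rw [tsupport_mollKernel]
  simpa using hx

lemma integrable_mollKernel (hR : 0 < R) (n : ℕ) : Integrable (mollKernel hR n) :=
  (mollKernel_continuous hR n).integrable_of_hasCompactSupport (mollKernel_compact hR n)

/-- Mollification combined with a dilation, so that the values of `f` on the cube determine a smooth
function on a neighbourhood of the closed cube. -/
noncomputable def moll (hR : 0 < R) (n : ℕ) (f : Pt → ℝ) (x : Pt) : ℝ :=
  ∫ y in cube R, mollKernel hR n ((1 - mollEps n) • x - y) * f y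

lemma convolution_indicator_cube (k f : Pt → ℝ) (z : Pt) :
    convolution k (indicator (cube R) f) (ContinuousLinearMap.mul ℝ ℝ) volume z =
      ∫ y in cube R, k (z - y) * f y := by
  rw [convolution_eq_swap, ← integral_indicator (measurableSet_cube R)]
  congr 1
  ext y
  by_cases hy : y ∈ cube R <;> simp [hy]

lemma integrable_indicator_cube (hf : MemLp f 2 (cubeMeasure R)) :
    Integrable (indicator (cube R) f) := by
  rw [integrable_indicator_iff (measurableSet_cube R)]
  exact hf.integrable (by norm_num)

lemma moll_eq_convolution (hR : 0 < R) (n : ℕ) (f : Pt → ℝ) :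
    moll hR n f = fun x => convolution (mollKernel hR n) (indicator (cube R) f)
      (ContinuousLinearMap.mul ℝ ℝ) volume ((1 - mollEps n) • x) := by
  funext x
  rw [convolution_indicator_cube]; rfl

lemma moll_contDiff (hR : 0 < R) (n : ℕ) (hf : MemLp f 2 (cubeMeasure R)) :
    ContDiff ℝ ∞ (moll hR n f) := by
  rw [moll_eq_convolution]
  exact ((mollKernel_compact hR n).contDiff_convolution_left (ContinuousLinearMap.mul ℝ ℝ)
    (mollKernel_contDiff hR n) (integrable_indicator_cube hf).locallyIntegrable).comp
    (contDiff_id.const_smul _)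

lemma moll_continuous (hR : 0 < R) (n : ℕ) (hf : MemLp f 2 (cubeMeasure R)) :
    Continuous (moll hR n f) := (moll_contDiff hR n hf).continuous

lemma moll_hasCompactSupport (hR : 0 < R) (n : ℕ) (f : Pt → ℝ) :
    HasCompactSupport (moll hR n f) := by
  rw [moll_eq_convolution]
  have h1 : HasCompactSupport (indicator (cube R) f) :=
    HasCompactSupport.of_support_subset_isCompact (isCompact_closure_cube R)
      (support_indicator_subset.trans subset_closure)
  have h2 := (mollKernel_compact hR n).convolution (ContinuousLinearMap.mul ℝ ℝ) (μ := volume) h1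
  have h3 := mollEps_le n
  have h4 : (1 - mollEps n : ℝ) ≠ 0 := by linarith
  exact h2.comp_homeomorph (Homeomorph.smulOfNeZero _ h4)

/-- The dilated point is farther than εR from every face, while the kernel has radius εR/2. Thus the
mollifier centred at (1 - ε)x sees only values of the function inside the cube. -/
lemma norm_sub_le_mem_cube (hR : 0 < R) (n : ℕ) {x y : Pt} (hx : x ∈ cube R)
    (hy : ‖(1 - mollEps n) • x - y‖ ≤ mollEps n * R / 2) : y ∈ cube R := by
  intro l
  have h1 := (PiLp.norm_apply_le ((1 - mollEps n) • x - y) l).trans hy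
  have h2 := hx l
  have h3 := mollEps_pos n
  have h4 := mollEps_le n
  simp only [PiLp.sub_apply, PiLp.smul_apply, smul_eq_mul, Real.norm_eq_abs] at h1
  rw [abs_lt] at h2 ⊢
  rw [abs_le] at h1
  constructor <;> nlinarith [mul_pos h3 hR]

/-- The derivative falls on the kernel, so square integrability of f is enough; the chain rule for
the dilation produces the factor 1 - ε. -/
lemma hasFDerivAt_moll (hR : 0 < R) (n : ℕ) (hf : MemLp f 2 (cubeMeasure R)) (i : Fin 3) (x : Pt) :
    partialD i (moll hR n f) x = (1 - mollEps n) *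
      ∫ y in cube R, partialD i (mollKernel hR n) ((1 - mollEps n) • x - y) * f y := by
  have hloc := (integrable_indicator_cube hf).locallyIntegrable
  have h1 := (mollKernel_compact hR n).hasFDerivAt_convolution_left (ContinuousLinearMap.mul ℝ ℝ)
    ((mollKernel_contDiff hR n).of_le (by simp)) hloc ((1 - mollEps n) • x)
  have h2 : HasFDerivAt (fun x : Pt => (1 - mollEps n) • x)
      ((1 - mollEps n) • ContinuousLinearMap.id ℝ Pt) x :=
    ((1 - mollEps n) • ContinuousLinearMap.id ℝ Pt).hasFDerivAt
  have h3 := (h1.comp x h2).fderiv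
  rw [Function.comp_def, ← moll_eq_convolution] at h3
  rw [partialD, h3]
  simp only [ContinuousLinearMap.comp_apply, _root_.smul_apply,
    ContinuousLinearMap.id_apply, map_smul, smul_eq_mul]
  congr 1
  rw [convolution_eq_swap, ContinuousLinearMap.integral_apply, ← integral_indicator (measurableSet_cube R)]
  · congr 1
    ext y
    by_cases hy : y ∈ cube R <;> simp [hy, partialD, ContinuousLinearMap.precompL_apply]
  · have := ((mollKernel_compact hR n).fderiv ℝ).convolutionExists_left
      ((ContinuousLinearMap.mul ℝ ℝ).precompL Pt)
      (((mollKernel_contDiff hR n).of_le (by simp : (1 : WithTop ℕ∞) ≤ ∞)).continuous_fderiv (by simp)) hloc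
    exact (this _).integrable_swap

/-- Mollification commutes with weak derivatives, up to the dilation factor. -/
lemma partialD_moll (hR : 0 < R) (n : ℕ) (h : HasWD R (cube R) i f g) {x : Pt} (hx : x ∈ cube R) :
    partialD i (moll hR n f) x = (1 - mollEps n) * moll hR n g x := by
  rw [hasFDerivAt_moll hR n h.memf, moll]
  congr 1
  set z := (1 - mollEps n) • x with hz
  have hs : ContDiff ℝ ∞ (fun y => mollKernel hR n (z - y)) :=
    (mollKernel_contDiff hR n).comp (by fun_prop)
  have hpd : ∀ y, partialD i (fun y => mollKernel hR n (z - y)) y =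
      -partialD i (mollKernel hR n) (z - y) := by
    intro y
    simp only [partialD]
    have h1 : HasFDerivAt (fun y : Pt => z - y) (-ContinuousLinearMap.id ℝ Pt) y :=
      (hasFDerivAt_id y).const_sub z
    have h2 := (differentiable_of_smooth (mollKernel_contDiff hR n) (z - y)).hasFDerivAt.comp y h1
    have h3 : fderiv ℝ (fun y => mollKernel hR n (z - y)) y = _ := h2.fderiv
    rw [h3]
    simp
  have hcs : HasCompactSupport (fun y => mollKernel hR n (z - y)) :=
    (mollKernel_compact hR n).comp_homeomorph (Homeomorph.subLeft z)
  -- This is the purpose of the dilation: the translated kernel is an admissible test function for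
  -- every x in the cube, up to the boundary.
  have hsub : tsupport (fun y => mollKernel hR n (z - y)) ⊆ cube R := by
    have hcl : IsClosed {y : Pt | ‖z - y‖ ≤ mollEps n * R / 2} :=
      isClosed_le (by fun_prop) continuous_const
    refine (closure_minimal ?_ hcl).trans fun y hy => norm_sub_le_mem_cube hR n hx hy
    intro y hy
    by_contra hc
    exact hy (mollKernel_eq_zero hR n (not_le.1 hc))
  have := h.ibp _ hs hcs hsub
  simp only [hpd, neg_mul, integral_neg] at this
  linarith

end ConvexCIP

/-! ### L² bounds and L² convergence of the mollification. -/

namespace ConvexCIP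

open Filter Topology

variable {R : ℝ} {U V : Set Pt} {i j : Fin 3} {f g f' g' : Pt → ℝ}

open scoped ENNReal

lemma eLpNorm_two_sq {α E : Type*} [MeasurableSpace α] [NormedAddCommGroup E] (f : α → E)
    (μ : Measure α) : eLpNorm f 2 μ ^ 2 = ∫⁻ x, ‖f x‖ₑ ^ 2 ∂μ := by
  have := eLpNorm_nnreal_pow_eq_lintegral (f := f) (μ := μ) (p := 2) (by norm_num)
  simpa using this

/-- Jensen's inequality for a sub-probability density, obtained from Cauchy–Schwarz applied to
k^{1/2} and k^{1/2}F. -/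
lemma lintegral_kernel_sq_le {α : Type*} [MeasurableSpace α] {μ : Measure α} {k F : α → ℝ≥0∞}
    (hk : AEMeasurable k μ) (hF : AEMeasurable F μ) (h1 : ∫⁻ x, k x ∂μ ≤ 1) :
    (∫⁻ x, k x * F x ∂μ) ^ 2 ≤ ∫⁻ x, k x * F x ^ 2 ∂μ := by
  have hc : Real.HolderConjugate 2 2 := by
    rw [Real.holderConjugate_iff]; norm_num
  have h := ENNReal.lintegral_mul_le_Lp_mul_Lq μ hc (hk.pow_const (1 / 2 : ℝ))
    ((hk.pow_const (1 / 2 : ℝ)).mul hF)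
  have e1 : ∀ x, k x ^ (1 / 2 : ℝ) * (k x ^ (1 / 2 : ℝ) * F x) = k x * F x := fun x => by
    rw [← mul_assoc, ← ENNReal.rpow_add_of_nonneg _ _ (by norm_num) (by norm_num)]; norm_num
  have e2 : ∀ x, (k x ^ (1 / 2 : ℝ)) ^ (2 : ℝ) = k x := fun x => by
    rw [← ENNReal.rpow_mul]; norm_num
  have e3 : ∀ x, (k x ^ (1 / 2 : ℝ) * F x) ^ (2 : ℝ) = k x * F x ^ 2 := fun x => by
    rw [ENNReal.mul_rpow_of_nonneg _ _ (by norm_num), e2]; norm_num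
  simp only [Pi.mul_apply, e1, e2, e3] at h
  calc (∫⁻ x, k x * F x ∂μ) ^ 2
      ≤ ((∫⁻ x, k x ∂μ) ^ (1 / 2 : ℝ) * (∫⁻ x, k x * F x ^ 2 ∂μ) ^ (1 / 2 : ℝ)) ^ 2 := by gcongr
    _ ≤ (1 * (∫⁻ x, k x * F x ^ 2 ∂μ) ^ (1 / 2 : ℝ)) ^ 2 := by
        gcongr
        exact ENNReal.rpow_le_one h1 (by norm_num)
    _ = _ := by
        rw [one_mul, ← ENNReal.rpow_natCast, ← ENNReal.rpow_mul]; norm_num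

lemma lintegral_mollKernel_left (hR : 0 < R) (n : ℕ) (z : Pt) :
    ∫⁻ y, ENNReal.ofReal (mollKernel hR n (z - y)) = 1 := by
  have h := lintegral_sub_left_eq_self (μ := (volume : Measure Pt))
    (fun y => ENNReal.ofReal (mollKernel hR n y)) z
  rw [h, ← ofReal_integral_eq_lintegral_ofReal (integrable_mollKernel hR n)
    (Eventually.of_forall (mollKernel_nonneg hR n)), integral_mollKernel, ENNReal.ofReal_one]

/-- The substitution x ↦ (1 - ε)x costs (1 - ε)⁻³ ≤ 2³. -/
lemma lintegral_mollKernel_right (hR : 0 < R) (n : ℕ) (y : Pt) :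
    ∫⁻ x, ENNReal.ofReal (mollKernel hR n ((1 - mollEps n) • x - y)) ≤ 8 := by
  have h3 := mollEps_le n
  have h4 : (1 - mollEps n : ℝ) ≠ 0 := by linarith
  have hint : Integrable (fun x => mollKernel hR n (x - y)) :=
    (integrable_mollKernel hR n).comp_sub_right y
  have hint2 : Integrable (fun x => mollKernel hR n ((1 - mollEps n) • x - y)) :=
    (integrable_comp_smul_iff volume (fun x => mollKernel hR n (x - y)) h4).2 hint
  rw [← ofReal_integral_eq_lintegral_ofReal hint2
    (Eventually.of_forall fun x => mollKernel_nonneg hR n _),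
    Measure.integral_comp_smul volume (fun x => mollKernel hR n (x - y)),
    integral_sub_right_eq_self (fun x => mollKernel hR n x) y, integral_mollKernel]
  have h5 : |((1 - mollEps n) ^ Module.finrank ℝ Pt)⁻¹| ≤ 8 := by
    have e : Module.finrank ℝ Pt = 3 := by simp
    rw [e, abs_of_nonneg (by have : (0 : ℝ) ≤ 1 - mollEps n := by linarith
                             positivity)]
    have h6 : (1 / 2 : ℝ) ≤ 1 - mollEps n := by linarith
    calc ((1 - mollEps n) ^ 3)⁻¹ ≤ ((1 / 2 : ℝ) ^ 3)⁻¹ := by gcongr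
      _ = 8 := by norm_num
  calc ENNReal.ofReal (|((1 - mollEps n) ^ Module.finrank ℝ Pt)⁻¹| • 1)
      ≤ ENNReal.ofReal 8 := ENNReal.ofReal_le_ofReal (by simpa using h5)
    _ = 8 := by simp

/-- Schur's test: Jensen in y, Tonelli, then the kernel mass in x is at most 8 ≤ 3². -/
lemma eLpNorm_moll_le (hR : 0 < R) (n : ℕ) (hf : MemLp f 2 (cubeMeasure R)) :
    eLpNorm (moll hR n f) 2 (cubeMeasure R) ≤ 3 * eLpNorm f 2 (cubeMeasure R) := by
  refine (ENNReal.pow_le_pow_left_iff two_ne_zero).1 ?_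
  rw [mul_pow, eLpNorm_two_sq, eLpNorm_two_sq]
  have hk : Measurable (fun p : Pt × Pt =>
      ENNReal.ofReal (mollKernel hR n ((1 - mollEps n) • p.1 - p.2))) := by
    have := mollKernel_continuous hR n
    exact (ENNReal.continuous_ofReal.comp (this.comp (by fun_prop))).measurable
  have hfm : AEMeasurable (fun y => ‖f y‖ₑ) (cubeMeasure R) := hf.1.enorm
  have hpt : ∀ x, ‖moll hR n f x‖ₑ ^ 2 ≤
      ∫⁻ y, ENNReal.ofReal (mollKernel hR n ((1 - mollEps n) • x - y)) * ‖f y‖ₑ ^ 2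
        ∂cubeMeasure R := by
    intro x
    have hkx : Measurable (fun y : Pt =>
        ENNReal.ofReal (mollKernel hR n ((1 - mollEps n) • x - y))) :=
      (ENNReal.continuous_ofReal.comp
        ((mollKernel_continuous hR n).comp (by fun_prop))).measurable
    have h1 : ∫⁻ y, ENNReal.ofReal (mollKernel hR n ((1 - mollEps n) • x - y)) ∂cubeMeasure R ≤ 1 :=
      (lintegral_mono' Measure.restrict_le_self le_rfl).trans
        (lintegral_mollKernel_left hR n ((1 - mollEps n) • x)).le
    have h2 : ‖moll hR n f x‖ₑ ≤ ∫⁻ y, ENNReal.ofReal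
        (mollKernel hR n ((1 - mollEps n) • x - y)) * ‖f y‖ₑ ∂cubeMeasure R := by
      rw [moll]
      refine (enorm_integral_le_lintegral_enorm _).trans (lintegral_mono fun y => ?_)
      rw [enorm_mul, Real.enorm_of_nonneg (mollKernel_nonneg hR n _)]
    have h3 := lintegral_kernel_sq_le hkx.aemeasurable hfm h1
    exact (pow_le_pow_left' h2 2).trans h3
  calc ∫⁻ x in cube R, ‖moll hR n f x‖ₑ ^ 2
      ≤ ∫⁻ x in cube R, ∫⁻ y in cube R,
        ENNReal.ofReal (mollKernel hR n ((1 - mollEps n) • x - y)) * ‖f y‖ₑ ^ 2 :=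
        lintegral_mono hpt
    _ = ∫⁻ y in cube R, ∫⁻ x in cube R,
        ENNReal.ofReal (mollKernel hR n ((1 - mollEps n) • x - y)) * ‖f y‖ₑ ^ 2 := by
        refine lintegral_lintegral_swap ?_
        exact hk.aemeasurable.mul ((hfm.pow_const 2).comp_snd)
    _ ≤ ∫⁻ y in cube R, 8 * ‖f y‖ₑ ^ 2 := by
        refine lintegral_mono fun y => ?_
        simp only
        have hky : Measurable (fun x : Pt =>
            ENNReal.ofReal (mollKernel hR n ((1 - mollEps n) • x - y))) :=
          (ENNReal.continuous_ofReal.comp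
            ((mollKernel_continuous hR n).comp (by fun_prop))).measurable
        rw [lintegral_mul_const _ hky]
        gcongr
        exact (lintegral_mono' Measure.restrict_le_self le_rfl).trans
          (lintegral_mollKernel_right hR n y)
    _ ≤ 3 ^ 2 * ∫⁻ y in cube R, ‖f y‖ₑ ^ 2 := by
        rw [lintegral_const_mul'' _ (hfm.pow_const 2)]
        gcongr
        norm_num

lemma integrable_mollKernel_mul (hR : 0 < R) (n : ℕ) (hf : MemLp f 2 (cubeMeasure R)) (z : Pt) :
    Integrable (fun y => mollKernel hR n (z - y) * f y) (cubeMeasure R) :=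
  integrable_continuous_mul (w := fun y => mollKernel hR n (z - y))
    ((mollKernel_continuous hR n).comp (by fun_prop)) hf

lemma moll_sub (hR : 0 < R) (n : ℕ) (hf : MemLp f 2 (cubeMeasure R))
    (hg : MemLp g 2 (cubeMeasure R)) :
    moll hR n (f - g) = moll hR n f - moll hR n g := by
  funext x
  simp only [moll, Pi.sub_apply, mul_sub]
  exact integral_sub (integrable_mollKernel_mul hR n hf _) (integrable_mollKernel_mul hR n hg _)

/-- The kernel has total mass 1 inside the cube, so the difference is an average of g(y) - g(x) over
points with |y - x| ≤ εR/2 + ε|x| ≤ 3Rε. -/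
lemma abs_moll_sub_le (hR : 0 < R) (n : ℕ) (hg : Continuous g) {ε : ℝ} {x : Pt} (hx : x ∈ cube R)
    (h : ∀ y, ‖y - x‖ ≤ 3 * R * mollEps n → |g y - g x| ≤ ε) : |moll hR n g x - g x| ≤ ε := by
  set z := (1 - mollEps n) • x with hz
  have hgl : MemLp g 2 (cubeMeasure R) := memLp_of_continuous R 2 hg
  have hki : Integrable (fun y => mollKernel hR n (z - y)) (cubeMeasure R) :=
    ((integrable_mollKernel hR n).comp_sub_left z).integrableOn
  have hone : ∫ y in cube R, mollKernel hR n (z - y) = 1 := by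
    rw [setIntegral_eq_integral_of_forall_compl_eq_zero, integral_sub_left_eq_self
      (fun y => mollKernel hR n y), integral_mollKernel]
    intro y hy
    refine mollKernel_eq_zero hR n ?_
    by_contra hc
    exact hy (norm_sub_le_mem_cube hR n hx (not_lt.1 hc))
  have e : moll hR n g x - g x = ∫ y in cube R, mollKernel hR n (z - y) * (g y - g x) := by
    simp only [mul_sub]
    rw [integral_sub (integrable_mollKernel_mul hR n hgl z) (hki.mul_const _), integral_mul_const,
      hone, one_mul]
    rfl
  rw [e, ← Real.norm_eq_abs]
  calc ‖∫ y in cube R, mollKernel hR n (z - y) * (g y - g x)‖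
      ≤ ∫ y in cube R, mollKernel hR n (z - y) * ε := by
        refine norm_integral_le_of_norm_le (hki.mul_const _) (Eventually.of_forall fun y => ?_)
        rw [norm_mul, Real.norm_of_nonneg (mollKernel_nonneg hR n _)]
        by_cases hy : ‖z - y‖ ≤ mollEps n * R / 2
        · refine mul_le_mul_of_nonneg_left (h y ?_) (mollKernel_nonneg hR n _)
          have e1 : y - x = -(z - y) - mollEps n • x := by
            rw [hz, sub_smul, one_smul]; abel
          rw [e1]
          refine (norm_sub_le _ _).trans ?_
          rw [norm_neg, norm_smul, Real.norm_of_nonneg (mollEps_pos n).le]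
          have h1 := norm_le_of_mem_cube hx
          have h2 := mollEps_pos n
          nlinarith [mul_pos h2 hR]
        · rw [mollKernel_eq_zero hR n (not_le.1 hy), zero_mul, zero_mul]
    _ = ε := by rw [integral_mul_const, hone, one_mul]

lemma tendsto_moll_of_compactSupport (hR : 0 < R) (hg : Continuous g) (hc : HasCompactSupport g) :
    Tendsto (fun n => eLpNorm (moll hR n g - g) 2 (cubeMeasure R)) atTop (𝓝 0) := by
  have hu := hc.uniformContinuous_of_continuous hg
  rw [ENNReal.tendsto_nhds_zero]
  intro ε hε
  set m := (cubeMeasure R univ) ^ (1 / 2 : ℝ) with hm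
  have hmt : m ≠ ⊤ := ENNReal.rpow_ne_top_of_nonneg (by norm_num) (measure_ne_top _ _)
  obtain ⟨η, hη, hηε⟩ : ∃ η : ℝ, 0 < η ∧ m * ENNReal.ofReal η ≤ ε := by
    by_cases hε' : ε = ⊤
    · exact ⟨1, one_pos, by simp [hε']⟩
    · refine ⟨(ε / (m + 1)).toReal, ENNReal.toReal_pos ?_ ?_, ?_⟩
      · exact (ENNReal.div_pos hε.ne' (by finiteness)).ne'
      · exact ENNReal.div_ne_top hε' (by simp)
      · rw [ENNReal.ofReal_toReal (ENNReal.div_ne_top hε' (by simp)), ← mul_div_assoc]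
        refine ENNReal.div_le_of_le_mul ?_
        rw [mul_comm]
        gcongr
        simp
  obtain ⟨δ, hδ, h⟩ := Metric.uniformContinuous_iff.1 hu η hη
  have hlim : Tendsto (fun n => 3 * R * mollEps n) atTop (𝓝 0) := by
    simpa using tendsto_mollEps.const_mul (3 * R)
  filter_upwards [hlim.eventually (gt_mem_nhds hδ)] with n hn
  refine le_trans ?_ hηε
  have := eLpNorm_le_of_ae_bound (μ := cubeMeasure R) (p := 2) (f := moll hR n g - g) (C := η) ?_
  · simpa [hm] using this
  · filter_upwards [ae_mem_cube R] with x hx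
    refine abs_moll_sub_le hR n hg hx fun y hy => ?_
    have := h (a := y) (b := x) (by rw [dist_eq_norm]; exact hy.trans_lt hn)
    rw [Real.dist_eq] at this
    exact this.le

lemma tendsto_moll (hR : 0 < R) (hf : MemLp f 2 (cubeMeasure R)) :
    Tendsto (fun n => eLpNorm (moll hR n f - f) 2 (cubeMeasure R)) atTop (𝓝 0) := by
  rw [ENNReal.tendsto_nhds_zero]
  intro ε hε
  -- Approximating f by a compactly supported continuous g leaves the errors 3‖f - g‖ (mollified),
  -- ‖moll g - g‖ and ‖f - g‖, hence 3 + 1 + 1 fifths.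
  have hε5 : ε / 5 ≠ 0 := (ENNReal.div_pos hε.ne' (by norm_num)).ne'
  obtain ⟨g, hgc, hfg, hg, -⟩ := hf.exists_hasCompactSupport_eLpNorm_sub_le (by norm_num) hε5
  have hgl : MemLp g 2 (cubeMeasure R) := memLp_of_continuous R 2 hg
  filter_upwards [(ENNReal.tendsto_nhds_zero.1 (tendsto_moll_of_compactSupport hR hg hgc)) (ε / 5)
    (pos_iff_ne_zero.2 hε5)] with n hn
  have e : moll hR n f - f = moll hR n (f - g) + (moll hR n g - g) - (f - g) := by
    rw [moll_sub hR n hf hgl]; abel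
  have hmc : ∀ {h}, MemLp h 2 (cubeMeasure R) → AEStronglyMeasurable (moll hR n h) (cubeMeasure R) :=
    fun hh => (moll_continuous hR n hh).aestronglyMeasurable
  rw [e]
  calc _ ≤ eLpNorm (moll hR n (f - g) + (moll hR n g - g)) 2 (cubeMeasure R) +
        eLpNorm (f - g) 2 (cubeMeasure R) :=
        eLpNorm_sub_le ((hmc (hf.sub hgl)).add ((hmc hgl).sub hgl.1)) (hf.sub hgl).1 (by norm_num)
    _ ≤ (eLpNorm (moll hR n (f - g)) 2 (cubeMeasure R) +
        eLpNorm (moll hR n g - g) 2 (cubeMeasure R)) + eLpNorm (f - g) 2 (cubeMeasure R) := by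
        gcongr
        exact eLpNorm_add_le (hmc (hf.sub hgl)) ((hmc hgl).sub hgl.1) (by norm_num)
    _ ≤ (3 * (ε / 5) + ε / 5) + ε / 5 := by
        gcongr
        exact (eLpNorm_moll_le hR n (hf.sub hgl)).trans (by gcongr)
    _ = 5 * (ε / 5) := by ring
    _ = ε := ENNReal.mul_div_cancel (by norm_num) (by norm_num)

/-- Convergence of `(1 - ε) moll g`, the gradient of the mollified function. -/
lemma tendsto_scaled_moll (hR : 0 < R) (hf : MemLp f 2 (cubeMeasure R)) :
    Tendsto (fun n => eLpNorm ((fun x => (1 - mollEps n) * moll hR n f x) - f) 2 (cubeMeasure R))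
      atTop (𝓝 0) := by
  have h1 := tendsto_moll hR hf
  have h2 : Tendsto (fun n => ‖mollEps n‖ₑ * (3 * eLpNorm f 2 (cubeMeasure R))) atTop (𝓝 0) := by
    have : Tendsto (fun n => ‖mollEps n‖ₑ) atTop (𝓝 0) := by
      simpa [Function.comp_def] using (continuous_enorm.tendsto (0 : ℝ)).comp tendsto_mollEps
    have h3 := ENNReal.Tendsto.mul_const (b := 3 * eLpNorm f 2 (cubeMeasure R)) this
      (Or.inr (ENNReal.mul_ne_top (by norm_num) hf.2.ne))
    simpa using h3
  refine tendsto_of_tendsto_of_tendsto_of_le_of_le tendsto_const_nhds (by simpa using h1.add h2)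
    (fun _ => zero_le) fun n => ?_
  have hmc : AEStronglyMeasurable (moll hR n f) (cubeMeasure R) :=
    (moll_continuous hR n hf).aestronglyMeasurable
  have e : (fun x => (1 - mollEps n) * moll hR n f x) - f =
      (moll hR n f - f) - mollEps n • moll hR n f := by
    ext x; simp; ring
  rw [e]
  refine (eLpNorm_sub_le (hmc.sub hf.1) (hmc.const_smul _) (by norm_num)).trans ?_
  rw [eLpNorm_const_smul]
  gcongr
  exact eLpNorm_moll_le hR n hf

end ConvexCIP

namespace ConvexCIP

open Filter Topology

variable {R : ℝ} {U V : Set Pt} {i j : Fin 3} {f g f' g' : Pt → ℝ}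

open scoped ENNReal

/-! ### Integration by parts for weakly differentiable functions -/

lemma tendsto_integral_mul_of_L2 {a : ℕ → Pt → ℝ} {b : Pt → ℝ}
    (ha : ∀ n, MemLp (a n) 2 (cubeMeasure R)) (hf : MemLp f 2 (cubeMeasure R))
    (hb : MemLp b 2 (cubeMeasure R))
    (hlim : Tendsto (fun n => eLpNorm (a n - f) 2 (cubeMeasure R)) atTop (𝓝 0)) :
    Tendsto (fun n => ∫ x in cube R, a n x * b x) atTop (𝓝 (∫ x in cube R, f x * b x)) := by
  refine tendsto_integral_of_L1' (fun x => f x * b x) (integrable_mul_L2 hf hb).1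
    (Eventually.of_forall fun n => integrable_mul_L2 (ha n) hb) ?_
  have h1 : Tendsto (fun n => eLpNorm (a n - f) 2 (cubeMeasure R) * eLpNorm b 2 (cubeMeasure R))
      atTop (𝓝 0) := by
    simpa using ENNReal.Tendsto.mul_const hlim (Or.inr hb.2.ne)
  refine tendsto_of_tendsto_of_tendsto_of_le_of_le tendsto_const_nhds h1 (fun _ => zero_le)
    fun n => ?_
  have e : ((fun x => a n x * b x) - fun x => f x * b x) = (a n - f) • b := by
    ext x; simp [sub_mul]
  simp only
  rw [e]
  exact eLpNorm_smul_le_mul_eLpNorm hb.1 ((ha n).sub hf).1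

/-- Green's formula without boundary term. The zero boundary values of f are what allows arbitrary
compactly supported smooth tests on the whole space; the mollification of h is such a test, and both
its values and its gradient on the cube converge in L². -/
lemma HasWD.integral_mul_add (hR : 0 < R) {h h' : Pt → ℝ} (hf : HasWD R univ i f g)
    (hh : HasWD R (cube R) i h h') :
    (∫ x in cube R, g x * h x) + ∫ x in cube R, f x * h' x = 0 := by
  have hm : ∀ {k : Pt → ℝ}, MemLp k 2 (cubeMeasure R) → ∀ n, MemLp (moll hR n k) 2 (cubeMeasure R) :=
    fun hk n => memLp_of_continuous R 2 (moll_continuous hR n hk)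
  have t1 := tendsto_integral_mul_of_L2 (hm hh.memf) hh.memf hf.memg (tendsto_moll hR hh.memf)
  have t2 := tendsto_integral_mul_of_L2 (a := fun n x => (1 - mollEps n) * moll hR n h' x)
    (fun n => (hm hh.memg n).const_mul _) hh.memg hf.memf (tendsto_scaled_moll hR hh.memg)
  have t3 := t1.add t2
  have hz : ∀ n, (∫ x in cube R, moll hR n h x * g x) +
      ∫ x in cube R, (1 - mollEps n) * moll hR n h' x * f x = 0 := by
    intro n
    have h1 := hf.ibp (moll hR n h) (moll_contDiff hR n hh.memf) (moll_hasCompactSupport hR n h)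
      (subset_univ _)
    have h2 : ∫ x in cube R, partialD i (moll hR n h) x * f x =
        ∫ x in cube R, (1 - mollEps n) * moll hR n h' x * f x :=
      setIntegral_congr_fun (measurableSet_cube R) fun x hx => by
        simp only [partialD_moll hR n hh hx]
    linarith
  simp only [hz] at t3
  have := tendsto_nhds_unique t3 tendsto_const_nhds
  simp only [mul_comm (g _), mul_comm (f _)]
  exact this

/-! ### The Gagliardo–Nirenberg inequality on the cube -/

/-- The quadratic polynomial t ↦ ∫ (t a + b)² is nonnegative, so its discriminant is not positive.
-/
lemma sq_integral_mul_le {α : Type*} [MeasurableSpace α] {μ : Measure α} {a b : α → ℝ}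
    (ha : MemLp a 2 μ) (hb : MemLp b 2 μ) :
    (∫ x, a x * b x ∂μ) ^ 2 ≤ (∫ x, a x ^ 2 ∂μ) * ∫ x, b x ^ 2 ∂μ := by
  have hab : Integrable (fun x => a x * b x) μ := ha.integrable_mul hb
  have h := discrim_le_zero (a := ∫ x, a x ^ 2 ∂μ) (b := 2 * ∫ x, a x * b x ∂μ)
    (c := ∫ x, b x ^ 2 ∂μ) fun t => by
      have e : (∫ x, a x ^ 2 ∂μ) * (t * t) + 2 * (∫ x, a x * b x ∂μ) * t + ∫ x, b x ^ 2 ∂μ =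
          ∫ x, (t * a x + b x) ^ 2 ∂μ := by
        have e1 : ∀ x, (t * a x + b x) ^ 2 = (t * t) * a x ^ 2 + (2 * t) * (a x * b x) + b x ^ 2 :=
          fun x => by ring
        have i1 := ha.integrable_sq.const_mul (t * t)
        have i2 := hab.const_mul (2 * t)
        have i12 : Integrable (fun x => (t * t) * a x ^ 2 + (2 * t) * (a x * b x)) μ := i1.add i2
        simp only [e1]
        rw [integral_add i12 hb.integrable_sq, integral_add i1 i2, integral_const_mul,
          integral_const_mul]
        ring
      rw [e]
      exact integral_nonneg fun x => sq_nonneg _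
  rw [discrim] at h
  nlinarith

lemma lintegral_cube_eq_pi (F : Pt → ℝ≥0∞) :
    ∫⁻ x in cube R, F x = ∫⁻ y : Fin 3 → ℝ, F (WithLp.toLp 2 y)
      ∂(Measure.pi fun _ => volume.restrict (Ioo (-R) R)) := by
  rw [← Measure.restrict_pi_pi, ← volume_pi]
  have hmp := (EuclideanSpace.volume_preserving_symm_measurableEquiv_toLp (Fin 3)).symm
  have h := hmp.setLIntegral_comp_preimage_emb (MeasurableEquiv.measurableEmbedding _) F (cube R)
  rw [← h]
  congr 2
  ext y
  simp [cube, abs_lt]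

/-- The fundamental theorem of calculus for φ⁴ between s and t, averaged over s. The average takes
the place of the vanishing at infinity in the classical Gagliardo–Nirenberg–Sobolev argument. -/
lemma pow_four_le_integral (hR : 0 < R) {φ : ℝ → ℝ} (hφ : ContDiff ℝ 1 φ) {t : ℝ}
    (ht : t ∈ Icc (-R) R) :
    φ t ^ 4 ≤ ∫ s in (-R)..R, (φ s ^ 4 / (2 * R) + 4 * |φ s| ^ 3 * |deriv φ s|) := by
  have hc := hφ.continuous
  have hd := hφ.continuous_deriv (by simp)
  have hder : ∀ s, HasDerivAt (fun s => φ s ^ 4) (4 * φ s ^ 3 * deriv φ s) s := fun s => by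
    simpa using (hφ.differentiable (by simp) s).hasDerivAt.fun_pow 4
  set D := ∫ s in (-R)..R, 4 * |φ s| ^ 3 * |deriv φ s| with hD
  have hpt : ∀ s ∈ Icc (-R) R, φ t ^ 4 ≤ φ s ^ 4 + D := by
    intro s hs
    have h1 : ∫ u in s..t, 4 * φ u ^ 3 * deriv φ u = φ t ^ 4 - φ s ^ 4 :=
      intervalIntegral.integral_eq_sub_of_hasDerivAt (fun u _ => hder u)
        (by apply Continuous.intervalIntegrable; fun_prop)
    have h2 : |∫ u in s..t, 4 * φ u ^ 3 * deriv φ u| ≤ D := by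
      rw [← Real.norm_eq_abs]
      refine (intervalIntegral.norm_integral_le_integral_norm_uIoc).trans ?_
      rw [hD, intervalIntegral.integral_of_le (by linarith)]
      have : ∀ u, ‖4 * φ u ^ 3 * deriv φ u‖ = 4 * |φ u| ^ 3 * |deriv φ u| := fun u => by
        simp
      simp only [this]
      refine setIntegral_mono_set ?_ (Eventually.of_forall fun u => by positivity) ?_
      · exact (Continuous.integrableOn_Icc (by fun_prop)).mono_set Ioc_subset_Icc_self
      · refine (LE.le.eventuallyLE ?_)
        intro u hu
        rw [uIoc, mem_Ioc] at hu
        exact ⟨lt_of_le_of_lt (le_min hs.1 ht.1) hu.1, hu.2.trans (max_le hs.2 ht.2)⟩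
    have := (abs_le.1 h2).2
    linarith
  rw [intervalIntegral.integral_add (by apply Continuous.intervalIntegrable; fun_prop)
    (by apply Continuous.intervalIntegrable; fun_prop), ← hD]
  have h3 : ∫ _ in (-R)..R, (φ t ^ 4 - D) / (2 * R) ≤ ∫ s in (-R)..R, φ s ^ 4 / (2 * R) := by
    refine intervalIntegral.integral_mono_on (by linarith) (by simp)
      (by apply Continuous.intervalIntegrable; fun_prop) fun s hs => ?_
    have := hpt s hs
    gcongr
    linarith
  rw [intervalIntegral.integral_const, smul_eq_mul] at h3
  have h4 : (R - -R) * ((φ t ^ 4 - D) / (2 * R)) = φ t ^ 4 - D := by field_simp; ring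
  linarith

/-- The integrand `|w|⁴/(2R) + 4|w|³ ∑ |∂_j w|` which controls `w⁴` along lines. -/
noncomputable def lineBound (R : ℝ) (w : Pt → ℝ) (x : Pt) : ℝ :=
  w x ^ 4 / (2 * R) + 4 * |w x| ^ 3 * ∑ j, |partialD j w x|

lemma continuous_lineBound {w : Pt → ℝ} (hw : ContDiff ℝ ∞ w) : Continuous (lineBound R w) := by
  have h0 := hw.continuous
  have h1 : ∀ j, Continuous (partialD j w) := fun j => (contDiff_partialD j hw).continuous
  unfold lineBound
  fun_prop

lemma lineBound_nonneg (hR : 0 < R) (w : Pt → ℝ) (x : Pt) : 0 ≤ lineBound R w x := by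
  unfold lineBound; positivity

/-- All three partial derivatives are kept in `lineBound` so that one and the same function serves
for the lines in every coordinate direction. -/
lemma pow_four_le_lintegral_line (hR : 0 < R) {w : Pt → ℝ} (hw : ContDiff ℝ ∞ w) (i : Fin 3)
    {y : Fin 3 → ℝ} (hy : y i ∈ Icc (-R) R) :
    ENNReal.ofReal (w (WithLp.toLp 2 y) ^ 4) ≤
      ∫⁻ t in Ioo (-R) R, ENNReal.ofReal (lineBound R w (WithLp.toLp 2 (Function.update y i t))) := by
  set φ : ℝ → ℝ := fun t => w (WithLp.toLp 2 (Function.update y i t)) with hφ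
  have haff : ∀ t, WithLp.toLp 2 (Function.update y i t) =
      (WithLp.toLp 2 (Function.update y i 0) : Pt) + t • EuclideanSpace.single i (1 : ℝ) := by
    intro t
    ext l
    by_cases hl : l = i
    · subst hl; simp
    · simp [hl]
  have hline : ∀ t, HasDerivAt (fun t => (WithLp.toLp 2 (Function.update y i t) : Pt))
      (EuclideanSpace.single i (1 : ℝ)) t := by
    intro t
    rw [funext haff]
    simpa using ((hasDerivAt_id t).smul_const (EuclideanSpace.single i (1 : ℝ) : Pt)).const_add
      (WithLp.toLp 2 (Function.update y i 0) : Pt)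
  have hcl : ContDiff ℝ ∞ (fun t => (WithLp.toLp 2 (Function.update y i t) : Pt)) := by
    rw [funext haff]
    fun_prop
  have hsm : ContDiff ℝ 1 φ := (hw.comp hcl).of_le (by simp)
  have hder : ∀ t, deriv φ t = partialD i w (WithLp.toLp 2 (Function.update y i t)) := fun t =>
    ((differentiable_of_smooth hw _).hasFDerivAt.comp_hasDerivAt t (hline t)).deriv
  have h1 := pow_four_le_integral hR hsm hy
  have hL : Continuous (fun t => lineBound R w (WithLp.toLp 2 (Function.update y i t))) :=
    (continuous_lineBound hw).comp hcl.continuous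
  have h2 : ∫ s in (-R)..R, (φ s ^ 4 / (2 * R) + 4 * |φ s| ^ 3 * |deriv φ s|) ≤
      ∫ t in (-R)..R, lineBound R w (WithLp.toLp 2 (Function.update y i t)) := by
    have hc := hsm.continuous
    have hd := hsm.continuous_deriv (by simp)
    refine intervalIntegral.integral_mono_on (by linarith)
      (by apply Continuous.intervalIntegrable; fun_prop) (hL.intervalIntegrable _ _) fun s _ => ?_
    simp only [lineBound, hder]
    gcongr
    exact Finset.single_le_sum (f := fun j => |partialD j w (WithLp.toLp 2 (Function.update y i s))|)
      (fun j _ => abs_nonneg _) (Finset.mem_univ i)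
  rw [intervalIntegral.integral_of_le (a := -R) (b := R) (f := fun t => lineBound R w _) (by linarith),
    integral_Ioc_eq_integral_Ioo] at h2
  rw [← ofReal_integral_eq_lintegral_ofReal]
  · refine ENNReal.ofReal_le_ofReal ?_
    have e : φ (y i) = w (WithLp.toLp 2 y) := by simp [hφ]
    rw [← e]
    exact h1.trans h2
  · exact (hL.integrableOn_Icc).mono_set Ioo_subset_Icc_self
  · exact Eventually.of_forall fun t => lineBound_nonneg hR w _

lemma integrable_of_continuous (R : ℝ) {w : Pt → ℝ} (hw : Continuous w) :
    Integrable w (cubeMeasure R) :=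
  (memLp_of_continuous R 1 hw).integrable le_rfl

/-- The Loomis–Whitney argument: w⁶ is the product over the three axes of (w⁴)^{1/2}, each factor is
bounded by a line integral to the power 1/(3 - 1), and `lintegral_prod_lintegral_pow_le` integrates
the product. -/
lemma sq_integral_pow_six_le (hR : 0 < R) {w : Pt → ℝ} (hw : ContDiff ℝ ∞ w) :
    (∫ x in cube R, w x ^ 6) ^ 2 ≤ (∫ x in cube R, lineBound R w x) ^ 3 := by
  have hwc := hw.continuous
  have hconj : Real.HolderConjugate (Fintype.card (Fin 3)) (3 / 2) := by
    rw [Real.holderConjugate_iff]; norm_num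
  have hlb := continuous_lineBound (R := R) hw
  have hmeas : Measurable fun y : Fin 3 → ℝ => ENNReal.ofReal (lineBound R w (WithLp.toLp 2 y)) :=
    (ENNReal.continuous_ofReal.comp (hlb.comp (PiLp.continuous_toLp 2 _))).measurable
  have h := lintegral_prod_lintegral_pow_le (fun _ : Fin 3 => volume.restrict (Ioo (-R) R)) hconj hmeas
  rw [← lintegral_cube_eq_pi (fun x => ENNReal.ofReal (lineBound R w x))] at h
  have h6 : ∫⁻ x in cube R, ENNReal.ofReal (w x ^ 6) ≤
      (∫⁻ x in cube R, ENNReal.ofReal (lineBound R w x)) ^ (3 / 2 : ℝ) := by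
    refine le_trans ?_ h
    rw [lintegral_cube_eq_pi, ← Measure.restrict_pi_pi]
    refine setLIntegral_mono' (MeasurableSet.univ_pi fun _ => measurableSet_Ioo) fun y hy => ?_
    have hle : ∀ i : Fin 3, ENNReal.ofReal (w (WithLp.toLp 2 y) ^ 4) ^ (1 / 2 : ℝ) ≤
        (∫⁻ t in Ioo (-R) R, ENNReal.ofReal
          (lineBound R w (WithLp.toLp 2 (Function.update y i t)))) ^
          ((1 : ℝ) / (Fintype.card (Fin 3) - 1 : ℝ)) := fun i => by
      have e : (1 : ℝ) / (Fintype.card (Fin 3) - 1 : ℝ) = 1 / 2 := by norm_num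
      rw [e]
      exact ENNReal.rpow_le_rpow (pow_four_le_lintegral_line hR hw i
        (Ioo_subset_Icc_self (hy i (mem_univ i)))) (by norm_num)
    refine le_trans (le_of_eq ?_) (Finset.prod_le_prod' fun i _ => hle i)
    rw [Finset.prod_const, ENNReal.ofReal_rpow_of_nonneg (by positivity) (by norm_num),
      ← ENNReal.ofReal_pow (by positivity)]
    congr 1
    have e2 : w (WithLp.toLp 2 y) ^ 4 = |w (WithLp.toLp 2 y)| ^ 4 := by
      rw [pow_abs, abs_of_nonneg (by positivity)]
    have e6 : w (WithLp.toLp 2 y) ^ 6 = |w (WithLp.toLp 2 y)| ^ 6 := by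
      rw [pow_abs, abs_of_nonneg (by positivity)]
    rw [e2, e6, ← Real.rpow_natCast, ← Real.rpow_natCast, ← Real.rpow_natCast, ← Real.rpow_mul
      (abs_nonneg _), ← Real.rpow_mul (abs_nonneg _)]
    norm_num
  have hA : ∫⁻ x in cube R, ENNReal.ofReal (lineBound R w x) =
      ENNReal.ofReal (∫ x in cube R, lineBound R w x) :=
    (ofReal_integral_eq_lintegral_ofReal (integrable_of_continuous R hlb)
      (Eventually.of_forall (lineBound_nonneg hR w))).symm
  have hB : ∫⁻ x in cube R, ENNReal.ofReal (w x ^ 6) = ENNReal.ofReal (∫ x in cube R, w x ^ 6) :=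
    (ofReal_integral_eq_lintegral_ofReal (integrable_of_continuous R (by fun_prop))
      (Eventually.of_forall fun x => by positivity)).symm
  have hA0 : 0 ≤ ∫ x in cube R, lineBound R w x := integral_nonneg (lineBound_nonneg hR w)
  have hB0 : 0 ≤ ∫ x in cube R, w x ^ 6 := integral_nonneg fun x => by positivity
  rw [hA, hB, ENNReal.ofReal_rpow_of_nonneg hA0 (by norm_num),
    ENNReal.ofReal_le_ofReal_iff (by positivity)] at h6
  calc (∫ x in cube R, w x ^ 6) ^ 2 ≤ ((∫ x in cube R, lineBound R w x) ^ (3 / 2 : ℝ)) ^ 2 := by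
        gcongr
    _ = _ := by
        rw [← Real.rpow_natCast, ← Real.rpow_mul hA0, ← Real.rpow_natCast]; norm_num

end ConvexCIP

/-! ### L⁶, L⁴ and L⁸ bounds for smooth functions on the cube. -/

namespace ConvexCIP

open Filter Topology

variable {R : ℝ} {U V : Set Pt} {i j : Fin 3} {f g f' g' : Pt → ℝ}

open scoped ENNReal

/-- The square of the `H¹` norm of a smooth function on the cube. -/
noncomputable def smoothEnergy (R : ℝ) (w : Pt → ℝ) : ℝ :=
  (∫ x in cube R, w x ^ 2) + ∑ j, ∫ x in cube R, partialD j w x ^ 2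

lemma smoothEnergy_nonneg (R : ℝ) (w : Pt → ℝ) : 0 ≤ smoothEnergy R w :=
  add_nonneg (integral_nonneg fun _ => sq_nonneg _)
    (Finset.sum_nonneg fun _ _ => integral_nonneg fun _ => sq_nonneg _)

lemma integral_sq_le_smoothEnergy (R : ℝ) (w : Pt → ℝ) :
    ∫ x in cube R, w x ^ 2 ≤ smoothEnergy R w :=
  le_add_of_nonneg_right (Finset.sum_nonneg fun _ _ => integral_nonneg fun _ => sq_nonneg _)

/-- Cauchy–Schwarz after splitting off the factor |w|³. The 96 is 2 · 4² · 3: two summands, the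
coefficient 4, three partial derivatives. -/
lemma sq_integral_lineBound_le (hR : 0 < R) {w : Pt → ℝ} (hw : ContDiff ℝ ∞ w) :
    (∫ x in cube R, lineBound R w x) ^ 2 ≤
      (∫ x in cube R, w x ^ 6) * ((1 / R ^ 2 + 96) * smoothEnergy R w) := by
  have h0 := hw.continuous
  have h1 : ∀ j, Continuous (partialD j w) := fun j => (contDiff_partialD j hw).continuous
  have hb : Continuous fun x => |w x| / (2 * R) + 4 * ∑ j, |partialD j w x| := by fun_prop
  have e1 : ∀ x, lineBound R w x = |w x| ^ 3 * (|w x| / (2 * R) + 4 * ∑ j, |partialD j w x|) := by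
    intro x
    have : w x ^ 4 = |w x| ^ 4 := by rw [pow_abs, abs_of_nonneg (by positivity)]
    rw [lineBound, this]; ring
  have e2 : ∀ x, (|w x| ^ 3) ^ 2 = w x ^ 6 := fun x => by
    rw [← pow_mul, pow_abs, abs_of_nonneg (Even.pow_nonneg (by decide) _)]
  have hcs := sq_integral_mul_le (memLp_of_continuous R 2 (w := fun x => |w x| ^ 3) (by fun_prop))
    (memLp_of_continuous R 2 hb)
  simp only [e2, ← e1] at hcs
  refine hcs.trans (mul_le_mul_of_nonneg_left ?_ (integral_nonneg fun x => by positivity))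
  have hpt : ∀ x, (|w x| / (2 * R) + 4 * ∑ j, |partialD j w x|) ^ 2 ≤
      (1 / R ^ 2 + 96) * (w x ^ 2 + ∑ j, partialD j w x ^ 2) := by
    intro x
    simp only [Fin.sum_univ_three]
    rw [← sq_abs (w x), ← sq_abs (partialD 0 w x), ← sq_abs (partialD 1 w x),
      ← sq_abs (partialD 2 w x)]
    set a := |w x|
    set b := |partialD 0 w x|
    set c := |partialD 1 w x|
    set d := |partialD 2 w x|
    have hA : (a / (2 * R)) ^ 2 = 1 / 4 * (1 / R ^ 2 * a ^ 2) := by field_simp; norm_num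
    have hp : 0 ≤ 1 / R ^ 2 * a ^ 2 := by positivity
    have hq : 0 ≤ 1 / R ^ 2 * (b ^ 2 + c ^ 2 + d ^ 2) := by positivity
    nlinarith [sq_nonneg (a / (2 * R) - 4 * (b + c + d)), sq_nonneg (b - c), sq_nonneg (c - d),
      sq_nonneg (b - d), sq_nonneg a]
  have hint : ∫ x in cube R, (1 / R ^ 2 + 96) * (w x ^ 2 + ∑ j, partialD j w x ^ 2) =
      (1 / R ^ 2 + 96) * smoothEnergy R w := by
    rw [integral_const_mul, smoothEnergy, integral_add, integral_finsetSum]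
    · exact fun j _ => integrable_of_continuous R ((h1 j).pow 2)
    · exact integrable_of_continuous R (h0.pow 2)
    · exact integrable_of_continuous R (by fun_prop)
  rw [← hint]
  exact integral_mono (integrable_of_continuous R (hb.pow 2))
    (integrable_of_continuous R (by fun_prop)) hpt

/-- The Sobolev inequality `‖w‖_{L⁶} ≤ C ‖w‖_{H¹}` on the cube. -/
lemma integral_pow_six_le (hR : 0 < R) {w : Pt → ℝ} (hw : ContDiff ℝ ∞ w) :
    ∫ x in cube R, w x ^ 6 ≤ (1 / R ^ 2 + 96) ^ 3 * smoothEnergy R w ^ 3 := by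
  set B := ∫ x in cube R, w x ^ 6
  set A := ∫ x in cube R, lineBound R w x
  set K := (1 / R ^ 2 + 96) * smoothEnergy R w with hK
  have hB0 : 0 ≤ B := integral_nonneg fun x => by positivity
  have hA0 : 0 ≤ A := integral_nonneg (lineBound_nonneg hR w)
  have hK0 : 0 ≤ K := mul_nonneg (by positivity) (smoothEnergy_nonneg R w)
  have h1 : B ^ 2 ≤ A ^ 3 := sq_integral_pow_six_le hR hw
  have h2 : A ^ 2 ≤ B * K := sq_integral_lineBound_le hR hw
  rw [← mul_pow, ← hK]
  rcases hB0.eq_or_lt with h | hpos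
  · rw [← h]; positivity
  · have h3 : B ^ 3 * B ≤ B ^ 3 * K ^ 3 := by
      calc B ^ 3 * B = (B ^ 2) ^ 2 := by ring
        _ ≤ (A ^ 3) ^ 2 := by gcongr
        _ = (A ^ 2) ^ 3 := by ring
        _ ≤ (B * K) ^ 3 := by gcongr
        _ = B ^ 3 * K ^ 3 := by ring
    exact le_of_mul_le_mul_left h3 (by positivity)

/-- The Gagliardo–Nirenberg inequality `‖w‖_{L⁴}⁴ ≤ C ‖w‖_{L²} ‖w‖_{H¹}³` for smooth functions. -/
lemma sq_integral_pow_four_le (hR : 0 < R) {w : Pt → ℝ} (hw : ContDiff ℝ ∞ w) :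
    (∫ x in cube R, w x ^ 4) ^ 2 ≤
      (∫ x in cube R, w x ^ 2) * ((1 / R ^ 2 + 96) ^ 3 * smoothEnergy R w ^ 3) := by
  have h0 := hw.continuous
  have h := sq_integral_mul_le (memLp_of_continuous R 2 h0)
    (memLp_of_continuous R 2 (w := fun x => w x ^ 3) (by fun_prop))
  have e1 : ∀ x, w x * w x ^ 3 = w x ^ 4 := fun x => by ring
  have e2 : ∀ x, (w x ^ 3) ^ 2 = w x ^ 6 := fun x => by ring
  simp only [e1, e2] at h
  exact h.trans (mul_le_mul_of_nonneg_left (integral_pow_six_le hR hw)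
    (integral_nonneg fun x => sq_nonneg _))

lemma integral_pow_four_le (hR : 0 < R) {w : Pt → ℝ} (hw : ContDiff ℝ ∞ w) :
    ∫ x in cube R, w x ^ 4 ≤ (1 / R ^ 2 + 96) ^ 3 * smoothEnergy R w ^ 2 := by
  set c := 1 / R ^ 2 + 96
  have hc : 1 ≤ c := by
    have : 0 ≤ 1 / R ^ 2 := by positivity
    show 1 ≤ 1 / R ^ 2 + 96
    linarith
  have hE := smoothEnergy_nonneg R w
  refine (sq_le_sq₀ (integral_nonneg fun x => by positivity) (by positivity)).1 ?_
  calc (∫ x in cube R, w x ^ 4) ^ 2 ≤ (∫ x in cube R, w x ^ 2) * (c ^ 3 * smoothEnergy R w ^ 3) :=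
        sq_integral_pow_four_le hR hw
    _ ≤ smoothEnergy R w * (c ^ 3 * smoothEnergy R w ^ 3) := by
        gcongr; exact integral_sq_le_smoothEnergy R w
    _ = c ^ 3 * smoothEnergy R w ^ 4 := by ring
    _ ≤ (c ^ 3) ^ 2 * smoothEnergy R w ^ 4 := by
        gcongr
        exact le_self_pow₀ (one_le_pow₀ hc) two_ne_zero
    _ = _ := by ring

/-- The L⁴ bound applied to w², whose gradient 2w∇w is in L² because w and ∇w are in L⁴. The energy
of w² is at most 1 + 3 · 4 = 13 units, and 169 = 13². -/
lemma integral_pow_eight_le (hR : 0 < R) {w : Pt → ℝ} (hw : ContDiff ℝ ∞ w) :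
    ∫ x in cube R, w x ^ 8 ≤ (1 / R ^ 2 + 96) ^ 9 * 169 *
      (smoothEnergy R w + ∑ j, smoothEnergy R (partialD j w)) ^ 4 := by
  have h0 := hw.continuous
  have h1 : ∀ j, Continuous (partialD j w) := fun j => (contDiff_partialD j hw).continuous
  set c := 1 / R ^ 2 + 96
  have hc : 0 ≤ c := by positivity
  set K := smoothEnergy R w + ∑ j, smoothEnergy R (partialD j w) with hK
  have hs : ∀ j, 0 ≤ smoothEnergy R (partialD j w) := fun j => smoothEnergy_nonneg R _
  have hK1 : smoothEnergy R w ≤ K := le_add_of_nonneg_right (Finset.sum_nonneg fun j _ => hs j)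
  have hK2 : ∀ j, smoothEnergy R (partialD j w) ≤ K := fun j =>
    (Finset.single_le_sum (f := fun j => smoothEnergy R (partialD j w)) (fun j _ => hs j)
      (Finset.mem_univ j)).trans (le_add_of_nonneg_left (smoothEnergy_nonneg R w))
  have hw4 : ∫ x in cube R, w x ^ 4 ≤ c ^ 3 * K ^ 2 :=
    (integral_pow_four_le hR hw).trans (by gcongr; exact smoothEnergy_nonneg R w)
  have hd4 : ∀ j, ∫ x in cube R, partialD j w x ^ 4 ≤ c ^ 3 * K ^ 2 := fun j =>
    (integral_pow_four_le hR (contDiff_partialD j hw)).trans (by gcongr; exacts [hs j, hK2 j])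
  have hpd : ∀ j x, partialD j (fun x => w x * w x) x ^ 2 ≤ 2 * w x ^ 4 + 2 * partialD j w x ^ 4 := by
    intro j x
    rw [partialD_mul (differentiable_of_smooth hw) (differentiable_of_smooth hw)]
    nlinarith [sq_nonneg (w x ^ 2 - partialD j w x ^ 2)]
  have hE : smoothEnergy R (fun x => w x * w x) ≤ 13 * (c ^ 3 * K ^ 2) := by
    have e : ∀ x, (w x * w x) ^ 2 = w x ^ 4 := fun x => by ring
    have hj : ∀ j, ∫ x in cube R, partialD j (fun x => w x * w x) x ^ 2 ≤ 4 * (c ^ 3 * K ^ 2) := by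
      intro j
      have i1 : Integrable (fun x => 2 * w x ^ 4) (cubeMeasure R) :=
        integrable_of_continuous R (by fun_prop)
      have i2 : Integrable (fun x => 2 * partialD j w x ^ 4) (cubeMeasure R) :=
        integrable_of_continuous R (by fun_prop)
      calc ∫ x in cube R, partialD j (fun x => w x * w x) x ^ 2
          ≤ ∫ x in cube R, (2 * w x ^ 4 + 2 * partialD j w x ^ 4) :=
            integral_mono (integrable_of_continuous R
              ((contDiff_partialD j (hw.mul hw)).continuous.pow 2)) (i1.add i2) (hpd j)
        _ = 2 * (∫ x in cube R, w x ^ 4) + 2 * ∫ x in cube R, partialD j w x ^ 4 := by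
            rw [integral_add i1 i2, integral_const_mul, integral_const_mul]
        _ ≤ 4 * (c ^ 3 * K ^ 2) := by linarith [hd4 j]
    simp only [smoothEnergy, e, Fin.sum_univ_three]
    linarith [hj 0, hj 1, hj 2]
  have h := integral_pow_four_le hR (hw.mul hw)
  have e : ∀ x, (w x * w x) ^ 4 = w x ^ 8 := fun x => by ring
  simp only [e] at h
  calc ∫ x in cube R, w x ^ 8 ≤ c ^ 3 * smoothEnergy R (fun x => w x * w x) ^ 2 := h
    _ ≤ c ^ 3 * (13 * (c ^ 3 * K ^ 2)) ^ 2 := by gcongr; exact smoothEnergy_nonneg R _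
    _ = c ^ 9 * 169 * K ^ 4 := by ring

/-! ### Passage to weakly differentiable functions -/

lemma integral_sq_moll_le (hR : 0 < R) (n : ℕ) (hf : MemLp f 2 (cubeMeasure R)) :
    ∫ x in cube R, moll hR n f x ^ 2 ≤ 9 * ∫ x in cube R, f x ^ 2 := by
  have key : ∀ {k : Pt → ℝ}, MemLp k 2 (cubeMeasure R) →
      eLpNorm k 2 (cubeMeasure R) ^ 2 = ENNReal.ofReal (∫ x in cube R, k x ^ 2) := by
    intro k hk
    rw [eLpNorm_two_sq, ofReal_integral_eq_lintegral_ofReal hk.integrable_sq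
      (Eventually.of_forall fun x => sq_nonneg _)]
    refine lintegral_congr fun x => ?_
    rw [← sq_abs, ENNReal.ofReal_pow (abs_nonneg _), Real.enorm_eq_ofReal_abs]
  have h := pow_le_pow_left' (eLpNorm_moll_le hR n hf) 2
  rw [mul_pow, key hf, key (memLp_of_continuous R 2 (moll_continuous hR n hf))] at h
  have e : (3 : ℝ≥0∞) ^ 2 = ENNReal.ofReal 9 := by norm_num
  rw [e, ← ENNReal.ofReal_mul (by norm_num), ENNReal.ofReal_le_ofReal_iff] at h
  · exact h
  · have : 0 ≤ ∫ x in cube R, f x ^ 2 := integral_nonneg fun x => sq_nonneg _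
    positivity

lemma integral_sq_scaled_moll_le (hR : 0 < R) (n : ℕ) (hf : MemLp f 2 (cubeMeasure R)) {s : ℝ}
    (hs : s ^ 2 ≤ 1) : ∫ x in cube R, (s * moll hR n f x) ^ 2 ≤ 9 * ∫ x in cube R, f x ^ 2 := by
  simp only [mul_pow]
  rw [integral_const_mul]
  have := integral_sq_moll_le hR n hf
  have h0 : 0 ≤ ∫ x in cube R, moll hR n f x ^ 2 := integral_nonneg fun x => sq_nonneg _
  nlinarith

/-- L² convergence gives a subsequence of mollifications converging almost everywhere; Fatou's lemma
applies because an even power is nonnegative. -/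
lemma integrable_pow_of_moll_bound (hR : 0 < R) (hf : MemLp f 2 (cubeMeasure R)) {m : ℕ}
    (hm : Even m) {b : ℝ} (hb : ∀ n, ∫ x in cube R, moll hR n f x ^ m ≤ b) :
    Integrable (fun x => f x ^ m) (cubeMeasure R) ∧ ∫ x in cube R, f x ^ m ≤ b := by
  have hb0 : 0 ≤ b := (integral_nonneg fun x => hm.pow_nonneg _).trans (hb 0)
  have hmeas : TendstoInMeasure (cubeMeasure R) (fun n => moll hR n f) atTop f :=
    tendstoInMeasure_of_tendsto_eLpNorm (p := 2) (by norm_num)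
      (fun n => (moll_continuous hR n hf).aestronglyMeasurable) hf.1 (tendsto_moll hR hf)
  obtain ⟨ns, -, hae⟩ := hmeas.exists_seq_tendsto_ae
  have hlin : ∫⁻ x in cube R, ENNReal.ofReal (f x ^ m) ≤ ENNReal.ofReal b := by
    calc ∫⁻ x in cube R, ENNReal.ofReal (f x ^ m)
        = ∫⁻ x in cube R, liminf (fun k => ENNReal.ofReal (moll hR (ns k) f x ^ m)) atTop := by
          refine lintegral_congr_ae ?_
          filter_upwards [hae] with x hx
          exact ((ENNReal.continuous_ofReal.tendsto _).comp (hx.pow m)).liminf_eq.symm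
      _ ≤ liminf (fun k => ∫⁻ x in cube R, ENNReal.ofReal (moll hR (ns k) f x ^ m)) atTop := by
          refine lintegral_liminf_le fun k => ?_
          exact (ENNReal.continuous_ofReal.comp ((moll_continuous hR _ hf).pow m)).measurable
      _ ≤ liminf (fun _ : ℕ => ENNReal.ofReal b) atTop := by
          refine liminf_le_liminf (Eventually.of_forall fun k => ?_)
          rw [← ofReal_integral_eq_lintegral_ofReal
            (integrable_of_continuous R (w := fun x => moll hR (ns k) f x ^ m)
              ((moll_continuous hR _ hf).pow m))
            (Eventually.of_forall fun x => hm.pow_nonneg _)]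
          exact ENNReal.ofReal_le_ofReal (hb _)
      _ = ENNReal.ofReal b := by simp
  have hint : Integrable (fun x => f x ^ m) (cubeMeasure R) := by
    refine ⟨hf.1.pow m, ?_⟩
    rw [hasFiniteIntegral_iff_ofReal (Eventually.of_forall fun x => hm.pow_nonneg _)]
    exact hlin.trans_lt ENNReal.ofReal_lt_top
  refine ⟨hint, ?_⟩
  rw [← ofReal_integral_eq_lintegral_ofReal hint (Eventually.of_forall fun x => hm.pow_nonneg _),
    ENNReal.ofReal_le_ofReal_iff hb0] at hlin
  exact hlin

lemma scale_sq_le_one (n : ℕ) : (1 - mollEps n) ^ 2 ≤ 1 := by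
  have h1 := mollEps_pos n
  have h2 := mollEps_le n
  nlinarith

/-- The square of the `H¹` norm of a function with weak gradient `(f₀, f₁, f₂)`. -/
noncomputable def weakEnergy (R : ℝ) (f : Pt → ℝ) (df : Fin 3 → Pt → ℝ) : ℝ :=
  (∫ x in cube R, f x ^ 2) + ∑ j, ∫ x in cube R, df j x ^ 2

lemma weakEnergy_nonneg (R : ℝ) (f : Pt → ℝ) (df : Fin 3 → Pt → ℝ) : 0 ≤ weakEnergy R f df :=
  add_nonneg (integral_nonneg fun _ => sq_nonneg _)
    (Finset.sum_nonneg fun _ _ => integral_nonneg fun _ => sq_nonneg _)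

/-- The 9 is the square of the L² operator bound 3; the dilation factor in the gradient only helps.
-/
lemma smoothEnergy_moll_le (hR : 0 < R) (n : ℕ) {df : Fin 3 → Pt → ℝ}
    (h : ∀ j, HasWD R (cube R) j f (df j)) :
    smoothEnergy R (moll hR n f) ≤ 9 * weakEnergy R f df := by
  rw [smoothEnergy, weakEnergy, mul_add, Finset.mul_sum]
  refine add_le_add (integral_sq_moll_le hR n (h 0).memf) (Finset.sum_le_sum fun j _ => ?_)
  have e : ∫ x in cube R, partialD j (moll hR n f) x ^ 2 =
      ∫ x in cube R, ((1 - mollEps n) * moll hR n (df j) x) ^ 2 :=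
    setIntegral_congr_fun (measurableSet_cube R) fun x hx => by
      simp only [partialD_moll hR n (h j) hx]
  rw [e]
  exact integral_sq_scaled_moll_le hR n (h j).memg (scale_sq_le_one n)

lemma partialD_congr_on_cube {φ ψ : Pt → ℝ} (h : ∀ x ∈ cube R, φ x = ψ x) (i : Fin 3) {x : Pt}
    (hx : x ∈ cube R) : partialD i φ x = partialD i ψ x := by
  have : φ =ᶠ[𝓝 x] ψ := by
    filter_upwards [(isOpen_cube R).mem_nhds hx] with y hy using h y hy
  simp only [partialD, this.fderiv_eq]

lemma smoothEnergy_partialD_moll_le (hR : 0 < R) (n : ℕ) {df : Fin 3 → Pt → ℝ}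
    {ddf : Fin 3 → Fin 3 → Pt → ℝ} (h : ∀ j, HasWD R (cube R) j f (df j))
    (h2 : ∀ j l, HasWD R (cube R) l (df j) (ddf j l)) (j : Fin 3) :
    smoothEnergy R (partialD j (moll hR n f)) ≤ 9 * weakEnergy R (df j) (ddf j) := by
  have e0 : ∀ x ∈ cube R, partialD j (moll hR n f) x = (1 - mollEps n) * moll hR n (df j) x :=
    fun x hx => partialD_moll hR n (h j) hx
  have e1 : ∀ l, ∀ x ∈ cube R, partialD l (partialD j (moll hR n f)) x =
      (1 - mollEps n) ^ 2 * moll hR n (ddf j l) x := by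
    intro l x hx
    rw [partialD_congr_on_cube e0 l hx, partialD_mul (differentiable_const _)
      (differentiable_of_smooth (moll_contDiff hR n (h j).memg)), partialD_moll hR n (h2 j l) hx]
    simp [partialD]
    ring
  rw [smoothEnergy, weakEnergy, mul_add, Finset.mul_sum]
  refine add_le_add ?_ (Finset.sum_le_sum fun l _ => ?_)
  · rw [setIntegral_congr_fun (g := fun x => ((1 - mollEps n) * moll hR n (df j) x) ^ 2)
      (measurableSet_cube R) fun x hx => by simp only [e0 x hx]]
    exact integral_sq_scaled_moll_le hR n (h j).memg (scale_sq_le_one n)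
  · rw [setIntegral_congr_fun (g := fun x => ((1 - mollEps n) ^ 2 * moll hR n (ddf j l) x) ^ 2)
      (measurableSet_cube R) fun x hx => by simp only [e1 l x hx]]
    refine integral_sq_scaled_moll_le hR n (h2 j l).memg ?_
    exact pow_le_one₀ (by positivity) (scale_sq_le_one n)

/-- The Gagliardo–Nirenberg inequality `‖f‖_{L⁴}⁴ ≤ C ‖f‖_{L²} ‖f‖_{H¹}³` on the cube. -/
lemma exists_gagliardoNirenberg_four (hR : 0 < R) : ∃ C, 0 < C ∧
    ∀ (f : Pt → ℝ) (df : Fin 3 → Pt → ℝ), (∀ j, HasWD R (cube R) j f (df j)) →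
      Integrable (fun x => f x ^ 4) (cubeMeasure R) ∧
      (∫ x in cube R, f x ^ 4) ^ 2 ≤ C * (∫ x in cube R, f x ^ 2) * weakEnergy R f df ^ 3 := by
  refine ⟨9 ^ 4 * (1 / R ^ 2 + 96) ^ 3, by positivity, fun f df h => ?_⟩
  set c := 1 / R ^ 2 + 96
  have hE := weakEnergy_nonneg R f df
  have hI : 0 ≤ ∫ x in cube R, f x ^ 2 := integral_nonneg fun x => sq_nonneg _
  set b := Real.sqrt (9 ^ 4 * c ^ 3 * (∫ x in cube R, f x ^ 2) * weakEnergy R f df ^ 3) with hbdef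
  have hb : ∀ n, ∫ x in cube R, moll hR n f x ^ 4 ≤ b := by
    intro n
    refine Real.le_sqrt_of_sq_le ((sq_integral_pow_four_le hR (moll_contDiff hR n (h 0).memf)).trans ?_)
    calc _ ≤ (9 * ∫ x in cube R, f x ^ 2) * (c ^ 3 * (9 * weakEnergy R f df) ^ 3) := by
          have := smoothEnergy_nonneg R (moll hR n f)
          gcongr
          · exact integral_sq_moll_le hR n (h 0).memf
          · exact smoothEnergy_moll_le hR n h
      _ = _ := by ring
  obtain ⟨h1, h2⟩ := integrable_pow_of_moll_bound hR (h 0).memf (by decide) hb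
  refine ⟨h1, ?_⟩
  calc (∫ x in cube R, f x ^ 4) ^ 2 ≤ b ^ 2 := by
        gcongr
    _ = _ := by rw [hbdef, Real.sq_sqrt (by positivity)]

/-- The embedding `H²(Ω) ⊂ L⁸(Ω)`. -/
lemma exists_sobolev_eight (hR : 0 < R) : ∃ C, 0 < C ∧
    ∀ (f : Pt → ℝ) (df : Fin 3 → Pt → ℝ) (ddf : Fin 3 → Fin 3 → Pt → ℝ),
      (∀ j, HasWD R (cube R) j f (df j)) → (∀ j l, HasWD R (cube R) l (df j) (ddf j l)) →
      Integrable (fun x => f x ^ 8) (cubeMeasure R) ∧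
      ∫ x in cube R, f x ^ 8 ≤ C * (weakEnergy R f df + ∑ j, weakEnergy R (df j) (ddf j)) ^ 4 := by
  refine ⟨(1 / R ^ 2 + 96) ^ 9 * 169 * 9 ^ 4, by positivity, fun f df ddf h h2 => ?_⟩
  set c := 1 / R ^ 2 + 96
  refine integrable_pow_of_moll_bound hR (h 0).memf (by decide) fun n => ?_
  refine (integral_pow_eight_le hR (moll_contDiff hR n (h 0).memf)).trans ?_
  have e : c ^ 9 * 169 * 9 ^ 4 * (weakEnergy R f df + ∑ j, weakEnergy R (df j) (ddf j)) ^ 4 =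
      c ^ 9 * 169 * (9 * weakEnergy R f df + ∑ j, 9 * weakEnergy R (df j) (ddf j)) ^ 4 := by
    rw [← Finset.mul_sum]; ring
  rw [e]
  have h0 : 0 ≤ smoothEnergy R (moll hR n f) + ∑ j, smoothEnergy R (partialD j (moll hR n f)) :=
    add_nonneg (smoothEnergy_nonneg R _) (Finset.sum_nonneg fun j _ => smoothEnergy_nonneg R _)
  gcongr with j
  · exact smoothEnergy_moll_le hR n h
  · exact smoothEnergy_partialD_moll_le hR n h h2 j

end ConvexCIP

namespace ConvexCIP

open Filter Topology

variable {R : ℝ} {U V : Set Pt} {i j : Fin 3} {f g f' g' : Pt → ℝ}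

/-! ### The Carleman estimate -/

/-- `f` is integrable on the cube with integral `a`. -/
def HasInt (R : ℝ) (f : Pt → ℝ) (a : ℝ) : Prop :=
  Integrable f (cubeMeasure R) ∧ ∫ x in cube R, f x = a

lemma HasInt.add {a b : ℝ} (hf : HasInt R f a) (hg : HasInt R g b) :
    HasInt R (fun x => f x + g x) (a + b) :=
  ⟨hf.1.add hg.1, by rw [integral_add hf.1 hg.1, hf.2, hg.2]⟩

lemma HasInt.const_mul {a : ℝ} (c : ℝ) (hf : HasInt R f a) :
    HasInt R (fun x => c * f x) (c * a) :=
  ⟨hf.1.const_mul c, by rw [integral_const_mul, hf.2]⟩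

lemma HasInt.le {a b : ℝ} (hf : HasInt R f a) (hg : HasInt R g b)
    (h : ∀ x ∈ cube R, f x ≤ g x) : a ≤ b := by
  rw [← hf.2, ← hg.2]
  exact setIntegral_mono_on hf.1 hg.1 (measurableSet_cube R) h

lemma HasInt.eq {a b : ℝ} (hf : HasInt R f a) (hg : HasInt R g b)
    (h : ∀ x ∈ cube R, f x = g x) : a = b :=
  le_antisymm (hf.le hg fun x hx => (h x hx).le) (hg.le hf fun x hx => (h x hx).ge)

lemma Integrable.hasInt (hf : Integrable f (cubeMeasure R)) :
    HasInt R f (∫ x in cube R, f x) := ⟨hf, rfl⟩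

lemma integrable_weighted_mul {ρ : Pt → ℝ} (hρ : Continuous ρ) (hf : MemLp f 2 (cubeMeasure R))
    (hg : MemLp g 2 (cubeMeasure R)) : Integrable (fun x => ρ x * f x * g x) (cubeMeasure R) :=
  integrable_mul_L2 (f := fun x => ρ x * f x) (memLp_continuous_mul hρ hf) hg

/-- Weighted integration by parts. -/
lemma HasWD.weighted_ibp (hR : 0 < R) {h h' ρ : Pt → ℝ} (hf : HasWD R univ i f g)
    (hh : HasWD R (cube R) i h h') (hρ : ContDiff ℝ ∞ ρ) :
    (∫ x in cube R, ρ x * g x * h x) + (∫ x in cube R, ρ x * f x * h' x) +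
      ∫ x in cube R, partialD i ρ x * f x * h x = 0 := by
  have h1 := hf.integral_mul_add hR (hh.smooth_mul hρ)
  have i1 := integrable_weighted_mul hρ.continuous hf.memf hh.memg
  have i2 := integrable_weighted_mul (contDiff_partialD i hρ).continuous hf.memf hh.memf
  have e1 : ∀ x, g x * (ρ x * h x) = ρ x * g x * h x := fun x => by ring
  have e2 : ∀ x, f x * (ρ x * h' x + partialD i ρ x * h x) =
      ρ x * f x * h' x + partialD i ρ x * f x * h x := fun x => by ring
  simp only [e1, e2] at h1
  rw [integral_add i1 i2] at h1
  linarith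

/-- A function in `H³(Ω)` with zero boundary values and zero normal derivative on the lower face,
given by its weak derivatives. -/
structure DirichletData (R : ℝ) (u : Pt → ℝ) (du : Fin 3 → Pt → ℝ)
    (ddu : Fin 3 → Fin 3 → Pt → ℝ) : Prop where
  zero : ∀ i, HasWD R univ i u (du i)
  second : ∀ i j, HasWD R (cube R) j (du i) (ddu i j)
  third : ∀ i j l, ∃ g, HasWD R (cube R) l (ddu i j) g
  symm : ∀ i j, ddu i j = ddu j i
  lower : HasWD R {x | (1 : ℝ) * x 2 < R} 2 (du 2) (ddu 2 2)

namespace DirichletData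

variable {u : Pt → ℝ} {du : Fin 3 → Pt → ℝ} {ddu : Fin 3 → Fin 3 → Pt → ℝ}

lemma first (h : DirichletData R u du ddu) (i : Fin 3) : HasWD R (cube R) i u (du i) :=
  (h.zero i).mono (subset_univ _)

lemma memLp (h : DirichletData R u du ddu) : MemLp u 2 (cubeMeasure R) := (h.zero 0).memf

lemma memLp_first (h : DirichletData R u du ddu) (i : Fin 3) : MemLp (du i) 2 (cubeMeasure R) :=
  (h.zero i).memg

lemma memLp_second (h : DirichletData R u du ddu) (i j : Fin 3) :
    MemLp (ddu i j) 2 (cubeMeasure R) := (h.second i j).memg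

/-- On a face orthogonal to the j-th axis ∂_i is tangential, so ∂_i u inherits the zero boundary
values of u there. -/
lemma zero_first (h : DirichletData R u du ddu) (hij : i ≠ j) :
    HasWD R univ j (du i) (ddu i j) := by
  rw [h.symm]
  exact (h.zero j).tangential hij.symm (h.first i) (h.second j i)

/-- Multiplication by a smooth function preserves the boundary conditions. -/
lemma smooth_mul {w : Pt → ℝ} (hw : ContDiff ℝ ∞ w) (h : DirichletData R u du ddu) :
    DirichletData R (fun x => w x * u x) (fun i x => w x * du i x + partialD i w x * u x)
      (fun i j x => (w x * ddu i j x + partialD j w x * du i x) +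
        (partialD i w x * du j x + partialD j (partialD i w) x * u x)) where
  zero i := (h.zero i).smooth_mul hw
  second i j := ((h.second i j).smooth_mul hw).add
    ((h.first j).smooth_mul (contDiff_partialD i hw))
  third i j l := by
    obtain ⟨g, hg⟩ := h.third i j l
    exact ⟨_, ((hg.smooth_mul hw).add ((h.second i l).smooth_mul (contDiff_partialD j hw))).add
      (((h.second j l).smooth_mul (contDiff_partialD i hw)).add
        ((h.first l).smooth_mul (contDiff_partialD j (contDiff_partialD i hw))))⟩
  symm i j := by
    funext x
    rw [h.symm i j, partialD_comm hw i j]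
    ring
  lower := (h.lower.smooth_mul hw).add
    (((h.zero 2).mono (subset_univ _)).smooth_mul (contDiff_partialD 2 hw))

/-- Two integrations by parts through the third derivative ∂_i∂_i∂_j u, which is where membership in
H³ rather than H² enters. No boundary terms appear: ∂_i∂_i u vanishes on the j-faces and ∂_j u on
the i-faces. -/
lemma integral_second_mul (hR : 0 < R) (h : DirichletData R u du ddu) (hij : i ≠ j) :
    ∫ x in cube R, ddu i i x * ddu j j x = ∫ x in cube R, ddu i j x ^ 2 := by
  obtain ⟨g, hg⟩ := h.third j i i
  have h1 : HasWD R univ j (ddu i i) g := by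
    refine (h.zero_first hij).tangential hij.symm (h.second i i) ?_
    rw [h.symm]; exact hg
  have e1 := h1.integral_mul_add hR (h.second j j)
  have e2 := (h.zero_first hij.symm).integral_mul_add hR hg
  have e3 : ∀ x, ddu j i x * ddu j i x = ddu i j x ^ 2 := fun x => by rw [h.symm i j]; ring
  simp only [e3] at e2
  have e4 : ∫ x in cube R, g x * du j x = ∫ x in cube R, du j x * g x := by simp only [mul_comm]
  linarith

/-- Expanding the square, each mixed product is exchanged for a squared mixed derivative. On a box
with zero Dirichlet data this is an identity, so no elliptic regularity at edges or corners is
needed. -/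
lemma integral_sq_laplacian (hR : 0 < R) (h : DirichletData R u du ddu) :
    ∫ x in cube R, (∑ i, ddu i i x) ^ 2 = ∑ i, ∑ j, ∫ x in cube R, ddu i j x ^ 2 := by
  have hs : ∀ i j, HasInt R (fun x => ddu i i x * ddu j j x)
      (∫ x in cube R, ddu i j x ^ 2) := by
    intro i j
    refine ⟨integrable_mul_L2 (h.memLp_second i i) (h.memLp_second j j), ?_⟩
    by_cases hij : i = j
    · subst hij
      simp only [pow_two]
    · exact h.integral_second_mul hR hij
  have e : (fun x => (∑ i, ddu i i x) ^ 2) = fun x => ∑ i, ∑ j, ddu i i x * ddu j j x := by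
    funext x
    rw [pow_two, Finset.sum_mul_sum]
  rw [e, integral_finsetSum _ fun i _ => integrable_finsetSum _ fun j _ => (hs i j).1]
  refine Finset.sum_congr rfl fun i _ => ?_
  rw [integral_finsetSum _ fun j _ => (hs i j).1]
  exact Finset.sum_congr rfl fun j _ => (hs i j).2

end DirichletData

lemma contDiff_coord_sub (r : ℝ) : ContDiff ℝ ∞ (fun x : Pt => x 2 - r) := by fun_prop

lemma partialD_comp_coord {χ : ℝ → ℝ} (hχ : Differentiable ℝ χ) (l i : Fin 3) (x : Pt) :
    partialD i (fun y : Pt => χ (y l)) x = if i = l then deriv χ (x l) else 0 := by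
  simpa using partialD_coord hχ 1 l i x

lemma partialD_coord_sub (r : ℝ) (i : Fin 3) (x : Pt) :
    partialD i (fun x : Pt => x 2 - r) x = if i = 2 then 1 else 0 := by
  have := partialD_comp_coord (χ := fun t => t - r) (by fun_prop) 2 i x
  rw [this]
  simp

/-- The boundary term on the upper face has a favourable sign. -/
lemma integral_lower_face_le (hR : 0 < R) {r : ℝ} (hr : R < r)
    (h : HasWD R {x | (1 : ℝ) * x 2 < R} 2 f g) :
    2 * (∫ x in cube R, (x 2 - r) * f x * g x) + ∫ x in cube R, f x ^ 2 ≤ 0 := by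
  have hcube : HasWD R (cube R) 2 f g := h.mono fun x hx => lt_of_mem_cube (Or.inl rfl) hx 2
  have hsc : Continuous fun x : Pt => x 2 - r := (contDiff_coord_sub r).continuous
  have i1 : Integrable (fun x => (x 2 - r) * f x * g x) (cubeMeasure R) :=
    integrable_weighted_mul hsc h.memf h.memg
  have i2 := h.memf.integrable_sq
  have i3 : Integrable (fun x => 2 * ((x 2 - r) * f x * g x) + f x ^ 2) (cubeMeasure R) :=
    (i1.const_mul 2).add i2
  have t := tendsto_integral_cutoff_mul i3
    (c := fun n x => faceCutoff R n (1 * x 2)) (fun n => (coordCutoff_contDiff R 1 n 2).continuous)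
    (fun n x => coordCutoff_abs_le R 1 n 2 x) (fun x hx => coordCutoff_tendsto (Or.inl rfl) hx 2)
  rw [← integral_const_mul, ← integral_add (i1.const_mul 2) i2]
  refine le_of_tendsto t ?_
  filter_upwards [eventually_gt_atTop 0] with n hn
  have hχ := coordCutoff_contDiff R 1 n 2
  have hχc := hχ.continuous
  have hdc := (contDiff_partialD 2 hχ).continuous
  -- The function need not vanish on the upper face; multiplied by the cutoff it does, and it can
  -- then be tested by anything.
  have h1 : HasWD R univ 2 _ _ :=
    h.smooth_mul' hχ (inter_subset_right.trans (tsupport_coordCutoff R 1 hn 2))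
  have h2 := h1.weighted_ibp hR hcube (contDiff_coord_sub r)
  simp only [partialD_coord_sub, if_true, one_mul] at h2
  have i4 : Integrable (fun x => (x 2 - r) * partialD 2 (fun x : Pt => faceCutoff R n (1 * x 2)) x *
      f x * f x) (cubeMeasure R) :=
    integrable_weighted_mul (ρ := fun x => (x 2 - r) *
      partialD 2 (fun x : Pt => faceCutoff R n (1 * x 2)) x) (hsc.mul hdc) h.memf h.memf
  -- The cutoff decreases in z and z - r is negative on the cube, so the upper boundary layer
  -- contributes a nonnegative amount and can be dropped before the limit.
  have hnn : 0 ≤ ∫ x in cube R, (x 2 - r) * partialD 2 (fun x : Pt => faceCutoff R n (1 * x 2)) x *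
      f x * f x := by
    refine setIntegral_nonneg (measurableSet_cube R) fun x hx => ?_
    rw [partialD_coord ((faceCutoff_contDiff R n).differentiable (by simp)), if_pos rfl, mul_assoc]
    have hx2 := (abs_lt.1 (hx 2)).2
    have hd : deriv (faceCutoff R n) (1 * x 2) ≤ 0 := (faceCutoff_antitone R n).deriv_nonpos
    refine mul_nonneg (mul_nonneg_of_nonpos_of_nonpos (by linarith) (by linarith))
      (mul_self_nonneg _)
  have i5 : Integrable (fun x => faceCutoff R n (1 * x 2) *
      (2 * ((x 2 - r) * f x * g x) + f x ^ 2)) (cubeMeasure R) :=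
    i3.bdd_mul (c := 1) hχc.aestronglyMeasurable
      (Eventually.of_forall fun x => coordCutoff_abs_le R 1 n 2 x)
  have m1 := memLp_continuous_mul hχc h.memf
  have m2 := memLp_continuous_mul hχc h.memg
  have m3 := memLp_continuous_mul hdc h.memf
  have j1 := integrable_weighted_mul hsc (m2.add m3) h.memf
  have j2 := integrable_weighted_mul hsc m1 h.memg
  have j3 := integrable_mul_L2 m1 h.memf
  simp only [Pi.add_apply] at j1
  simp only [one_mul] at *
  have h3 := ((Integrable.hasInt j1).add (Integrable.hasInt j2)).add (Integrable.hasInt j3)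
  have h4 := (Integrable.hasInt i5).add (Integrable.hasInt i4)
  have h5 := h4.eq h3 fun x _ => by ring
  linarith

end ConvexCIP

/-! ### The Carleman inequality for the conjugated Laplacian. -/

namespace ConvexCIP

open Filter Topology

variable {R : ℝ} {U V : Set Pt} {i j : Fin 3} {f g f' g' : Pt → ℝ}

namespace DirichletData

variable {v : Pt → ℝ} {dv : Fin 3 → Pt → ℝ} {ddv : Fin 3 → Fin 3 → Pt → ℝ}

/-- The conjugated Laplacian `e^{λs²} Δ (e^{-λs²} v)`, `s = z - r`. -/
def conjLaplacian (lam r : ℝ) (v : Pt → ℝ) (dv : Fin 3 → Pt → ℝ) (ddv : Fin 3 → Fin 3 → Pt → ℝ)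
    (x : Pt) : ℝ :=
  (∑ i, ddv i i x) - 4 * lam * (x 2 - r) * dv 2 x + (4 * lam ^ 2 * (x 2 - r) ^ 2 - 2 * lam) * v x

lemma memLp_conjLaplacian (h : DirichletData R v dv ddv) (lam r : ℝ) :
    MemLp (conjLaplacian lam r v dv ddv) 2 (cubeMeasure R) := by
  refine MemLp.add (MemLp.sub (memLp_finsetSum _ fun i _ => h.memLp_second i i) ?_) ?_
  · exact memLp_continuous_mul (by fun_prop) (h.memLp_first 2)
  · exact memLp_continuous_mul (by fun_prop) h.memLp

/-- Integrates 2 v ∂_z v = ∂_z(v²) against ρ(z); v vanishes on both horizontal faces. -/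
lemma integral_mul_vertical (hR : 0 < R) (h : DirichletData R v dv ddv) {ρ : ℝ → ℝ}
    (hρ : ContDiff ℝ ∞ ρ) :
    2 * ∫ x in cube R, ρ (x 2) * v x * dv 2 x = -∫ x in cube R, deriv ρ (x 2) * v x * v x := by
  have hs : ContDiff ℝ ∞ (fun x : Pt => ρ (x 2)) := hρ.comp (by fun_prop)
  have h1 := (h.zero 2).weighted_ibp hR (h.first 2) hs
  simp only [partialD_comp_coord (hρ.differentiable (by simp)), if_true] at h1
  have e : ∫ x in cube R, ρ (x 2) * dv 2 x * v x = ∫ x in cube R, ρ (x 2) * v x * dv 2 x := by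
    congr 1; funext x; ring
  linarith

lemma integral_mul_second (hR : 0 < R) (h : DirichletData R v dv ddv) (i : Fin 3) :
    ∫ x in cube R, v x * ddv i i x = -∫ x in cube R, dv i x ^ 2 := by
  have h1 := (h.zero i).integral_mul_add hR (h.second i i)
  simp only [← pow_two] at h1
  linarith

/-- Moving ∂_i and then ∂_z produces s ∂_iv ∂_i∂_zv, half the z-derivative of (∂_iv)² times s. This
uses ∂_zv = 0 on the i-faces and ∂_iv = 0 on the z-faces. -/
lemma integral_vertical_mul_second (hR : 0 < R) (r : ℝ) (h : DirichletData R v dv ddv)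
    (hi : i ≠ 2) :
    2 * ∫ x in cube R, (x 2 - r) * dv 2 x * ddv i i x = ∫ x in cube R, dv i x ^ 2 := by
  have h1 := (h.zero_first (i := 2) (j := i) hi.symm).weighted_ibp hR (h.second i i)
    (contDiff_coord_sub r)
  have h2 := (h.zero_first (i := i) (j := 2) hi).weighted_ibp hR (h.second i 2)
    (contDiff_coord_sub r)
  simp only [partialD_coord_sub, if_neg hi, if_true, zero_mul, one_mul, integral_zero,
    add_zero] at h1 h2
  rw [h.symm 2 i] at h1
  have e : ∫ x in cube R, (x 2 - r) * dv i x * ddv i 2 x =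
      ∫ x in cube R, (x 2 - r) * ddv i 2 x * dv i x := by
    congr 1; funext x; ring
  have e2 : ∫ x in cube R, dv i x * dv i x = ∫ x in cube R, dv i x ^ 2 := by simp only [pow_two]
  linarith

/-- The basic Carleman inequality, before absorbing the lower-order term. -/
lemma carleman_aux (hR : 0 < R) {r lam : ℝ} (hr : R < r) (hlam : 0 < lam)
    (h : DirichletData R v dv ddv) :
    4 * lam * (∑ i, ∫ x in cube R, dv i x ^ 2) +
      ∫ x in cube R, (16 * lam ^ 3 * (x 2 - r) ^ 2 - 24 * lam ^ 2) * v x * v x ≤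
      2 * ∫ x in cube R, conjLaplacian lam r v dv ddv x ^ 2 := by
  have hs : Continuous fun x : Pt => x 2 - r := (contDiff_coord_sub r).continuous
  have hX := Integrable.hasInt (h.memLp_conjLaplacian lam r).integrable_sq
  have hA : ∀ i, HasInt R _ _ := fun i =>
    Integrable.hasInt (integrable_weighted_mul hs (h.memLp_first 2) (h.memLp_second i i))
  have hD : ∀ i, HasInt R _ _ := fun i =>
    Integrable.hasInt (integrable_mul_L2 h.memLp (h.memLp_second i i))
  have hB : HasInt R _ _ := Integrable.hasInt (integrable_weighted_mul
    (ρ := fun x : Pt => -32 * lam ^ 3 * (x 2 - r) ^ 3 + 48 * lam ^ 2 * (x 2 - r))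
    (by fun_prop) h.memLp (h.memLp_first 2))
  have hG : HasInt R _ _ := Integrable.hasInt (integrable_weighted_mul
    (ρ := fun x : Pt => (x 2 - r) ^ 2) (by fun_prop) h.memLp h.memLp)
  have hF : HasInt R _ _ := Integrable.hasInt (h.memLp.integrable_sq)
  have eB := h.integral_mul_vertical hR
    (ρ := fun t => -32 * lam ^ 3 * (t - r) ^ 3 + 48 * lam ^ 2 * (t - r)) (by fun_prop)
  have hder : ∀ t, deriv (fun t => -32 * lam ^ 3 * (t - r) ^ 3 + 48 * lam ^ 2 * (t - r)) t =
      -96 * lam ^ 3 * (t - r) ^ 2 + 48 * lam ^ 2 := by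
    intro t
    have h1 : HasDerivAt (fun t => t - r) 1 t := (hasDerivAt_id t).sub_const r
    have h2 := ((h1.fun_pow 3).const_mul (-32 * lam ^ 3)).add (h1.const_mul (48 * lam ^ 2))
    have h3 : deriv (fun t => -32 * lam ^ 3 * (t - r) ^ 3 + 48 * lam ^ 2 * (t - r)) t = _ := h2.deriv
    rw [h3]
    push_cast
    ring
  simp only [hder] at eB
  have hB' : HasInt R _ _ := Integrable.hasInt (integrable_weighted_mul
    (ρ := fun x : Pt => -96 * lam ^ 3 * (x 2 - r) ^ 2 + 48 * lam ^ 2) (by fun_prop) h.memLp h.memLp)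
  have eB' := hB'.eq ((hG.const_mul (-96 * lam ^ 3)).add (hF.const_mul (48 * lam ^ 2)))
    fun x _ => by ring
  have hT : HasInt R _ _ := Integrable.hasInt (integrable_weighted_mul
    (ρ := fun x : Pt => 16 * lam ^ 3 * (x 2 - r) ^ 2 - 24 * lam ^ 2) (by fun_prop) h.memLp h.memLp)
  have eT := hT.eq ((hG.const_mul (16 * lam ^ 3)).add (hF.const_mul (-24 * lam ^ 2)))
    fun x _ => by ring
  have eA0 := h.integral_vertical_mul_second hR r (i := 0) (by decide)
  have eA1 := h.integral_vertical_mul_second hR r (i := 1) (by decide)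
  have eA2 := integral_lower_face_le hR hr h.lower
  have eD : ∀ i, _ := fun i => h.integral_mul_second hR i
  -- Write the conjugated Laplacian as P = a - b with a = Δv + (4λ²s² - 2λ)v and b = 4λs∂_zv. The
  -- left integrand is -2ab - 8λvP, and it equals 2P² + 16λ²v² - a² - b² - (P + 4λv)². The product
  -- -2ab alone yields (∂_xv)² and (∂_yv)² with the coefficient -4λ; the extra multiplier -8λv
  -- contributes 8λ|∇v|² and restores the sign.
  have main := HasInt.le
    ((((((hA 0).add (hA 1)).add (hA 2)).const_mul (-8 * lam)).add hB).add
      (((((hD 0).add (hD 1)).add (hD 2)).const_mul (-8 * lam)).add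
        ((hG.const_mul (-32 * lam ^ 3)).add (hF.const_mul (16 * lam ^ 2)))))
    ((hX.const_mul 2).add (hF.const_mul (16 * lam ^ 2))) (fun x _ => by
      simp only [conjLaplacian, Fin.sum_univ_three]
      set L := ddv 0 0 x + ddv 1 1 x + ddv 2 2 x with hL
      set s := x 2 - r
      set P := L - 4 * lam * s * dv 2 x + (4 * lam ^ 2 * s ^ 2 - 2 * lam) * v x with hP
      have q1 := sq_nonneg (L + (4 * lam ^ 2 * s ^ 2 - 2 * lam) * v x)
      have q2 := sq_nonneg (4 * lam * s * dv 2 x)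
      have q3 := sq_nonneg (P + 4 * lam * v x)
      have key : -8 * lam * (s * dv 2 x * ddv 0 0 x + s * dv 2 x * ddv 1 1 x + s * dv 2 x * ddv 2 2 x)
          + (-32 * lam ^ 3 * s ^ 3 + 48 * lam ^ 2 * s) * v x * dv 2 x +
          (-8 * lam * (v x * ddv 0 0 x + v x * ddv 1 1 x + v x * ddv 2 2 x) +
          (-32 * lam ^ 3 * (s ^ 2 * v x * v x) + 16 * lam ^ 2 * v x ^ 2)) =
          2 * P ^ 2 + 16 * lam ^ 2 * v x ^ 2 - (L + (4 * lam ^ 2 * s ^ 2 - 2 * lam) * v x) ^ 2 -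
          (4 * lam * s * dv 2 x) ^ 2 - (P + 4 * lam * v x) ^ 2 := by
        rw [hP, hL]; ring
      rw [key]
      linarith)
  rw [eT]
  simp only [Fin.sum_univ_three]
  have eD0 := eD 0
  have eD1 := eD 1
  have eD2 := eD 2
  have q : lam * (2 * (∫ x in cube R, (x 2 - r) * dv 2 x * ddv 2 2 x) +
      ∫ x in cube R, dv 2 x ^ 2) ≤ 0 := mul_nonpos_of_nonneg_of_nonpos hlam.le eA2
  have eA0' : ∫ x in cube R, (x 2 - r) * dv 2 x * ddv 0 0 x = (∫ x in cube R, dv 0 x ^ 2) / 2 := by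
    linarith
  have eA1' : ∫ x in cube R, (x 2 - r) * dv 2 x * ddv 1 1 x = (∫ x in cube R, dv 1 x ^ 2) / 2 := by
    linarith
  rw [eD0, eD1, eD2, eA0', eA1'] at main
  -- The vertical derivative arrives with coefficient 12λ, the horizontal ones with 4λ; the surplus
  -- is discarded.
  have hE2 : 0 ≤ lam * ∫ x in cube R, dv 2 x ^ 2 :=
    mul_nonneg hlam.le (integral_nonneg fun x => sq_nonneg _)
  linarith [main, q, eB, eB', hE2]

end DirichletData

end ConvexCIP

/-! ### Bounds for all derivatives of the conjugated function, and absorption of an L⁴ coefficient.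
-/

namespace ConvexCIP

open Filter Topology

variable {R : ℝ} {U V : Set Pt} {i j : Fin 3} {f g f' g' : Pt → ℝ}

lemma abs_coord_sub_le {r : ℝ} (hr : R < r) {x : Pt} (hx : x ∈ cube R) :
    (x 2 - r) ^ 2 ≤ (R + r) ^ 2 ∧ (r - R) ^ 2 ≤ (x 2 - r) ^ 2 := by
  have h := abs_lt.1 (hx 2)
  constructor <;> nlinarith

namespace DirichletData

variable {v : Pt → ℝ} {dv : Fin 3 → Pt → ℝ} {ddv : Fin 3 → Fin 3 → Pt → ℝ}

/-- The Carleman estimate for the conjugated function: gradient and function. -/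
lemma carleman_lower_order (hR : 0 < R) {r lam : ℝ} (hr : R < r) (hlam : 0 < lam)
    (hlam' : 2 ≤ lam * (r - R) ^ 2) (h : DirichletData R v dv ddv) :
    lam * (∑ i, ∫ x in cube R, dv i x ^ 2) ≤ ∫ x in cube R, conjLaplacian lam r v dv ddv x ^ 2 ∧
    2 * lam ^ 3 * (r - R) ^ 2 * (∫ x in cube R, v x ^ 2) ≤
      ∫ x in cube R, conjLaplacian lam r v dv ddv x ^ 2 := by
  have h1 := h.carleman_aux hR hr hlam
  have hT : HasInt R _ _ := Integrable.hasInt (integrable_weighted_mul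
    (ρ := fun x : Pt => 16 * lam ^ 3 * (x 2 - r) ^ 2 - 24 * lam ^ 2) (by fun_prop) h.memLp h.memLp)
  have hF : HasInt R _ _ := Integrable.hasInt (h.memLp.integrable_sq)
  have h2 := (hF.const_mul (4 * lam ^ 3 * (r - R) ^ 2)).le hT fun x hx => by
    have h3 := (abs_coord_sub_le hr hx).2
    -- The condition λ(r - R)² ≥ 2 lets 12 of the 16 units of λ³s² pay for the negative 24λ²; 4
    -- units are left.
    have h4 : 24 * lam ^ 2 ≤ 12 * lam ^ 3 * (r - R) ^ 2 := by nlinarith [sq_nonneg lam]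
    have h5 : lam ^ 3 * (r - R) ^ 2 ≤ lam ^ 3 * (x 2 - r) ^ 2 := by gcongr
    nlinarith [sq_nonneg (v x)]
  have hF0 : 0 ≤ ∫ x in cube R, v x ^ 2 := integral_nonneg fun _ => sq_nonneg _
  have hE0 : 0 ≤ ∑ i, ∫ x in cube R, dv i x ^ 2 :=
    Finset.sum_nonneg fun _ _ => integral_nonneg fun _ => sq_nonneg _
  have p1 : 0 ≤ lam * ∑ i, ∫ x in cube R, dv i x ^ 2 := by positivity
  have p2 : 0 ≤ 4 * lam ^ 3 * (r - R) ^ 2 * ∫ x in cube R, v x ^ 2 := by positivity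
  constructor <;> linarith

/-- The Carleman estimate for the conjugated function: second derivatives. -/
lemma carleman_second_order (hR : 0 < R) {r lam : ℝ} (hr : R < r) (hlam : 1 ≤ lam)
    (hlam' : 2 ≤ lam * (r - R) ^ 2) (h : DirichletData R v dv ddv) :
    ∑ i, ∑ j, ∫ x in cube R, ddv i j x ^ 2 ≤
      (3 + 48 * (R + r) ^ 2 + 3 * (4 * (R + r) ^ 2 + 2) ^ 2 / (2 * (r - R) ^ 2)) * lam *
        ∫ x in cube R, conjLaplacian lam r v dv ddv x ^ 2 := by
  have hlam0 : 0 < lam := by linarith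
  obtain ⟨h1, h2⟩ := h.carleman_lower_order hR hr hlam0 hlam'
  rw [← h.integral_sq_laplacian hR]
  set X := ∫ x in cube R, conjLaplacian lam r v dv ddv x ^ 2 with hXdef
  set b := R + r
  have hq : 0 < r - R := by linarith
  have hb : 0 < b := by show 0 < R + r; linarith
  have hX : HasInt R _ X := Integrable.hasInt (h.memLp_conjLaplacian lam r).integrable_sq
  have hE : HasInt R _ _ := Integrable.hasInt (h.memLp_first 2).integrable_sq
  have hF : HasInt R _ _ := Integrable.hasInt (h.memLp.integrable_sq)
  have hL : HasInt R _ _ := Integrable.hasInt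
    (memLp_finsetSum (s := Finset.univ) (μ := cubeMeasure R) (p := 2)
      (f := fun i => ddv i i) fun i _ => h.memLp_second i i).integrable_sq
  have h3 := hL.le (((hX.const_mul 3).add (hE.const_mul (48 * lam ^ 2 * b ^ 2))).add
    (hF.const_mul (3 * lam ^ 4 * (4 * b ^ 2 + 2) ^ 2))) fun x hx => by
      have hs := (abs_coord_sub_le hr hx).1
      set s := x 2 - r
      set P := conjLaplacian lam r v dv ddv x with hP
      -- The Laplacian is recovered from P and the lower-order terms, and it controls the whole
      -- Hessian by `integral_sq_laplacian`. The factor λ²(∂_zv)² against the bound X/λ for the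
      -- gradient is what costs one power of λ.
      have e : ∑ i, ddv i i x = P + 4 * lam * s * dv 2 x - (4 * lam ^ 2 * s ^ 2 - 2 * lam) * v x := by
        rw [hP, conjLaplacian]; ring
      rw [e]
      have q1 : (4 * lam * s * dv 2 x) ^ 2 ≤ 16 * lam ^ 2 * b ^ 2 * dv 2 x ^ 2 := by
        calc (4 * lam * s * dv 2 x) ^ 2 = 16 * lam ^ 2 * s ^ 2 * dv 2 x ^ 2 := by ring
          _ ≤ _ := by gcongr
      have q2 : ((4 * lam ^ 2 * s ^ 2 - 2 * lam) * v x) ^ 2 ≤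
          lam ^ 4 * (4 * b ^ 2 + 2) ^ 2 * v x ^ 2 := by
        have : (4 * lam ^ 2 * s ^ 2 - 2 * lam) ^ 2 ≤ (lam ^ 2 * (4 * b ^ 2 + 2)) ^ 2 := by
          refine sq_le_sq' ?_ ?_
          · nlinarith [sq_nonneg s, sq_nonneg (lam * s), sq_nonneg (lam * b)]
          · nlinarith [sq_nonneg (lam)]
        calc ((4 * lam ^ 2 * s ^ 2 - 2 * lam) * v x) ^ 2
            = (4 * lam ^ 2 * s ^ 2 - 2 * lam) ^ 2 * v x ^ 2 := by ring
          _ ≤ (lam ^ 2 * (4 * b ^ 2 + 2)) ^ 2 * v x ^ 2 := by gcongr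
          _ = _ := by ring
      generalize 4 * lam * s * dv 2 x = y at *
      generalize (4 * lam ^ 2 * s ^ 2 - 2 * lam) * v x = z at *
      nlinarith [sq_nonneg (P - y), sq_nonneg (P + z), sq_nonneg (y + z)]
  have hX0 : 0 ≤ X := integral_nonneg fun _ => sq_nonneg _
  have hE2 : ∫ x in cube R, dv 2 x ^ 2 ≤ ∑ i, ∫ x in cube R, dv i x ^ 2 :=
    Finset.single_le_sum (f := fun i => ∫ x in cube R, dv i x ^ 2)
      (fun i _ => integral_nonneg fun _ => sq_nonneg _) (Finset.mem_univ 2)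
  have h4 : 48 * lam ^ 2 * b ^ 2 * (∫ x in cube R, dv 2 x ^ 2) ≤ 48 * b ^ 2 * lam * X := by
    calc _ ≤ 48 * lam ^ 2 * b ^ 2 * (∑ i, ∫ x in cube R, dv i x ^ 2) := by gcongr
      _ = 48 * b ^ 2 * lam * (lam * (∑ i, ∫ x in cube R, dv i x ^ 2)) := by ring
      _ ≤ _ := by gcongr
  have h5 : 3 * lam ^ 4 * (4 * b ^ 2 + 2) ^ 2 * (∫ x in cube R, v x ^ 2) ≤
      3 * (4 * b ^ 2 + 2) ^ 2 / (2 * (r - R) ^ 2) * lam * X := by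
    calc _ = 3 * (4 * b ^ 2 + 2) ^ 2 / (2 * (r - R) ^ 2) * lam *
        (2 * lam ^ 3 * (r - R) ^ 2 * ∫ x in cube R, v x ^ 2) := by field_simp
      _ ≤ _ := by gcongr
  have h6 : 3 * X ≤ 3 * lam * X := by nlinarith
  calc _ ≤ _ := h3
    _ ≤ 3 * lam * X + 48 * b ^ 2 * lam * X +
        3 * (4 * b ^ 2 + 2) ^ 2 / (2 * (r - R) ^ 2) * lam * X := by linarith
    _ = _ := by ring

end DirichletData

/-- Hölder's inequality in the form needed to absorb unbounded coefficients. -/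
lemma integral_mul_sq_pow_four_le {g s : Pt → ℝ} (hg : AEStronglyMeasurable g (cubeMeasure R))
    (hg4 : Integrable (fun x => g x ^ 4) (cubeMeasure R)) (hs : MemLp s 2 (cubeMeasure R))
    (hs4 : Integrable (fun x => s x ^ 4) (cubeMeasure R)) :
    Integrable (fun x => g x * s x ^ 2) (cubeMeasure R) ∧
    (∫ x in cube R, g x * s x ^ 2) ^ 4 ≤
      (∫ x in cube R, g x ^ 4) * (∫ x in cube R, s x ^ 4) * (∫ x in cube R, s x ^ 2) ^ 2 := by
  have e4 : ∀ y : ℝ, (y ^ 2) ^ 2 = y ^ 4 := fun y => by ring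
  have hg2 : MemLp (fun x => g x ^ 2) 2 (cubeMeasure R) := by
    refine (memLp_two_iff_integrable_sq (hg.pow 2)).2 ?_
    simpa only [Pi.pow_apply, e4] using hg4
  have hs2 : MemLp (fun x => s x ^ 2) 2 (cubeMeasure R) := by
    refine (memLp_two_iff_integrable_sq (hs.1.pow 2)).2 ?_
    simpa only [Pi.pow_apply, e4] using hs4
  have hgs : MemLp (fun x => g x * s x) 2 (cubeMeasure R) := by
    refine (memLp_two_iff_integrable_sq (hg.mul hs.1)).2 ?_
    simp only [Pi.mul_apply, mul_pow]
    exact integrable_mul_L2 hg2 hs2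
  have e1 : ∀ x, g x * s x * s x = g x * s x ^ 2 := fun x => by ring
  have c1 := sq_integral_mul_le hgs hs
  have c2 := sq_integral_mul_le hg2 hs2
  simp only [e1, mul_pow] at c1
  simp only [e4] at c2
  refine ⟨by simpa only [e1] using integrable_mul_L2 hgs hs, ?_⟩
  calc (∫ x in cube R, g x * s x ^ 2) ^ 4 = ((∫ x in cube R, g x * s x ^ 2) ^ 2) ^ 2 := by ring
    _ ≤ ((∫ x in cube R, g x ^ 2 * s x ^ 2) * ∫ x in cube R, s x ^ 2) ^ 2 := by gcongr
    _ = (∫ x in cube R, g x ^ 2 * s x ^ 2) ^ 2 * (∫ x in cube R, s x ^ 2) ^ 2 := by ring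
    _ ≤ _ := by gcongr

/-- Absorption of a coefficient in `L⁴`: if `‖s‖² ≤ K/λ` in `L²` and `‖s‖² ≤ Kλ` in `H¹`, then
`∫ g s²` is small compared with `K` for large `λ`. -/
lemma exists_absorption (hR : 0 < R) : ∃ C, 0 < C ∧ ∀ (g s : Pt → ℝ) (ds : Fin 3 → Pt → ℝ)
    (lam K Γ κ : ℝ), AEStronglyMeasurable g (cubeMeasure R) →
    Integrable (fun x => g x ^ 4) (cubeMeasure R) → (∫ x in cube R, g x ^ 4) ≤ Γ →
    (∀ j, HasWD R (cube R) j s (ds j)) → 0 < lam → 0 ≤ K → 0 ≤ κ →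
    lam * (∫ x in cube R, s x ^ 2) ≤ K → weakEnergy R s ds ≤ lam * K →
    C * Γ ^ 2 ≤ κ ^ 8 * lam ^ 2 →
    Integrable (fun x => g x * s x ^ 2) (cubeMeasure R) ∧
      ∫ x in cube R, g x * s x ^ 2 ≤ κ * K := by
  obtain ⟨C, hC, hGN⟩ := exists_gagliardoNirenberg_four hR
  refine ⟨C, hC, fun g s ds lam K Γ κ hg hg4 hΓ hs hlam hK hκ h1 h2 h3 => ?_⟩
  obtain ⟨hs4, hs4'⟩ := hGN s ds hs
  obtain ⟨hi, h4⟩ := integral_mul_sq_pow_four_le hg hg4 (hs 0).memf hs4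
  refine ⟨hi, ?_⟩
  set S := ∫ x in cube R, s x ^ 2
  set G := ∫ x in cube R, g x ^ 4
  set F := ∫ x in cube R, s x ^ 4
  set Y := ∫ x in cube R, g x * s x ^ 2
  have hS0 : 0 ≤ S := integral_nonneg fun _ => sq_nonneg _
  have hG0 : 0 ≤ G := integral_nonneg fun x => by positivity
  have hF0 : 0 ≤ F := integral_nonneg fun x => by positivity
  have hE0 := weakEnergy_nonneg R s ds
  -- At the eighth power all exponents are integers. Hölder gives S⁴F², and F² ≤ C S (λK)³, so five
  -- factors S ≤ K/λ face three factors λ: a net gain of λ⁻².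
  have h8 : lam ^ 2 * Y ^ 8 ≤ lam ^ 2 * (κ * K) ^ 8 := by
    calc lam ^ 2 * Y ^ 8 = lam ^ 2 * (Y ^ 4) ^ 2 := by ring
      _ ≤ lam ^ 2 * (G * F * S ^ 2) ^ 2 := by
          have : 0 ≤ Y ^ 4 := by positivity
          gcongr
      _ = lam ^ 2 * G ^ 2 * F ^ 2 * S ^ 4 := by ring
      _ ≤ lam ^ 2 * Γ ^ 2 * (C * S * (lam * K) ^ 3) * S ^ 4 := by
          gcongr
          exact hs4'.trans (by gcongr)
      _ = (C * Γ ^ 2) * K ^ 3 * (lam * S) ^ 5 := by ring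
      _ ≤ (κ ^ 8 * lam ^ 2) * K ^ 3 * K ^ 5 := by gcongr
      _ = lam ^ 2 * (κ * K) ^ 8 := by ring
  have h9 : Y ^ 8 ≤ (κ * K) ^ 8 := le_of_mul_le_mul_left h8 (by positivity)
  exact le_of_pow_le_pow_left₀ (by norm_num) (by positivity) h9

end ConvexCIP

/-! ### Returning from the conjugated function to the weighted one. -/

namespace ConvexCIP

open Filter Topology

variable {R : ℝ} {U V : Set Pt} {i j : Fin 3} {f g f' g' : Pt → ℝ}

/-- The square root of the Carleman weight. -/
noncomputable def halfWeight (lam r : ℝ) (x : Pt) : ℝ := Real.exp (lam * (x 2 - r) ^ 2)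

lemma halfWeight_contDiff (lam r : ℝ) : ContDiff ℝ ∞ (halfWeight lam r) := by
  unfold halfWeight; fun_prop

lemma halfWeight_pos (lam r : ℝ) (x : Pt) : 0 < halfWeight lam r x := Real.exp_pos _

lemma halfWeight_sq (lam r : ℝ) (x : Pt) : halfWeight lam r x ^ 2 = carleman r lam (x 2) := by
  rw [halfWeight, carleman, ← Real.exp_nat_mul]
  congr 1
  push_cast
  ring

lemma one_le_halfWeight {lam : ℝ} (hlam : 0 ≤ lam) (r : ℝ) (x : Pt) : 1 ≤ halfWeight lam r x :=
  Real.one_le_exp (by positivity)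

lemma partialD_halfWeight (lam r : ℝ) (i : Fin 3) :
    partialD i (halfWeight lam r) = fun x =>
      if i = 2 then 2 * lam * (x 2 - r) * halfWeight lam r x else 0 := by
  funext x
  have hd : ∀ t, HasDerivAt (fun t => Real.exp (lam * (t - r) ^ 2))
      (Real.exp (lam * (t - r) ^ 2) * (lam * (2 * (t - r)))) t := by
    intro t
    have h1 : HasDerivAt (fun t => t - r) 1 t := (hasDerivAt_id t).sub_const r
    have h2 := ((h1.fun_pow 2).const_mul lam).exp
    simpa using h2
  have h := partialD_comp_coord (χ := fun t => Real.exp (lam * (t - r) ^ 2))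
    (fun t => (hd t).differentiableAt) 2 i x
  have e : (fun y : Pt => Real.exp (lam * (y 2 - r) ^ 2)) = halfWeight lam r := rfl
  rw [e, (hd (x 2)).deriv] at h
  rw [h]
  split_ifs
  · rw [halfWeight]; ring
  · rfl

lemma partialD_partialD_halfWeight (lam r : ℝ) (i j : Fin 3) (x : Pt) :
    partialD j (partialD i (halfWeight lam r)) x =
      if i = 2 ∧ j = 2 then (2 * lam + 4 * lam ^ 2 * (x 2 - r) ^ 2) * halfWeight lam r x else 0 := by
  rw [partialD_halfWeight]
  by_cases hi : i = 2
  · have hs : Differentiable ℝ (fun x : Pt => 2 * lam * (x 2 - r)) := by fun_prop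
    have h1 := partialD_mul hs (differentiable_of_smooth (halfWeight_contDiff lam r)) j x
    simp only [hi, if_true, true_and]
    rw [h1, partialD_halfWeight]
    have h2 : partialD j (fun x : Pt => 2 * lam * (x 2 - r)) x = if j = 2 then 2 * lam else 0 := by
      have := partialD_comp_coord (χ := fun t => 2 * lam * (t - r)) (by fun_prop) 2 j x
      rw [this]
      have hd : HasDerivAt (fun t => 2 * lam * (t - r)) (2 * lam) (x 2) := by
        simpa using ((hasDerivAt_id (x 2)).sub_const r).const_mul (2 * lam)
      rw [hd.deriv]
    rw [h2]
    split_ifs <;> ring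
  · simp [hi, partialD]

namespace DirichletData

variable {u : Pt → ℝ} {du : Fin 3 → Pt → ℝ} {ddu : Fin 3 → Fin 3 → Pt → ℝ}

/-- The gradient of `e^{λs²} u`. -/
noncomputable def wGrad (lam r : ℝ) (u : Pt → ℝ) (du : Fin 3 → Pt → ℝ) (i : Fin 3) (x : Pt) : ℝ :=
  halfWeight lam r x * du i x + partialD i (halfWeight lam r) x * u x

/-- The Hessian of `e^{λs²} u`. -/
noncomputable def wHess (lam r : ℝ) (u : Pt → ℝ) (du : Fin 3 → Pt → ℝ)
    (ddu : Fin 3 → Fin 3 → Pt → ℝ) (i j : Fin 3) (x : Pt) : ℝ :=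
  (halfWeight lam r x * ddu i j x + partialD j (halfWeight lam r) x * du i x) +
    (partialD i (halfWeight lam r) x * du j x +
      partialD j (partialD i (halfWeight lam r)) x * u x)

lemma weighted (lam r : ℝ) (h : DirichletData R u du ddu) :
    DirichletData R (fun x => halfWeight lam r x * u x) (wGrad lam r u du)
      (wHess lam r u du ddu) := h.smooth_mul (halfWeight_contDiff lam r)

/-- The purpose of the conjugation: the unweighted estimates for e^{λs²}u become estimates by the
Carleman-weighted integral of (Δu)². -/
lemma conjLaplacian_weighted (lam r : ℝ) (u : Pt → ℝ) (du : Fin 3 → Pt → ℝ)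
    (ddu : Fin 3 → Fin 3 → Pt → ℝ) (x : Pt) :
    conjLaplacian lam r (fun x => halfWeight lam r x * u x) (wGrad lam r u du)
      (wHess lam r u du ddu) x = halfWeight lam r x * ∑ i, ddu i i x := by
  simp only [conjLaplacian, wGrad, wHess, partialD_partialD_halfWeight, Fin.sum_univ_three]
  simp [partialD_halfWeight]
  ring

lemma sq_conjLaplacian_weighted (lam r : ℝ) (u : Pt → ℝ) (du : Fin 3 → Pt → ℝ)
    (ddu : Fin 3 → Fin 3 → Pt → ℝ) :
    ∫ x in cube R, conjLaplacian lam r (fun x => halfWeight lam r x * u x) (wGrad lam r u du)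
      (wHess lam r u du ddu) x ^ 2 = ∫ x in cube R, (∑ i, ddu i i x) ^ 2 * carleman r lam (x 2) := by
  simp only [conjLaplacian_weighted, mul_pow, halfWeight_sq]
  congr 1
  funext x
  ring

/-- With w the half weight, w∂_iu = ∂_i(wu) - (∂_iw)u, and |∂_iw| ≤ 2λ(R + r)w on the cube. -/
lemma sq_weighted_gradient_le {r lam : ℝ} (hr : R < r) (u : Pt → ℝ)
    (du : Fin 3 → Pt → ℝ) (i : Fin 3) {x : Pt} (hx : x ∈ cube R) :
    du i x ^ 2 * carleman r lam (x 2) ≤ 2 * wGrad lam r u du i x ^ 2 +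
      8 * (R + r) ^ 2 * (lam * (halfWeight lam r x * u x)) ^ 2 := by
  have hs := (abs_coord_sub_le hr hx).1
  rw [← halfWeight_sq]
  set w := halfWeight lam r x
  have e : du i x ^ 2 * w ^ 2 =
      (wGrad lam r u du i x - partialD i (halfWeight lam r) x * u x) ^ 2 := by
    rw [wGrad]; ring
  have h1 : (partialD i (halfWeight lam r) x * u x) ^ 2 ≤ 4 * (R + r) ^ 2 * (lam * (w * u x)) ^ 2 := by
    rw [partialD_halfWeight]
    simp only
    split_ifs
    · calc (2 * lam * (x 2 - r) * w * u x) ^ 2 = 4 * (x 2 - r) ^ 2 * (lam * (w * u x)) ^ 2 := by ring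
        _ ≤ _ := by gcongr
    · simp only [zero_mul, ne_eq, OfNat.ofNat_ne_zero, not_false_eq_true, zero_pow]
      positivity
  rw [e]
  nlinarith [sq_nonneg (wGrad lam r u du i x + partialD i (halfWeight lam r) x * u x)]

/-- The Carleman estimate, as bounds in `H¹` for `e^{λs²} λ u` and the gradient of `e^{λs²} u`. -/
lemma exists_weighted_energy_le {r : ℝ} (hR : 0 < R) (hr : R < r) : ∃ c, 0 < c ∧
    ∀ (lam : ℝ) (u : Pt → ℝ) (du : Fin 3 → Pt → ℝ) (ddu : Fin 3 → Fin 3 → Pt → ℝ), 1 ≤ lam →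
    2 ≤ lam * (r - R) ^ 2 → DirichletData R u du ddu →
    (∀ i, lam * (∫ x in cube R, wGrad lam r u du i x ^ 2) ≤
      c * ∫ x in cube R, (∑ i, ddu i i x) ^ 2 * carleman r lam (x 2)) ∧
    (∀ i, weakEnergy R (wGrad lam r u du i) (wHess lam r u du ddu i) ≤
      lam * (c * ∫ x in cube R, (∑ i, ddu i i x) ^ 2 * carleman r lam (x 2))) ∧
    lam * (∫ x in cube R, (lam * (halfWeight lam r x * u x)) ^ 2) ≤
      c * (∫ x in cube R, (∑ i, ddu i i x) ^ 2 * carleman r lam (x 2)) ∧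
    weakEnergy R (fun x => lam * (halfWeight lam r x * u x))
      (fun i x => lam * wGrad lam r u du i x) ≤
      lam * (c * ∫ x in cube R, (∑ i, ddu i i x) ^ 2 * carleman r lam (x 2)) := by
  have hq : 0 < r - R := by linarith
  obtain ⟨c₁, hc₁, hc₁e⟩ : ∃ c₁, 0 ≤ c₁ ∧
      3 + 48 * (R + r) ^ 2 + 3 * (4 * (R + r) ^ 2 + 2) ^ 2 / (2 * (r - R) ^ 2) = c₁ :=
    ⟨_, by positivity, rfl⟩
  obtain ⟨q, hq0, hqe⟩ : ∃ q, 0 ≤ q ∧ q * (2 * (r - R) ^ 2) = 1 :=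
    ⟨1 / (2 * (r - R) ^ 2), by positivity, by field_simp⟩
  refine ⟨1 + c₁ + q, by positivity, fun lam u du ddu h1 h2 hu => ?_⟩
  have hlam0 : 0 < lam := by linarith
  have hv := hu.weighted lam r
  obtain ⟨e1, e2⟩ := hv.carleman_lower_order hR hr hlam0 h2
  have e3 := hv.carleman_second_order hR hr h1 h2
  rw [sq_conjLaplacian_weighted] at e1 e2 e3
  rw [hc₁e] at e3
  have hX0 : 0 ≤ ∫ x in cube R, (∑ i, ddu i i x) ^ 2 * carleman r lam (x 2) :=
    integral_nonneg fun x => by unfold carleman; positivity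
  have hg0 : ∀ i, 0 ≤ ∫ x in cube R, wGrad lam r u du i x ^ 2 := fun i =>
    integral_nonneg fun _ => sq_nonneg _
  have hH0 : ∀ i, 0 ≤ ∑ j, ∫ x in cube R, wHess lam r u du ddu i j x ^ 2 := fun i =>
    Finset.sum_nonneg fun j _ => integral_nonneg fun _ => sq_nonneg _
  have hE := fun i => Finset.single_le_sum (fun i _ => hg0 i) (Finset.mem_univ i)
  have hH := fun i => Finset.single_le_sum (fun i _ => hH0 i) (Finset.mem_univ i)
  have hS0 := Finset.sum_nonneg fun i (_ : i ∈ Finset.univ) => hg0 i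
  have hF0 : 0 ≤ ∫ x in cube R, (halfWeight lam r x * u x) ^ 2 :=
    integral_nonneg fun _ => sq_nonneg _
  simp only [weakEnergy, mul_pow lam, integral_const_mul, ← Finset.mul_sum]
  generalize (∫ x in cube R, (∑ i, ddu i i x) ^ 2 * carleman r lam (x 2)) = X at *
  generalize (∫ x in cube R, (halfWeight lam r x * u x) ^ 2) = F at *
  have hXle : X ≤ lam * X := by nlinarith
  have hqX : 0 ≤ q * X := by positivity
  have hcX : 0 ≤ c₁ * X := by positivity
  have hF : lam ^ 3 * F ≤ q * X := by
    calc lam ^ 3 * F = q * (2 * lam ^ 3 * (r - R) ^ 2 * F) := by linear_combination (-lam ^ 3 * F) * hqe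
      _ ≤ q * X := by gcongr
  have hEi : ∀ i, lam * (∫ x in cube R, wGrad lam r u du i x ^ 2) ≤ X := fun i =>
    (mul_le_mul_of_nonneg_left (hE i) hlam0.le).trans e1
  refine ⟨fun i => (hEi i).trans (by linarith), fun i => ?_, ?_, ?_⟩
  · have h5 : (∫ x in cube R, wGrad lam r u du i x ^ 2) ≤ X := by nlinarith [hEi i, hg0 i]
    have h6 := (hH i).trans e3
    have h7 : 0 ≤ lam * (q * X) := by positivity
    linarith
  · linarith
  · have h7 : lam ^ 2 * F ≤ lam * (q * X) := by
      have : 0 ≤ lam ^ 2 * F := by positivity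
      calc lam ^ 2 * F ≤ lam ^ 3 * F := by nlinarith
        _ ≤ q * X := hF
        _ ≤ _ := by nlinarith
    have h8 : lam ^ 2 * (∑ i, ∫ x in cube R, wGrad lam r u du i x ^ 2) ≤ lam * X := by
      rw [pow_two, mul_assoc]
      gcongr
    have h9 : 0 ≤ lam * (c₁ * X) := by positivity
    linarith

end DirichletData

/-- For large `λ` the Carleman estimate absorbs a gradient term with a coefficient in `L⁴`. -/
theorem exists_carleman_absorption {r : ℝ} (hR : 0 < R) (hr : R < r) {Γ κ : ℝ}
    (hκ : 0 < κ) : ∃ lam₀, 1 ≤ lam₀ ∧ ∀ lam, lam₀ ≤ lam → ∀ (g u : Pt → ℝ) (du : Fin 3 → Pt → ℝ)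
    (ddu : Fin 3 → Fin 3 → Pt → ℝ), DirichletData R u du ddu →
    AEStronglyMeasurable g (cubeMeasure R) → (∀ x, 0 ≤ g x) →
    Integrable (fun x => g x ^ 4) (cubeMeasure R) → (∫ x in cube R, g x ^ 4) ≤ Γ →
    ∀ i, Integrable (fun x => g x * (du i x ^ 2 * carleman r lam (x 2))) (cubeMeasure R) ∧
      ∫ x in cube R, g x * (du i x ^ 2 * carleman r lam (x 2)) ≤
      κ * ∫ x in cube R, (∑ i, ddu i i x) ^ 2 * carleman r lam (x 2) := by
  obtain ⟨C, hC, hab⟩ := exists_absorption hR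
  obtain ⟨c, hc, hce⟩ := DirichletData.exists_weighted_energy_le hR hr
  have hq : 0 < r - R := by linarith
  -- The absorption is used for two functions, entering with weights 2 and 8(R + r)², and its K is c
  -- times the weighted Laplacian energy; κ' shares κ among them.
  obtain ⟨κ', hκ'0, hκ'⟩ : ∃ κ', 0 < κ' ∧ κ' * (c * (2 + 8 * (R + r) ^ 2)) = κ :=
    ⟨κ / (c * (2 + 8 * (R + r) ^ 2)), by positivity, by field_simp⟩
  refine ⟨max 1 (max (2 / (r - R) ^ 2) (C * Γ ^ 2 / κ' ^ 8)), le_max_left _ _, ?_⟩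
  intro lam hlam g u du ddu hu hg hg0 hg4 hgΓ i
  have h1 : 1 ≤ lam := (le_max_left _ _).trans hlam
  have h2 : 2 ≤ lam * (r - R) ^ 2 := by
    rw [← div_le_iff₀ (by positivity)]
    exact ((le_max_left _ _).trans (le_max_right _ _)).trans hlam
  have h3 : C * Γ ^ 2 ≤ κ' ^ 8 * lam ^ 2 := by
    have : C * Γ ^ 2 / κ' ^ 8 ≤ lam := ((le_max_right _ _).trans (le_max_right _ _)).trans hlam
    rw [div_le_iff₀ (by positivity)] at this
    have h4 : lam ≤ lam ^ 2 := by nlinarith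
    calc C * Γ ^ 2 ≤ lam * κ' ^ 8 := this
      _ ≤ lam ^ 2 * κ' ^ 8 := by gcongr
      _ = _ := mul_comm _ _
  have hlam0 : 0 < lam := by linarith
  have hv := hu.weighted lam r
  obtain ⟨e1, e2, e3, e4⟩ := hce lam u du ddu h1 h2 hu
  have hX0 : 0 ≤ ∫ x in cube R, (∑ i, ddu i i x) ^ 2 * carleman r lam (x 2) :=
    integral_nonneg fun x => by unfold carleman; positivity
  have hdu := (hu.memLp_first i).1
  generalize (∫ x in cube R, (∑ i, ddu i i x) ^ 2 * carleman r lam (x 2)) = X at *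
  have hK : 0 ≤ c * X := by positivity
  -- The gradient of the weighted function and λ times the function itself obey the same pair of
  -- bounds, K/λ in L² and λK in H¹, so both pieces of w∂_iu are absorbed alike.
  obtain ⟨a1, a1'⟩ := hab g _ _ lam (c * X) Γ κ' hg hg4 hgΓ (fun j => hv.second i j) hlam0 hK
    hκ'0.le (e1 i) (e2 i) h3
  obtain ⟨a2, a2'⟩ := hab g (fun x => lam * (halfWeight lam r x * u x))
    (fun j x => lam * DirichletData.wGrad lam r u du j x) lam
      (c * X) Γ κ' hg hg4 hgΓ (fun j => (hv.first j).const_mul lam) hlam0 hK hκ'0.le e3 e4 h3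
  have b1 := ((Integrable.hasInt a1).const_mul 2).add
    ((Integrable.hasInt a2).const_mul (8 * (R + r) ^ 2))
  have hle : ∀ x ∈ cube R, g x * (du i x ^ 2 * carleman r lam (x 2)) ≤
      2 * (g x * DirichletData.wGrad lam r u du i x ^ 2) +
        8 * (R + r) ^ 2 * (g x * (lam * (halfWeight lam r x * u x)) ^ 2) := fun x hx => by
    have := mul_le_mul_of_nonneg_left
      (DirichletData.sq_weighted_gradient_le (lam := lam) hr u du i hx) (hg0 x)
    refine this.trans (le_of_eq ?_)
    ring
  have hcarl : Continuous fun x : Pt => carleman r lam (x 2) := by unfold carleman; fun_prop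
  have b2 : Integrable (fun x => g x * (du i x ^ 2 * carleman r lam (x 2))) (cubeMeasure R) := by
    refine b1.1.mono' (hg.mul ((hdu.pow 2).mul hcarl.aestronglyMeasurable)) ?_
    filter_upwards [ae_mem_cube R] with x hx
    rw [Real.norm_of_nonneg]
    · exact hle x hx
    · have := hg0 x
      unfold carleman
      positivity
  refine ⟨b2, ((Integrable.hasInt b2).le b1 hle).trans ?_⟩
  calc _ ≤ 2 * (κ' * (c * X)) + 8 * (R + r) ^ 2 * (κ' * (c * X)) := by gcongr
    _ = κ * X := by rw [← hκ']; ring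

end ConvexCIP

/-! ### Control of the full H² norm for fixed λ. -/

namespace ConvexCIP

open Filter Topology

variable {R : ℝ} {U V : Set Pt} {i j : Fin 3} {f g f' g' : Pt → ℝ}

namespace DirichletData

variable {u : Pt → ℝ} {du : Fin 3 → Pt → ℝ} {ddu : Fin 3 → Fin 3 → Pt → ℝ}

lemma sq_weighted_hessian_le {r lam : ℝ} (hr : R < r) (hlam : 1 ≤ lam) (u : Pt → ℝ)
    (du : Fin 3 → Pt → ℝ) (ddu : Fin 3 → Fin 3 → Pt → ℝ) (i j : Fin 3) {x : Pt} (hx : x ∈ cube R) :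
    ddu i j x ^ 2 * carleman r lam (x 2) ≤ 4 * (wHess lam r u du ddu i j x ^ 2 +
      4 * lam ^ 2 * (R + r) ^ 2 * (du i x ^ 2 * carleman r lam (x 2)) +
      4 * lam ^ 2 * (R + r) ^ 2 * (du j x ^ 2 * carleman r lam (x 2)) +
      (2 + 4 * lam * (R + r) ^ 2) ^ 2 * (lam * (halfWeight lam r x * u x)) ^ 2) := by
  have hs := (abs_coord_sub_le hr hx).1
  have hw := halfWeight_pos lam r x
  rw [← halfWeight_sq]
  have hD : ∀ (l : Fin 3) (y : ℝ), (partialD l (halfWeight lam r) x * y) ^ 2 ≤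
      4 * lam ^ 2 * (R + r) ^ 2 * (y ^ 2 * halfWeight lam r x ^ 2) := by
    intro l y
    rw [partialD_halfWeight]
    simp only
    split_ifs
    · calc (2 * lam * (x 2 - r) * halfWeight lam r x * y) ^ 2
          = 4 * lam ^ 2 * (x 2 - r) ^ 2 * (y ^ 2 * halfWeight lam r x ^ 2) := by ring
        _ ≤ _ := by gcongr
    · simp only [zero_mul, ne_eq, OfNat.ofNat_ne_zero, not_false_eq_true, zero_pow]
      positivity
  have hDD : (partialD j (partialD i (halfWeight lam r)) x * u x) ^ 2 ≤
      (2 + 4 * lam * (R + r) ^ 2) ^ 2 * (lam * (halfWeight lam r x * u x)) ^ 2 := by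
    rw [partialD_partialD_halfWeight]
    split_ifs
    · calc ((2 * lam + 4 * lam ^ 2 * (x 2 - r) ^ 2) * halfWeight lam r x * u x) ^ 2
          = (2 + 4 * lam * (x 2 - r) ^ 2) ^ 2 * (lam * (halfWeight lam r x * u x)) ^ 2 := by ring
        _ ≤ _ := by gcongr
    · simp only [zero_mul, ne_eq, OfNat.ofNat_ne_zero, not_false_eq_true, zero_pow]
      positivity
  have h1 := hD j (du i x)
  have h2 := hD i (du j x)
  have e : ddu i j x ^ 2 * halfWeight lam r x ^ 2 = (wHess lam r u du ddu i j x -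
      partialD j (halfWeight lam r) x * du i x - partialD i (halfWeight lam r) x * du j x -
      partialD j (partialD i (halfWeight lam r)) x * u x) ^ 2 := by
    rw [wHess]; ring
  rw [e]
  generalize partialD j (halfWeight lam r) x * du i x = p at *
  generalize partialD i (halfWeight lam r) x * du j x = q at *
  generalize partialD j (partialD i (halfWeight lam r)) x * u x = s at *
  generalize wHess lam r u du ddu i j x = t at *
  nlinarith [sq_nonneg (t + p), sq_nonneg (t + q), sq_nonneg (t + s), sq_nonneg (p - q),
    sq_nonneg (p - s), sq_nonneg (q - s)]

/-- The Carleman estimate controls the full `H²` norm. -/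
lemma exists_sobolev_two_le {r lam : ℝ} (hR : 0 < R) (hr : R < r) (h1 : 1 ≤ lam)
    (h2 : 2 ≤ lam * (r - R) ^ 2) : ∃ C, 0 < C ∧
    ∀ (u : Pt → ℝ) (du : Fin 3 → Pt → ℝ) (ddu : Fin 3 → Fin 3 → Pt → ℝ), DirichletData R u du ddu →
    (∫ x in cube R, u x ^ 2) ≤ C * (∫ x in cube R, (∑ i, ddu i i x) ^ 2 * carleman r lam (x 2)) ∧
    (∀ i, (∫ x in cube R, du i x ^ 2) ≤
      C * ∫ x in cube R, (∑ i, ddu i i x) ^ 2 * carleman r lam (x 2)) ∧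
    ∀ i j, (∫ x in cube R, ddu i j x ^ 2) ≤
      C * ∫ x in cube R, (∑ i, ddu i i x) ^ 2 * carleman r lam (x 2) := by
  obtain ⟨c, hc, hce⟩ := exists_weighted_energy_le hR hr
  have hlam0 : 0 < lam := by linarith
  have hc2 : 0 < (2 + 8 * (R + r) ^ 2) * c := by positivity
  have hc3 : 0 < 4 * (lam * c + 4 * lam ^ 2 * (R + r) ^ 2 * ((2 + 8 * (R + r) ^ 2) * c) +
      4 * lam ^ 2 * (R + r) ^ 2 * ((2 + 8 * (R + r) ^ 2) * c) +
      (2 + 4 * lam * (R + r) ^ 2) ^ 2 * c) := by positivity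
  -- Here λ is fixed, so powers of λ may be lost. The three summands serve the function, its
  -- gradient and its Hessian; the weight is at least 1 and is dropped at the end.
  refine ⟨c + (2 + 8 * (R + r) ^ 2) * c + 4 * (lam * c +
    4 * lam ^ 2 * (R + r) ^ 2 * ((2 + 8 * (R + r) ^ 2) * c) +
    4 * lam ^ 2 * (R + r) ^ 2 * ((2 + 8 * (R + r) ^ 2) * c) +
    (2 + 4 * lam * (R + r) ^ 2) ^ 2 * c), by positivity, fun u du ddu hu => ?_⟩
  have hv := hu.weighted lam r
  obtain ⟨e1, e2, e3, -⟩ := hce lam u du ddu h1 h2 hu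
  have hX0 : 0 ≤ ∫ x in cube R, (∑ i, ddu i i x) ^ 2 * carleman r lam (x 2) :=
    integral_nonneg fun x => by unfold carleman; positivity
  have hcarl1 : ∀ x : Pt, 1 ≤ carleman r lam (x 2) := fun x =>
    Real.one_le_exp (by positivity)
  have hcarl : Continuous fun x : Pt => halfWeight lam r x :=
    (halfWeight_contDiff lam r).continuous
  have hint : ∀ f : Pt → ℝ, MemLp f 2 (cubeMeasure R) →
      Integrable (fun x => f x ^ 2 * carleman r lam (x 2)) (cubeMeasure R) := fun f hf => by
    have := (memLp_continuous_mul hcarl hf).integrable_sq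
    simpa only [mul_pow, halfWeight_sq, mul_comm] using this
  have iT : HasInt R _ _ := Integrable.hasInt (hv.memLp.const_mul lam).integrable_sq
  have iG : ∀ i, HasInt R _ _ := fun i => Integrable.hasInt (hv.memLp_first i).integrable_sq
  have iH : ∀ i j, HasInt R _ _ := fun i j => Integrable.hasInt (hv.memLp_second i j).integrable_sq
  have iDw : ∀ i, HasInt R _ _ := fun i => Integrable.hasInt (hint _ (hu.memLp_first i))
  have iDDw : ∀ i j, HasInt R _ _ := fun i j => Integrable.hasInt (hint _ (hu.memLp_second i j))
  have hT0 : 0 ≤ ∫ x in cube R, (lam * (halfWeight lam r x * u x)) ^ 2 :=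
    integral_nonneg fun _ => sq_nonneg _
  have hG0 : ∀ i, 0 ≤ ∫ x in cube R, wGrad lam r u du i x ^ 2 := fun i =>
    integral_nonneg fun _ => sq_nonneg _
  have hH : ∀ i j, (∫ x in cube R, wHess lam r u du ddu i j x ^ 2) ≤
      weakEnergy R (wGrad lam r u du i) (wHess lam r u du ddu i) := fun i j => by
    have := Finset.single_le_sum (f := fun j => ∫ x in cube R, wHess lam r u du ddu i j x ^ 2)
      (fun j _ => integral_nonneg fun _ => sq_nonneg _) (Finset.mem_univ j)
    rw [weakEnergy]
    linarith [hG0 i]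
  have q0 : (∫ x in cube R, u x ^ 2) ≤ ∫ x in cube R, (lam * (halfWeight lam r x * u x)) ^ 2 := by
    refine (Integrable.hasInt hu.memLp.integrable_sq).le iT fun x _ => ?_
    have hw := one_le_halfWeight hlam0.le r x
    have : 1 ≤ lam * halfWeight lam r x := one_le_mul_of_one_le_of_one_le h1 hw
    calc u x ^ 2 = 1 ^ 2 * u x ^ 2 := by ring
      _ ≤ (lam * halfWeight lam r x) ^ 2 * u x ^ 2 := by gcongr
      _ = _ := by ring
  have q1 : ∀ i, (∫ x in cube R, du i x ^ 2 * carleman r lam (x 2)) ≤ _ := fun i =>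
    (iDw i).le (((iG i).const_mul 2).add (iT.const_mul (8 * (R + r) ^ 2))) fun x hx =>
      sq_weighted_gradient_le hr u du i hx
  have q2 := fun i j => (iDDw i j).le ((((iH i j).add
    ((iDw i).const_mul (4 * lam ^ 2 * (R + r) ^ 2))).add
    ((iDw j).const_mul (4 * lam ^ 2 * (R + r) ^ 2))).add
    (iT.const_mul ((2 + 4 * lam * (R + r) ^ 2) ^ 2)) |>.const_mul 4) fun x hx =>
      sq_weighted_hessian_le hr h1 u du ddu i j hx
  have q3 : ∀ i, (∫ x in cube R, du i x ^ 2) ≤ ∫ x in cube R, du i x ^ 2 * carleman r lam (x 2) :=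
    fun i => (Integrable.hasInt (hu.memLp_first i).integrable_sq).le (iDw i) fun x _ =>
      le_mul_of_one_le_right (sq_nonneg _) (hcarl1 x)
  have q4 : ∀ i j, (∫ x in cube R, ddu i j x ^ 2) ≤
      ∫ x in cube R, ddu i j x ^ 2 * carleman r lam (x 2) := fun i j =>
    (Integrable.hasInt (hu.memLp_second i j).integrable_sq).le (iDDw i j) fun x _ =>
      le_mul_of_one_le_right (sq_nonneg _) (hcarl1 x)
  clear iT iG iH iDw iDDw hint
  generalize (∫ x in cube R, (∑ i, ddu i i x) ^ 2 * carleman r lam (x 2)) = X at *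
  generalize (∫ x in cube R, (lam * (halfWeight lam r x * u x)) ^ 2) = T at *
  have hcX : 0 ≤ c * X := by positivity
  have hT : T ≤ c * X := by nlinarith
  have hG : ∀ i, (∫ x in cube R, wGrad lam r u du i x ^ 2) ≤ c * X := fun i => by
    nlinarith [e1 i, hG0 i]
  have hD : ∀ i, (∫ x in cube R, du i x ^ 2 * carleman r lam (x 2)) ≤
      (2 + 8 * (R + r) ^ 2) * c * X := fun i => by
    calc _ ≤ _ := q1 i
      _ ≤ 2 * (c * X) + 8 * (R + r) ^ 2 * (c * X) := by gcongr; exact hG i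
      _ = _ := by ring
  have hDD : ∀ i j, (∫ x in cube R, ddu i j x ^ 2 * carleman r lam (x 2)) ≤ 4 * (lam * c +
      4 * lam ^ 2 * (R + r) ^ 2 * ((2 + 8 * (R + r) ^ 2) * c) +
      4 * lam ^ 2 * (R + r) ^ 2 * ((2 + 8 * (R + r) ^ 2) * c) +
      (2 + 4 * lam * (R + r) ^ 2) ^ 2 * c) * X := fun i j => by
    calc _ ≤ _ := q2 i j
      _ ≤ 4 * (lam * (c * X) + 4 * lam ^ 2 * (R + r) ^ 2 * ((2 + 8 * (R + r) ^ 2) * c * X) +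
        4 * lam ^ 2 * (R + r) ^ 2 * ((2 + 8 * (R + r) ^ 2) * c * X) +
        (2 + 4 * lam * (R + r) ^ 2) ^ 2 * (c * X)) := by
          gcongr
          · exact (hH i j).trans (e2 i)
          · exact hD i
          · exact hD j
      _ = _ := by ring
  have r2 := mul_nonneg hc2.le hX0
  have r3 := mul_nonneg hc3.le hX0
  generalize (2 + 8 * (R + r) ^ 2) * c = c2 at *
  generalize 4 * (lam * c + 4 * lam ^ 2 * (R + r) ^ 2 * c2 + 4 * lam ^ 2 * (R + r) ^ 2 * c2 +
      (2 + 4 * lam * (R + r) ^ 2) ^ 2 * c) = c3 at *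
  refine ⟨by linarith, fun i => ?_, fun i j => ?_⟩
  · linarith [q3 i, hD i]
  · linarith [q4 i j, hDD i j]

end DirichletData

end ConvexCIP

namespace ConvexCIP

open Filter Topology

variable {R : ℝ} {U V : Set Pt} {i j : Fin 3} {f g f' g' : Pt → ℝ}

/-! ### Real components of elements of `H³` -/

/-- The real components of a vector in `ℂ^N`. -/
noncomputable def cpt {N : ℕ} (c : Fin N × Bool) : Val N →L[ℝ] ℝ :=
  (if c.2 then Complex.imCLM else Complex.reCLM) ∘L
    ((EuclideanSpace.proj c.1 : Val N →L[ℂ] ℂ).restrictScalars ℝ)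

lemma sum_sq_cpt {N : ℕ} (v : Val N) : ∑ c, cpt c v ^ 2 = ‖v‖ ^ 2 := by
  rw [EuclideanSpace.norm_sq_eq, Fintype.sum_prod_type]
  refine Finset.sum_congr rfl fun n _ => ?_
  rw [← Complex.normSq_eq_norm_sq, Complex.normSq_apply]
  simp [cpt]
  ring

lemma integrable_norm_sq {N : ℕ} (u : L2 N R) :
    Integrable (fun x => ‖u x‖ ^ 2) (cubeMeasure R) := (Lp.memLp u).integrable_norm_pow (by simp)

lemma norm_sq_eq_integral {N : ℕ} (u : L2 N R) : ‖u‖ ^ 2 = ∫ x in cube R, ‖u x‖ ^ 2 := by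
  rw [← real_inner_self_eq_norm_sq, L2.inner_def]
  simp only [real_inner_self_eq_norm_sq]

/-- The component `c` of `∂^β V`. -/
noncomputable def wDc {N : ℕ} (c : Fin N × Bool) (β : MultiIndex 3) (V : H3 N R) (x : Pt) : ℝ :=
  cpt c (wD β V x)

lemma memLp_wDc {N : ℕ} (c : Fin N × Bool) (β : MultiIndex 3) (V : H3 N R) :
    MemLp (wDc c β V) 2 (cubeMeasure R) := (cpt c).comp_memLp' (Lp.memLp (wD β V))

lemma norm_wD_sq {N : ℕ} (β : MultiIndex 3) (V : H3 N R) :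
    ‖wD β V‖ ^ 2 = ∑ c, ∫ x in cube R, wDc c β V x ^ 2 := by
  rw [norm_sq_eq_integral, ← integral_finsetSum _ fun c _ => (memLp_wDc c β V).integrable_sq]
  simp only [wDc, sum_sq_cpt]

lemma norm_sq_eq_sum {N : ℕ} (V : H3 N R) : ‖V‖ ^ 2 = ∑ β, ‖wD β V‖ ^ 2 :=
  PiLp.norm_sq_eq_of_L2 _ (V : Jets N R)

lemma norm_wD_le {N : ℕ} (β : MultiIndex 3) (V : H3 N R) : ‖wD β V‖ ≤ ‖V‖ := by
  refine le_of_sq_le_sq ?_ (norm_nonneg _)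
  rw [norm_sq_eq_sum]
  exact Finset.single_le_sum (f := fun β => ‖wD β V‖ ^ 2) (fun _ _ => sq_nonneg _)
    (Finset.mem_univ β)

lemma integral_wDc_sq_le {N : ℕ} (c : Fin N × Bool) (β : MultiIndex 3) (V : H3 N R) :
    ∫ x in cube R, wDc c β V x ^ 2 ≤ ‖V‖ ^ 2 := by
  refine le_trans ?_ (pow_le_pow_left₀ (norm_nonneg _) (norm_wD_le β V) 2)
  rw [norm_wD_sq]
  exact Finset.single_le_sum (f := fun c => ∫ x in cube R, wDc c β V x ^ 2)
    (fun _ _ => integral_nonneg fun _ => sq_nonneg _) (Finset.mem_univ c)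

/-! ### Multi-indices -/

/-- The multi-index of `∂_i ∂_j`. -/
def MultiIndex.pair (i j : Fin 3) : MultiIndex 3 :=
  ⟨Pi.single i 1 + Pi.single j 1, by revert i j; decide⟩

/-- The multi-index of `∂_i ∂_j ∂_l`. -/
def MultiIndex.triple (i j l : Fin 3) : MultiIndex 3 :=
  ⟨Pi.single i 1 + Pi.single j 1 + Pi.single l 1, by revert i j l; decide⟩

/-- `β' = β + e_i`. -/
def MultiIndex.IsSucc (i : Fin 3) (β β' : MultiIndex 3) : Prop :=
  ∀ j, (β'.1 j : ℕ) = β.1 j + if j = i then 1 else 0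

lemma MultiIndex.isSucc_first (i : Fin 3) : IsSucc i zero (first i) := by
  revert i; unfold IsSucc; decide

lemma MultiIndex.isSucc_pair (i j : Fin 3) : IsSucc j (first i) (pair i j) := by
  revert i j; unfold IsSucc; decide

lemma MultiIndex.isSucc_triple (i j l : Fin 3) : IsSucc l (pair i j) (triple i j l) := by
  revert i j l; unfold IsSucc; decide

lemma MultiIndex.pair_comm (i j : Fin 3) : pair i j = pair j i := Subtype.ext (add_comm _ _)

lemma MultiIndex.second_eq (i : Fin 3) : second i = pair i i := by revert i; decide

set_option maxRecDepth 10000 in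
lemma MultiIndex.of_order_le_two : ∀ β : MultiIndex 3, β.order ≤ 2 →
    β = zero ∨ (∃ i, β = first i) ∨ ∃ i j, β = pair i j := by
  decide

lemma MultiIndex.IsSucc.order {i : Fin 3} {β β' : MultiIndex 3} (h : IsSucc i β β') :
    β'.order = β.order + 1 := by
  simp only [MultiIndex.order, h _, Finset.sum_add_distrib]
  simp

lemma iterate_partialD_comm (i j : Fin 3) (n : ℕ) {φ : Pt → ℝ} (h : ContDiff ℝ ∞ φ) :
    (partialD i)^[n] (partialD j φ) = partialD j ((partialD i)^[n] φ) := by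
  induction n generalizing φ with
  | zero => rfl
  | succ n ih =>
    rw [Function.iterate_succ_apply, Function.iterate_succ_apply, ← ih (contDiff_partialD i h),
      partialD_comm h i j]

lemma contDiff_iterate_partialD (i : Fin 3) (n : ℕ) {φ : Pt → ℝ} (h : ContDiff ℝ ∞ φ) :
    ContDiff ℝ ∞ ((partialD i)^[n] φ) := by
  induction n with
  | zero => exact h
  | succ n ih =>
    rw [Function.iterate_succ_apply']
    exact contDiff_partialD i ih

/-- In `multiD` the z-derivatives act first, so an additional ∂_i has to be commuted through the
iterates to become innermost. -/
lemma multiD_isSucc {i : Fin 3} {β β' : MultiIndex 3} (hβ : MultiIndex.IsSucc i β β')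
    {φ : Pt → ℝ} (h : ContDiff ℝ ∞ φ) : multiD β' φ = multiD β (partialD i φ) := by
  have h2 := contDiff_iterate_partialD 2 (β.1 2) h
  have h1 := contDiff_iterate_partialD 1 (β.1 1) h2
  simp only [multiD, hβ _]
  fin_cases i
  · simp [iterate_partialD_comm 2 0 _ h, iterate_partialD_comm 1 0 _ h2]
  · simp [iterate_partialD_comm 2 1 _ h]
  · simp

lemma IsTest.partialD {φ : Pt → ℝ} (h : IsTest R φ) (i : Fin 3) : IsTest R (partialD i φ) :=
  ⟨contDiff_partialD i h.smooth, hasCompactSupport_partialD i h.compact,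
    (tsupport_partialD_subset i φ).trans h.support⟩

/-- In `H3` every derivative is tied to the function itself only. Testing order β with ∂_iφ and
order β' with φ gives the same left-hand side, which relates the two derivatives directly. -/
lemma integral_smul_wD_isSucc {N : ℕ} (V : H3 N R) {β β' : MultiIndex 3}
    (hβ : MultiIndex.IsSucc i β β') {φ : Pt → ℝ} (h : IsTest R φ) :
    ∫ x in cube R, partialD i φ x • wD β V x = -∫ x in cube R, φ x • wD β' V x := by
  have h1 := V.2 β _ (h.partialD i)
  have h2 := V.2 β' _ h
  rw [multiD_isSucc hβ h.smooth, h1, hβ.order, pow_succ, mul_smul] at h2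
  have h3 : ((-1 : ℝ) ^ β.order) ≠ 0 := by simp
  simpa [wD] using smul_right_injective _ h3 h2

lemma integral_mul_wDc {N : ℕ} (V : H3 N R) (c : Fin N × Bool) (β : MultiIndex 3) {φ : Pt → ℝ}
    (hφ : Continuous φ) (hs : HasCompactSupport φ) :
    ∫ x in cube R, φ x * wDc c β V x = cpt c (∫ x in cube R, φ x • wD β V x) := by
  rw [← (cpt c).integral_comp_comm (integrable_smul_L2 hφ hs _)]
  simp [wDc]

lemma hasWD_wDc {N : ℕ} (V : H3 N R) {β β' : MultiIndex 3} (hβ : MultiIndex.IsSucc i β β')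
    (c : Fin N × Bool) : HasWD R (cube R) i (wDc c β V) (wDc c β' V) := by
  refine ⟨memLp_wDc c β V, memLp_wDc c β' V, fun ψ h1 h2 h3 => ?_⟩
  rw [integral_mul_wDc V c β (contDiff_partialD i h1).continuous (hasCompactSupport_partialD i h2),
    integral_mul_wDc V c β' h1.continuous h2, integral_smul_wD_isSucc V hβ ⟨h1, h2, h3⟩, map_neg]

/-! ### Boundary values -/

/-- The restriction of `∂^β` to `H³`, as a continuous linear map into `L²`. -/
noncomputable def wDL {N : ℕ} (R : ℝ) (β : MultiIndex 3) : H3 N R →L[ℝ] L2 N R :=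
  (PiLp.proj 2 (fun _ : MultiIndex 3 => L2 N R) β : Jets N R →L[ℝ] L2 N R) ∘L (H3 N R).subtypeL

lemma wDL_apply {N : ℕ} (β : MultiIndex 3) (V : H3 N R) : wDL R β V = wD β V := rfl

lemma wDc_sub {N : ℕ} (c : Fin N × Bool) (β : MultiIndex 3) (V W : H3 N R) :
    wDc c β (V - W) =ᵐ[cubeMeasure R] fun x => wDc c β V x - wDc c β W x := by
  filter_upwards [Lp.coeFn_sub (wD β V) (wD β W)] with x hx
  have e : wD β (V - W) = wD β V - wD β W := map_sub (wDL R β) V W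
  rw [wDc, e, hx]
  simp [wDc]

lemma continuous_integral_mul_wDc {N : ℕ} (c : Fin N × Bool) (β : MultiIndex 3) {w : Pt → ℝ}
    (hw : Continuous w) : Continuous fun V : H3 N R => ∫ x in cube R, w x * wDc c β V x := by
  have hm := memLp_of_continuous R 2 hw
  have h : Continuous fun V : H3 N R =>
      inner ℝ (hm.toLp w) ((cpt c).compLpL 2 (cubeMeasure R) (wDL R β V)) :=
    continuous_const.inner (((cpt c).compLpL 2 (cubeMeasure R)).continuous.comp (wDL R β).continuous)
  refine h.congr fun V => ?_
  rw [L2.inner_def]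
  refine integral_congr_ae ?_
  filter_upwards [hm.coeFn_toLp, (cpt c).coeFn_compLpL (wDL R β V)] with x h1 h2
  rw [h1, h2]
  simp [wDc, wDL_apply, mul_comm]

/-- The pairs `(∂^β, ∂^β')` for which integration by parts holds form a closed condition. -/
lemma hasWD_wDc_of_mem_closure {N : ℕ} {c : Fin N × Bool} {β β' : MultiIndex 3}
    {S : Set (H3 N R)} (hS : ∀ W ∈ S, HasWD R U i (wDc c β W) (wDc c β' W)) {W : H3 N R}
    (hW : W ∈ closure S) : HasWD R U i (wDc c β W) (wDc c β' W) := by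
  refine ⟨memLp_wDc c β W, memLp_wDc c β' W, fun ψ h1 h2 h3 => ?_⟩
  have hcl : IsClosed {W : H3 N R | ∫ x in cube R, partialD i ψ x * wDc c β W x =
      -∫ x in cube R, ψ x * wDc c β' W x} :=
    isClosed_eq (continuous_integral_mul_wDc c β (contDiff_partialD i h1).continuous)
      (continuous_integral_mul_wDc c β' h1.continuous).neg
  exact closure_minimal (fun W hW => (hS W hW).ibp ψ h1 h2 h3) hcl hW

lemma hasWD_wDc_sub {N : ℕ} {c : Fin N × Bool} {β β' : MultiIndex 3} {W₁ W₂ : H3 N R}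
    (h₁ : HasWD R U i (wDc c β W₁) (wDc c β' W₁)) (h₂ : HasWD R U i (wDc c β W₂) (wDc c β' W₂)) :
    HasWD R U i (wDc c β (W₂ - W₁)) (wDc c β' (W₂ - W₁)) := by
  refine (h₂.add (h₁.const_mul (-1))).congr ?_ ?_
  · filter_upwards [wDc_sub c β W₂ W₁] with x hx
    rw [hx]; ring
  · filter_upwards [wDc_sub c β' W₂ W₁] with x hx
    rw [hx]; ring

lemma move_coord_mem_frontier (hR : 0 < R) {σ : ℝ} (hσ : σ = 1 ∨ σ = -1) {x : Pt}
    (hx : x ∈ cube R) (i : Fin 3) :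
    x + (σ * R - x i) • EuclideanSpace.single i 1 ∈ frontier (cube R) := by
  have hσ2 : |σ| = 1 := by rcases hσ with rfl | rfl <;> simp
  rw [frontier, (isOpen_cube R).interior_eq]
  refine ⟨mem_closure_cube hR fun l => ?_, fun h => ?_⟩
  · by_cases hl : l = i
    · subst hl
      simp [abs_mul, hσ2, abs_of_pos hR]
    · simpa [hl] using (hx l).le
  · have := h i
    simp [abs_mul, hσ2, abs_of_pos hR] at this

/-- The parallel faces never matter; the two orthogonal ones are removed in turn by means of the
continuous representative that vanishes on the boundary. -/
lemma hasWD_univ_of_mem_ballZero {N : ℕ} {ρ : ℝ} (hR : 0 < R) {W : H3 N R}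
    (hW : W ∈ ballZero N R ρ) (c : Fin N × Bool) (i : Fin 3) :
    HasWD R univ i (wDc c MultiIndex.zero W) (wDc c (MultiIndex.first i) W) := by
  obtain ⟨F, hF, hFf, h0⟩ := hW.2.1
  have hF' : ContinuousOn (fun x => cpt c (F x)) (closure (cube R)) :=
    (cpt c).continuous.comp_continuousOn hF
  have hFf' : (fun x => cpt c (F x)) =ᵐ[cubeMeasure R] wDc c MultiIndex.zero W := by
    filter_upwards [hFf] with x hx
    rw [hx, wDc]
  have h1 := (hasWD_wDc W (MultiIndex.isSucc_first i) c).to_slab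
  have h2 := h1.remove_face hR (Or.inr rfl) hF' hFf' fun x hx => by
    rw [h0 _ (move_coord_mem_frontier hR (Or.inr rfl) hx i), map_zero]
  rw [← univ_inter {x : Pt | (1 : ℝ) * x i < R}] at h2
  exact h2.remove_face hR (Or.inl rfl) hF' hFf' fun x hx => by
    rw [h0 _ (move_coord_mem_frontier hR (Or.inl rfl) hx i), map_zero]

/-- Only the lower face can be removed, since ∂_zW is known to vanish there alone. The feet of
perpendiculars from interior points lie in the open face, so nothing is needed on its edges. -/
lemma hasWD_lower_of_mem_ballZero {N : ℕ} {ρ : ℝ} (hR : 0 < R) {W : H3 N R}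
    (hW : W ∈ ballZero N R ρ) (c : Fin N × Bool) :
    HasWD R {x | (1 : ℝ) * x 2 < R} 2 (wDc c (MultiIndex.first 2) W)
      (wDc c (MultiIndex.pair 2 2) W) := by
  obtain ⟨F, hF, hFf, h0⟩ := hW.2.2
  have hF' : ContinuousOn (fun x => cpt c (F x)) (closure (cube R)) :=
    (cpt c).continuous.comp_continuousOn hF
  have hFf' : (fun x => cpt c (F x)) =ᵐ[cubeMeasure R] wDc c (MultiIndex.first 2) W := by
    filter_upwards [hFf] with x hx
    rw [hx, wDc]
  refine (hasWD_wDc W (MultiIndex.isSucc_pair 2 2) c).to_slab.remove_face hR (Or.inr rfl) hF' hFf'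
    fun x hx => ?_
  rw [h0 _ ⟨?_, ?_, ?_⟩, map_zero]
  · simpa using hx 0
  · simpa using hx 1
  · simp

/-- Limits of elements of the ball are handled through the integral form of the boundary conditions,
which is closed; no continuous representative of a limit is needed. -/
lemma dirichletData_sub {N : ℕ} {ρ : ℝ} (hR : 0 < R) {W₁ W₂ : H3 N R}
    (h₁ : W₁ ∈ closure (ballZero N R ρ)) (h₂ : W₂ ∈ closure (ballZero N R ρ))
    (c : Fin N × Bool) :
    DirichletData R (wDc c MultiIndex.zero (W₂ - W₁)) (fun i => wDc c (MultiIndex.first i) (W₂ - W₁))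
      (fun i j => wDc c (MultiIndex.pair i j) (W₂ - W₁)) where
  zero i := hasWD_wDc_sub
    (hasWD_wDc_of_mem_closure (fun _ h => hasWD_univ_of_mem_ballZero hR h c i) h₁)
    (hasWD_wDc_of_mem_closure (fun _ h => hasWD_univ_of_mem_ballZero hR h c i) h₂)
  second i j := hasWD_wDc _ (MultiIndex.isSucc_pair i j) c
  third i j l := ⟨_, hasWD_wDc _ (MultiIndex.isSucc_triple i j l) c⟩
  symm i j := by rw [MultiIndex.pair_comm]
  lower := hasWD_wDc_sub
    (hasWD_wDc_of_mem_closure (fun _ h => hasWD_lower_of_mem_ballZero hR h c) h₁)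
    (hasWD_wDc_of_mem_closure (fun _ h => hasWD_lower_of_mem_ballZero hR h c) h₂)

end ConvexCIP

namespace ConvexCIP

open Filter Topology

variable {R : ℝ} {U V : Set Pt} {i j : Fin 3} {f g f' g' : Pt → ℝ}

/-! ### Quartic functionals on Hilbert spaces -/

section Abstract

variable {X Y : Type*} [NormedAddCommGroup X] [InnerProductSpace ℝ X] [NormedAddCommGroup Y]
  [InnerProductSpace ℝ Y]

/-- The second-order expansion of `κ ‖A V + B V V‖² + γ ‖V‖²`, `V = W + G`. -/
lemma exists_hasFDerivAt_quartic (A : X →L[ℝ] Y) (B : X →L[ℝ] X →L[ℝ] Y) (κ γ : ℝ) (G W : X) :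
    ∃ F' : X →L[ℝ] ℝ,
      HasFDerivAt (fun W => κ * ‖A (W + G) + B (W + G) (W + G)‖ ^ 2 + γ * ‖W + G‖ ^ 2) F' W ∧
      ∀ h, κ * ‖A (W + h + G) + B (W + h + G) (W + h + G)‖ ^ 2 + γ * ‖W + h + G‖ ^ 2 -
        (κ * ‖A (W + G) + B (W + G) (W + G)‖ ^ 2 + γ * ‖W + G‖ ^ 2) - F' h =
        κ * (‖A h + B (W + G) h + B h (W + G) + B h h‖ ^ 2 +
          2 * inner ℝ (A (W + G) + B (W + G) (W + G)) (B h h)) + γ * ‖h‖ ^ 2 := by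
  have hid : HasFDerivAt (fun W : X => W + G) (ContinuousLinearMap.id ℝ X) W :=
    (hasFDerivAt_id W).add_const G
  have hA : HasFDerivAt (fun W : X => A (W + G)) (A ∘L ContinuousLinearMap.id ℝ X) W :=
    A.hasFDerivAt.comp W hid
  have hB := B.hasFDerivAt_of_bilinear hid hid
  have h : HasFDerivAt
      (fun W => κ * ‖A (W + G) + B (W + G) (W + G)‖ ^ 2 + γ * ‖W + G‖ ^ 2)
      (κ • (2 • (innerSL ℝ (A (W + G) + B (W + G) (W + G)) ∘L (A ∘L ContinuousLinearMap.id ℝ X +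
        (B.precompR X (W + G) (ContinuousLinearMap.id ℝ X) +
          B.precompL X (ContinuousLinearMap.id ℝ X) (W + G))))) +
        γ • (2 • (innerSL ℝ (W + G) ∘L ContinuousLinearMap.id ℝ X))) W :=
    (((hA.add hB).norm_sq).const_mul κ).add ((hid.norm_sq).const_mul γ)
  refine ⟨_, h, fun h => ?_⟩
  have e1 : W + h + G = W + G + h := by abel
  rw [e1]
  generalize W + G = v
  have e2 : A (v + h) + B (v + h) (v + h) =
      (A v + B v v) + ((A h + B v h + B h v) + B h h) := by
    simp only [map_add, _root_.add_apply]
    abel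
  have e3 : ‖A (v + h) + B (v + h) (v + h)‖ ^ 2 = ‖A v + B v v‖ ^ 2 +
      2 * (inner ℝ (A v + B v v) (A h + B v h + B h v) + inner ℝ (A v + B v v) (B h h)) +
      ‖A h + B v h + B h v + B h h‖ ^ 2 := by
    rw [e2, norm_add_sq_real, inner_add_right]
  rw [e3, norm_add_sq_real v h]
  simp [inner_add_right, inner_add_left]
  ring

/-- Keeps the weight operator T outside S and Q, so that the remainder can be read pointwise as the
Carleman weight times an expression free of λ. -/
lemma exists_hasFDerivAt_of_eq_quartic {Z : Type*} [NormedAddCommGroup Z] [InnerProductSpace ℝ Z]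
    (T : Y →L[ℝ] Z) (S : X →L[ℝ] Y) (Q : X →L[ℝ] X →L[ℝ] Y) (κ γ : ℝ) (G : X) {F : X → ℝ}
    (hF : ∀ W, F W = κ * ‖T (S (W + G) + Q (W + G) (W + G))‖ ^ 2 + γ * ‖W + G‖ ^ 2) :
    ∃ F' : X → X →L[ℝ] ℝ, (∀ W, HasFDerivAt F (F' W) W) ∧
      ∀ V W, F W - F V - F' V (W - V) =
        κ * (‖T (S (W - V) + Q (V + G) (W - V) + Q (W - V) (V + G) + Q (W - V) (W - V))‖ ^ 2 +
          2 * inner ℝ (T (S (V + G) + Q (V + G) (V + G))) (T (Q (W - V) (W - V)))) +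
        γ * ‖W - V‖ ^ 2 := by
  choose F' hF' hexp using exists_hasFDerivAt_quartic (T ∘L S)
    ((ContinuousLinearMap.compL ℝ X Y Z T) ∘L Q) κ γ G
  have e : F = fun W => κ * ‖(T ∘L S) (W + G) +
      ((ContinuousLinearMap.compL ℝ X Y Z T) ∘L Q) (W + G) (W + G)‖ ^ 2 + γ * ‖W + G‖ ^ 2 := by
    funext W
    rw [hF, map_add T]
    rfl
  refine ⟨F', fun W => e ▸ hF' W, fun V W => ?_⟩
  have h := hexp V (W - V)
  rw [add_sub_cancel] at h
  rw [hF, hF]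
  simp only [map_add T]
  exact h

/-- The strict tangent inequality at the intermediate point z, towards x and towards y. The
increments are b(x - y) and -a(x - y), so the linear terms cancel in the combination with weights a
and b. -/
lemma strictConvexOn_of_lt_sub {s : Set X} (hs : Convex ℝ s) {F : X → ℝ} {F' : X → X →L[ℝ] ℝ}
    (h : ∀ x ∈ s, ∀ y ∈ s, x ≠ y → 0 < F y - F x - F' x (y - x)) : StrictConvexOn ℝ s F := by
  refine ⟨hs, fun x hx y hy hxy a b ha hb hab => ?_⟩
  have hz : a • x + b • y ∈ s := hs hx hy ha.le hb.le hab
  have hb' : b = 1 - a := by linarith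
  have e1 : x - (a • x + b • y) = b • (x - y) := by rw [hb']; module
  have e2 : y - (a • x + b • y) = -(a • (x - y)) := by rw [hb']; module
  have hne : x - y ≠ 0 := sub_ne_zero.2 hxy
  have h1 := h _ hz x hx fun h0 => by
    rw [h0, sub_self] at e1
    exact smul_ne_zero hb.ne' hne e1.symm
  have h2 := h _ hz y hy fun h0 => by
    rw [h0, sub_self] at e2
    exact neg_ne_zero.2 (smul_ne_zero ha.ne' hne) e2.symm
  rw [e1, map_smul] at h1
  rw [e2, map_neg, map_smul] at h2
  simp only [smul_eq_mul] at *
  have h3 := mul_pos ha h1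
  have h4 := mul_pos hb h2
  have h5 : a * F (a • x + b • y) + b * F (a • x + b • y) = F (a • x + b • y) := by
    rw [← add_mul, hab, one_mul]
  linarith

end Abstract

/-! ### Sobolev embeddings for elements of `H³` -/

lemma pow_four_sum_le {ι : Type*} [Fintype ι] (a : ι → ℝ) :
    (∑ k, a k) ^ 4 ≤ (Fintype.card ι : ℝ) ^ 3 * ∑ k, a k ^ 4 := by
  have h1 : (∑ k, a k) ^ 2 ≤ Fintype.card ι * ∑ k, a k ^ 2 := sq_sum_le_card_mul_sum_sq
  have h2 : (∑ k, a k ^ 2) ^ 2 ≤ Fintype.card ι * ∑ k, (a k ^ 2) ^ 2 := sq_sum_le_card_mul_sum_sq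
  calc (∑ k, a k) ^ 4 = ((∑ k, a k) ^ 2) ^ 2 := by ring
    _ ≤ (Fintype.card ι * ∑ k, a k ^ 2) ^ 2 := by gcongr
    _ = (Fintype.card ι : ℝ) ^ 2 * (∑ k, a k ^ 2) ^ 2 := by ring
    _ ≤ (Fintype.card ι : ℝ) ^ 2 * (Fintype.card ι * ∑ k, (a k ^ 2) ^ 2) := by gcongr
    _ = (Fintype.card ι : ℝ) ^ 3 * ∑ k, a k ^ 4 := by
      simp only [← pow_mul]
      ring

lemma weakEnergy_wDc_le {N : ℕ} (c : Fin N × Bool) (V : H3 N R) (β : MultiIndex 3)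
    (β' : Fin 3 → MultiIndex 3) :
    weakEnergy R (wDc c β V) (fun j => wDc c (β' j) V) ≤ 4 * ‖V‖ ^ 2 := by
  rw [weakEnergy, Fin.sum_univ_three]
  linarith [integral_wDc_sq_le c β V, integral_wDc_sq_le c (β' 0) V, integral_wDc_sq_le c (β' 1) V,
    integral_wDc_sq_le c (β' 2) V]

/-- A derivative of order at most 2 has its own first derivatives in L², so Gagliardo–Nirenberg
applies. The constant C + 64 avoids a square root through 64C ≤ (C + 64)². -/
lemma exists_four_bound (hR : 0 < R) : ∃ C, 0 < C ∧ ∀ (N : ℕ) (V : H3 N R) (c : Fin N × Bool)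
    (β : MultiIndex 3) (β' : Fin 3 → MultiIndex 3), (∀ j, MultiIndex.IsSucc j β (β' j)) →
    Integrable (fun x => wDc c β V x ^ 4) (cubeMeasure R) ∧
      ∫ x in cube R, wDc c β V x ^ 4 ≤ C * ‖V‖ ^ 4 := by
  obtain ⟨C, hC, h⟩ := exists_gagliardoNirenberg_four hR
  refine ⟨C + 64, by positivity, fun N V c β β' hβ => ?_⟩
  obtain ⟨h1, h2⟩ := h _ _ fun j => hasWD_wDc V (hβ j) c
  refine ⟨h1, le_of_sq_le_sq ?_ (by positivity)⟩
  have hE := weakEnergy_wDc_le c V β β'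
  have hE0 := weakEnergy_nonneg R (wDc c β V) (fun j => wDc c (β' j) V)
  have h0 : 0 ≤ ∫ x in cube R, wDc c β V x ^ 2 := integral_nonneg fun _ => sq_nonneg _
  calc _ ≤ _ := h2
    _ ≤ C * ‖V‖ ^ 2 * (4 * ‖V‖ ^ 2) ^ 3 := by
      gcongr
      exact integral_wDc_sq_le c β V
    _ = (64 * C) * ‖V‖ ^ 8 := by ring
    _ ≤ (C + 64) ^ 2 * ‖V‖ ^ 8 := by
      gcongr
      nlinarith
    _ = _ := by ring

/-- First derivatives of H³ functions are in H². The 16 counts four energies of at most 4‖V‖² each.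
-/
lemma exists_eight_bound (hR : 0 < R) : ∃ C, 0 < C ∧ ∀ (N : ℕ) (V : H3 N R) (c : Fin N × Bool)
    (i : Fin 3), Integrable (fun x => wDc c (MultiIndex.first i) V x ^ 8) (cubeMeasure R) ∧
      ∫ x in cube R, wDc c (MultiIndex.first i) V x ^ 8 ≤ C * ‖V‖ ^ 8 := by
  obtain ⟨C, hC, h⟩ := exists_sobolev_eight hR
  refine ⟨C * 16 ^ 4, by positivity, fun N V c i => ?_⟩
  obtain ⟨h1, h2⟩ := h _ _ (fun j l => wDc c (MultiIndex.triple i j l) V)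
    (fun j => hasWD_wDc V (MultiIndex.isSucc_pair i j) c)
    (fun j l => hasWD_wDc V (MultiIndex.isSucc_triple i j l) c)
  refine ⟨h1, h2.trans ?_⟩
  have hE := weakEnergy_wDc_le c V (MultiIndex.first i) (MultiIndex.pair i)
  have hE' := fun j => weakEnergy_wDc_le c V (MultiIndex.pair i j) (MultiIndex.triple i j)
  rw [Fin.sum_univ_three]
  have hE0 := weakEnergy_nonneg R (wDc c (MultiIndex.first i) V)
    (fun j => wDc c (MultiIndex.pair i j) V)
  have hE0' := fun j => weakEnergy_nonneg R (wDc c (MultiIndex.pair i j) V)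
    (fun l => wDc c (MultiIndex.triple i j l) V)
  have := hE' 0
  have := hE' 1
  have := hE' 2
  have := hE0' 0
  have := hE0' 1
  have := hE0' 2
  calc _ ≤ C * (16 * ‖V‖ ^ 2) ^ 4 := by
        gcongr
        linarith
    _ = _ := by ring

/-- The values of gradients of `ℂ^N`-valued functions. -/
abbrev Grad (N : ℕ) : Type := Fin 3 → Val N

/-- The gradient of an element of `H³`. -/
noncomputable def gradFun {N : ℕ} (V : H3 N R) (x : Pt) : Grad N := fun i => wD (MultiIndex.first i) V x

lemma norm_gradFun_sq_le {N : ℕ} (V : H3 N R) (x : Pt) :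
    ‖gradFun V x‖ ^ 2 ≤ ∑ k : Fin 3 × (Fin N × Bool), wDc k.2 (MultiIndex.first k.1) V x ^ 2 := by
  have h0 : 0 ≤ ∑ k : Fin 3 × (Fin N × Bool), wDc k.2 (MultiIndex.first k.1) V x ^ 2 :=
    Finset.sum_nonneg fun _ _ => sq_nonneg _
  rw [← Real.sqrt_le_sqrt_iff h0, Real.sqrt_sq (norm_nonneg _)]
  refine (pi_norm_le_iff_of_nonneg (Real.sqrt_nonneg _)).2 fun i => ?_
  refine Real.le_sqrt_of_sq_le ?_
  rw [gradFun, ← sum_sq_cpt, Fintype.sum_prod_type (α₁ := Fin 3)]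
  exact Finset.single_le_sum (f := fun i => ∑ c : Fin N × Bool, wDc c (MultiIndex.first i) V x ^ 2)
    (fun _ _ => Finset.sum_nonneg fun _ _ => sq_nonneg _) (Finset.mem_univ i)

lemma aestronglyMeasurable_gradFun {N : ℕ} (V : H3 N R) :
    AEStronglyMeasurable (gradFun V) (cubeMeasure R) :=
  (memLp_pi_iff.2 fun i => Lp.memLp (wD (MultiIndex.first i) V)).1

lemma exists_gradFun_four_bound (hR : 0 < R) (N : ℕ) : ∃ C, 0 < C ∧ ∀ V : H3 N R,
    Integrable (fun x => ‖gradFun V x‖ ^ 4) (cubeMeasure R) ∧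
      ∫ x in cube R, ‖gradFun V x‖ ^ 4 ≤ C * ‖V‖ ^ 4 := by
  obtain ⟨C, hC, h⟩ := exists_four_bound hR
  set n : ℝ := (Fintype.card (Fin 3 × (Fin N × Bool)) : ℝ)
  refine ⟨n * (n * C) + 1, by positivity, fun V => ?_⟩
  have hk := fun k : Fin 3 × (Fin N × Bool) =>
    h N V k.2 (MultiIndex.first k.1) (MultiIndex.pair k.1) (MultiIndex.isSucc_pair k.1)
  have hint := (integrable_finsetSum (Finset.univ : Finset (Fin 3 × (Fin N × Bool)))
    fun k _ => (hk k).1).const_mul n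
  have hle : ∀ x, ‖gradFun V x‖ ^ 4 ≤ n * ∑ k : Fin 3 × (Fin N × Bool),
      wDc k.2 (MultiIndex.first k.1) V x ^ 4 := fun x => by
    calc ‖gradFun V x‖ ^ 4 = (‖gradFun V x‖ ^ 2) ^ 2 := by ring
      _ ≤ (∑ k : Fin 3 × (Fin N × Bool), wDc k.2 (MultiIndex.first k.1) V x ^ 2) ^ 2 := by
        gcongr
        exact norm_gradFun_sq_le V x
      _ ≤ n * ∑ k : Fin 3 × (Fin N × Bool), (wDc k.2 (MultiIndex.first k.1) V x ^ 2) ^ 2 :=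
        sq_sum_le_card_mul_sum_sq
      _ = _ := by simp only [← pow_mul]
  have h1 : Integrable (fun x => ‖gradFun V x‖ ^ 4) (cubeMeasure R) :=
    hint.mono' ((aestronglyMeasurable_gradFun V).norm.pow 4) (Eventually.of_forall fun x => by
      rw [Real.norm_of_nonneg (by positivity)]
      exact hle x)
  refine ⟨h1, ?_⟩
  calc _ ≤ ∫ x in cube R, n * ∑ k : Fin 3 × (Fin N × Bool),
        wDc k.2 (MultiIndex.first k.1) V x ^ 4 := integral_mono h1 hint hle
    _ = n * ∑ k : Fin 3 × (Fin N × Bool), ∫ x in cube R,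
        wDc k.2 (MultiIndex.first k.1) V x ^ 4 := by
      rw [integral_const_mul, integral_finsetSum _ fun k _ => (hk k).1]
    _ ≤ n * ∑ k : Fin 3 × (Fin N × Bool), C * ‖V‖ ^ 4 := by
      gcongr with k
      exact (hk k).2
    _ = n * (n * C) * ‖V‖ ^ 4 := by
      rw [Finset.sum_const, nsmul_eq_mul, Finset.card_univ]
      ring
    _ ≤ _ := by
      gcongr
      linarith

lemma memLp_four_iff {E : Type*} [NormedAddCommGroup E] {F : Pt → E} {μ : Measure Pt}
    (hF : AEStronglyMeasurable F μ) : MemLp F 4 μ ↔ Integrable (fun x => ‖F x‖ ^ 4) μ := by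
  rw [← integrable_norm_rpow_iff hF (by norm_num) (by norm_num)]
  simp

lemma norm_toLp_pow_four {E : Type*} [NormedAddCommGroup E] {F : Pt → E} {μ : Measure Pt}
    (hF : MemLp F 4 μ) : ‖hF.toLp F‖ ^ 4 = ∫ x, ‖F x‖ ^ 4 ∂μ := by
  have h0 : 0 ≤ ∫ x, ‖F x‖ ^ 4 ∂μ := integral_nonneg fun _ => by positivity
  rw [Lp.norm_toLp, hF.eLpNorm_eq_integral_rpow_norm (by norm_num) (by norm_num)]
  have e : ((4 : ENNReal).toReal) = ((4 : ℕ) : ℝ) := by simp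
  simp only [e, Real.rpow_natCast]
  rw [ENNReal.toReal_ofReal (by positivity), Real.rpow_inv_natCast_pow h0 (by norm_num)]

instance fact_one_le_four : Fact ((1 : ENNReal) ≤ 4) := ⟨by norm_num⟩

instance holderTriple_four_four_two : ENNReal.HolderTriple 4 4 2 where
  inv_add_inv_eq_inv := by
    have : (4 : ENNReal) = 2 * 2 := by norm_num
    rw [this, ENNReal.mul_inv (by simp) (by simp), ← mul_add, ENNReal.inv_two_add_inv_two, mul_one]

/-- With gradients in L⁴, products of two of them are in L² by Hölder with exponents 4, 4, 2; this
is what makes the quadratic term a bounded bilinear operator. The bound C + 1 works because C ≤ (C +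
1)⁴. -/
lemma exists_gradient_map (hR : 0 < R) (N : ℕ) : ∃ D : H3 N R →L[ℝ] Lp (Grad N) 4 (cubeMeasure R),
    ∀ V, D V =ᵐ[cubeMeasure R] gradFun V := by
  obtain ⟨C, hC, h⟩ := exists_gradFun_four_bound hR N
  have hm := fun V : H3 N R => (memLp_four_iff (aestronglyMeasurable_gradFun V)).2 (h V).1
  refine ⟨LinearMap.mkContinuous
    { toFun := fun V => (hm V).toLp _
      map_add' := fun V W => ?_
      map_smul' := fun t V => ?_ } (C + 1) fun V => ?_, fun V => (hm V).coeFn_toLp⟩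
  · rw [← MemLp.toLp_add]
    refine MemLp.toLp_congr _ _ ?_
    have : ∀ᵐ x ∂cubeMeasure R, ∀ i : Fin 3, wD (MultiIndex.first i) (V + W) x =
        wD (MultiIndex.first i) V x + wD (MultiIndex.first i) W x :=
      ae_all_iff.2 fun i => Lp.coeFn_add (wD (MultiIndex.first i) V) (wD (MultiIndex.first i) W)
    filter_upwards [this] with x hx
    exact funext hx
  · rw [RingHom.id_apply, ← MemLp.toLp_const_smul]
    refine MemLp.toLp_congr _ _ ?_
    have : ∀ᵐ x ∂cubeMeasure R, ∀ i : Fin 3, wD (MultiIndex.first i) (t • V) x =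
        t • wD (MultiIndex.first i) V x :=
      ae_all_iff.2 fun i => Lp.coeFn_smul t (wD (MultiIndex.first i) V)
    filter_upwards [this] with x hx
    exact funext hx
  · refine le_of_pow_le_pow_left₀ (n := 4) (by norm_num) (by positivity) ?_
    simp only [LinearMap.coe_mk, AddHom.coe_mk]
    rw [norm_toLp_pow_four]
    refine (h V).2.trans ?_
    rw [mul_pow]
    gcongr
    nlinarith [sq_nonneg C, pow_pos hC 3, pow_pos hC 4]

end ConvexCIP

namespace ConvexCIP

open Filter Topology

variable {R : ℝ} {U V : Set Pt} {i j : Fin 3} {f g f' g' : Pt → ℝ}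

/-! ### The structure of the nonlinearity -/

lemma contDiff_gs (a : ℝ) (n : ℕ) : ContDiff ℝ ∞ (gs a n) := by
  induction n using Nat.strong_induction_on with
  | _ n ih =>
    have e : gs a n = fun α => α ^ n * Real.exp α -
        ∑ i : Fin n, ip a (fun s => s ^ n * Real.exp s) (gs a i) / ip a (gs a i) (gs a i) *
          gs a i α := by
      funext α
      rw [gs]
    rw [e]
    refine ContDiff.sub (by fun_prop) (ContDiff.sum fun i _ => contDiff_const.mul (ih i i.2))

lemma contDiff_Psi (a : ℝ) (n : ℕ) : ContDiff ℝ ∞ (Psi a n) :=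
  (contDiff_gs a n).div_const _

lemma continuous_Psi (a : ℝ) (n : ℕ) : Continuous (Psi a n) := (contDiff_Psi a n).continuous

lemma continuous_deriv_Psi (a : ℝ) (n : ℕ) : Continuous (deriv (Psi a n)) :=
  (contDiff_Psi a n).continuous_deriv (by simp)

lemma continuous_src (d : ℝ) : Continuous (src d) := by
  unfold src
  refine (PiLp.continuous_toLp 2 _).comp (continuous_pi fun i => ?_)
  fin_cases i
  · exact continuous_id
  · exact continuous_const
  · exact continuous_const

/-- The sources lie on the plane z = -d, below the cube since d > R, so the denominators stay away
from 0. -/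
lemma le_norm_sub_src {d : ℝ} {x : Pt} (hx : x ∈ cube R) (α : ℝ) : d - R ≤ ‖x - src d α‖ := by
  have h1 : ‖(x - src d α) 2‖ ≤ ‖x - src d α‖ := PiLp.norm_apply_le _ 2
  have h2 : (x - src d α) 2 = x 2 + d := by simp [src]
  rw [h2, Real.norm_eq_abs] at h1
  have := (abs_lt.1 (hx 2)).1
  linarith [le_abs_self (x 2 + d)]

/-- The distance to the source, bounded below away from the cube. -/
noncomputable def truncDist (R d : ℝ) (x : Pt) (α : ℝ) : ℝ := max ‖x - src d α‖ (d - R)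

lemma continuous_truncDist (R d : ℝ) : Continuous fun q : Pt × ℝ => truncDist R d q.1 q.2 :=
  ((continuous_fst.sub ((continuous_src d).comp continuous_snd)).norm).max continuous_const

lemma truncDist_pos {d : ℝ} (hd : R < d) (x : Pt) (α : ℝ) : 0 < truncDist R d x α :=
  (sub_pos.2 hd).trans_le (le_max_right _ _)

lemma truncDist_eq {d : ℝ} {x : Pt} (hx : x ∈ cube R) (α : ℝ) :
    truncDist R d x α = ‖x - src d α‖ := max_eq_left (le_norm_sub_src hx α)

lemma continuous_ofReal_div_truncDist {d : ℝ} (hd : R < d) {w : Pt × ℝ → ℝ} (hw : Continuous w)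
    (n : ℕ) : Continuous fun q : Pt × ℝ => ((w q / truncDist R d q.1 q.2 ^ n : ℝ) : ℂ) :=
  Complex.continuous_ofReal.comp (hw.div ((continuous_truncDist R d).pow n)
    fun q => (pow_pos (truncDist_pos hd q.1 q.2) n).ne')

/-- Replacing the distance by `truncDist` changes nothing on the cube and makes the kernel
continuous everywhere, which continuity of the integrals over α requires. -/
lemma exists_continuous_xTilde {d : ℝ} (hd : R < d) (k : ℝ) (i : Fin 3) :
    ∃ χ : Pt → ℝ → ℂ, Continuous (Function.uncurry χ) ∧
      ∀ x ∈ cube R, ∀ α, χ x α = xTilde k d α x i := by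
  have hw : Continuous fun q : Pt × ℝ => (q.1 - src d q.2) i :=
    (EuclideanSpace.proj (𝕜 := ℝ) i).continuous.comp
      (continuous_fst.sub ((continuous_src d).comp continuous_snd))
  refine ⟨fun x α => Complex.I * k * ((x - src d α) i / truncDist R d x α ^ 1 : ℝ) -
    ((x - src d α) i / truncDist R d x α ^ 2 : ℝ), ?_, fun x hx α => ?_⟩
  · exact (continuous_const.mul (continuous_ofReal_div_truncDist hd hw 1)).sub
      (continuous_ofReal_div_truncDist hd hw 2)
  · simp only [truncDist_eq hx, xTilde, pow_one]

lemma exists_continuous_xHat {d : ℝ} (hd : R < d) (k : ℝ) (i : Fin 3) :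
    ∃ χ : Pt → ℝ → ℂ, Continuous (Function.uncurry χ) ∧
      ∀ x ∈ cube R, ∀ α, χ x α = xHat k d α x i := by
  have hc : ∀ l, Continuous fun q : Pt × ℝ => q.1 l := fun l =>
    (EuclideanSpace.proj (𝕜 := ℝ) l).continuous.comp continuous_fst
  have hw1 : Continuous fun q : Pt × ℝ => ![-(q.1 1) ^ 2 - (q.1 2 + d) ^ 2,
      (q.1 0 - q.2) * q.1 1, (q.1 0 - q.2) * (q.1 2 + d)] i := by
    have h0 := hc 0
    have h1 := hc 1
    have h2 := hc 2
    fin_cases i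
    · show Continuous fun q : Pt × ℝ => -(q.1 1) ^ 2 - (q.1 2 + d) ^ 2
      fun_prop
    · show Continuous fun q : Pt × ℝ => (q.1 0 - q.2) * q.1 1
      fun_prop
    · show Continuous fun q : Pt × ℝ => (q.1 0 - q.2) * (q.1 2 + d)
      fun_prop
  have hw2 : Continuous fun q : Pt × ℝ => ![(q.1 0 - q.2) ^ 2 - (q.1 1) ^ 2 - (q.1 2 + d) ^ 2,
      2 * (q.1 0 - q.2) * q.1 1, 2 * (q.1 0 - q.2) * (q.1 2 + d)] i := by
    have h0 := hc 0
    have h1 := hc 1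
    have h2 := hc 2
    fin_cases i
    · show Continuous fun q : Pt × ℝ => (q.1 0 - q.2) ^ 2 - (q.1 1) ^ 2 - (q.1 2 + d) ^ 2
      fun_prop
    · show Continuous fun q : Pt × ℝ => 2 * (q.1 0 - q.2) * q.1 1
      fun_prop
    · show Continuous fun q : Pt × ℝ => 2 * (q.1 0 - q.2) * (q.1 2 + d)
      fun_prop
  refine ⟨fun x α => Complex.I * k * ((![-(x 1) ^ 2 - (x 2 + d) ^ 2, (x 0 - α) * x 1,
      (x 0 - α) * (x 2 + d)] i / truncDist R d x α ^ 3 : ℝ) : ℂ) -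
    ((![(x 0 - α) ^ 2 - (x 1) ^ 2 - (x 2 + d) ^ 2, 2 * (x 0 - α) * x 1,
      2 * (x 0 - α) * (x 2 + d)] i / truncDist R d x α ^ 4 : ℝ) : ℂ),
    (continuous_const.mul (continuous_ofReal_div_truncDist hd hw1 3)).sub
    (continuous_ofReal_div_truncDist hd hw2 4), fun x hx α => ?_⟩
  simp only [truncDist_eq hx, xHat]
  push_cast
  ring

lemma exists_continuous_coefficient {χ : Pt → ℝ → ℂ} (hχ : Continuous (Function.uncurry χ))
    {a : ℝ} {φ : ℝ → ℝ} (hφ : Continuous φ) :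
    Continuous fun x => ∫ α in (-a)..a, (φ α : ℂ) * χ x α := by
  refine intervalIntegral.continuous_parametric_intervalIntegral_of_continuous' ?_ _ _
  exact ((Complex.continuous_ofReal.comp hφ).comp continuous_snd).mul hχ

lemma integral_mul_sum_coefficient {N : ℕ} {χ : Fin 3 → Pt → ℝ → ℂ}
    (hχ : ∀ i, Continuous (Function.uncurry (χ i))) {a : ℝ} {φ : ℝ → ℝ} (hφ : Continuous φ)
    (x : Pt) (p : Grad N) (n : Fin N) :
    ∫ α in (-a)..a, (φ α : ℂ) * ∑ i, p i n * χ i x α =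
      ∑ i, (∫ α in (-a)..a, (φ α : ℂ) * χ i x α) * p i n := by
  have hc : ∀ i, Continuous fun α => χ i x α := fun i =>
    (hχ i).comp (Continuous.prodMk_right x)
  have hφ' : Continuous fun α => (φ α : ℂ) := Complex.continuous_ofReal.comp hφ
  simp only [Finset.mul_sum]
  rw [intervalIntegral.integral_finsetSum]
  · refine Finset.sum_congr rfl fun i _ => ?_
    rw [← intervalIntegral.integral_mul_const]
    congr 1
    funext α
    ring
  · intro i _
    exact (hφ'.mul (continuous_const.mul (hc i))).intervalIntegrable _ _

/-- The matrix `S_N⁻¹` acting on vectors. -/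
noncomputable def invSN (N : ℕ) (a : ℝ) : (Fin N → ℂ) →ₗ[ℝ] Val N where
  toFun v := WithLp.toLp 2 (((SN N a)⁻¹.map Complex.ofReal).mulVec v)
  map_add' v w := by rw [Matrix.mulVec_add, WithLp.toLp_add]
  map_smul' t v := by rw [Matrix.mulVec_smul, WithLp.toLp_smul, RingHom.id_apply]

/-- The quadratic part of `f`, polarized. -/
noncomputable def quadPart (N : ℕ) (a : ℝ) : Grad N →ₗ[ℝ] Grad N →ₗ[ℝ] (Fin N → ℂ) :=
  LinearMap.mk₂ ℝ (fun p q m => 2 * ∑ n : Fin N, ∑ l : Fin N, (∑ i, p i n * q i l) *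
      ((∫ α in (-a)..a, Psi a m α * Psi a n α * deriv (Psi a l) α : ℝ) : ℂ))
    (fun p p' q => by
      funext m
      simp only [Pi.add_apply, PiLp.add_apply, add_mul, Finset.sum_add_distrib, mul_add])
    (fun t p q => by
      funext m
      simp only [Pi.smul_apply, PiLp.smul_apply, Complex.real_smul, Finset.mul_sum, Finset.sum_mul]
      refine Finset.sum_congr rfl fun n _ => Finset.sum_congr rfl fun l _ =>
        Finset.sum_congr rfl fun i _ => ?_
      ring)
    (fun p q q' => by
      funext m
      simp only [Pi.add_apply, PiLp.add_apply, add_mul, Finset.sum_add_distrib, mul_add])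
    (fun t p q => by
      funext m
      simp only [Pi.smul_apply, PiLp.smul_apply, Complex.real_smul, Finset.mul_sum, Finset.sum_mul]
      refine Finset.sum_congr rfl fun n _ => Finset.sum_congr rfl fun l _ =>
        Finset.sum_congr rfl fun i _ => ?_
      ring)

/-- A linear function of the gradient with given coefficients. -/
noncomputable def linPart {N : ℕ} (T : Fin N → Fin N → Fin 3 → ℂ) : Grad N →ₗ[ℝ] (Fin N → ℂ) where
  toFun p m := ∑ n, ∑ i, T m n i * p i n
  map_add' p q := by
    funext m
    simp only [Pi.add_apply, PiLp.add_apply, Finset.sum_add_distrib, mul_add]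
  map_smul' t p := by
    funext m
    simp only [Pi.smul_apply, PiLp.smul_apply, Complex.real_smul, Finset.mul_sum, RingHom.id_apply]
    refine Finset.sum_congr rfl fun n _ => Finset.sum_congr rfl fun i _ => ?_
    ring

/-- On the cube the nonlinearity is the sum of a linear form in the gradient with continuous
coefficients and a quadratic form with constant coefficients. -/
lemma exists_KNonlin_eq {d : ℝ} (hd : R < d) (N : ℕ) (a k : ℝ) :
    ∃ (A : Pt → Grad N →L[ℝ] Val N) (B : Grad N →L[ℝ] Grad N →L[ℝ] Val N), Continuous A ∧
      ∀ x ∈ cube R, ∀ p, KNonlin N a k d x p = A x p + B p p := by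
  choose χ hχ hχe using exists_continuous_xTilde hd k
  choose η hη hηe using exists_continuous_xHat hd k
  have hφ : ∀ m n : Fin N, Continuous fun α => Psi a m α * deriv (Psi a n) α := fun m n =>
    (continuous_Psi a m).mul (continuous_deriv_Psi a n)
  have hφ' : ∀ m n : Fin N, Continuous fun α => Psi a m α * Psi a n α := fun m n =>
    (continuous_Psi a m).mul (continuous_Psi a n)
  let T : Pt → Fin N → Fin N → Fin 3 → ℂ := fun x m n i =>
    2 * (∫ α in (-a)..a, ((Psi a m α * deriv (Psi a n) α : ℝ) : ℂ) * χ i x α) +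
      2 * ∫ α in (-a)..a, ((Psi a m α * Psi a n α : ℝ) : ℂ) * η i x α
  have hT : ∀ m n i, Continuous fun x => T x m n i := fun m n i =>
    (continuous_const.mul (exists_continuous_coefficient (hχ i) (hφ m n))).add
      (continuous_const.mul (exists_continuous_coefficient (hη i) (hφ' m n)))
  refine ⟨fun x => LinearMap.toContinuousLinearMap (invSN N a ∘ₗ linPart (T x)),
    LinearMap.toContinuousBilinearMap ((quadPart N a).compr₂ (invSN N a)), ?_, fun x hx p => ?_⟩
  · refine continuous_clm_apply.2 fun p => ?_
    have hΦ : Continuous (invSN N a) := (invSN N a).continuous_of_finiteDimensional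
    refine hΦ.comp (continuous_pi fun m => ?_)
    show Continuous fun x => ∑ n, ∑ i, T x m n i * p i n
    exact continuous_finsetSum _ fun n _ => continuous_finsetSum _ fun i _ =>
      (hT m n i).mul continuous_const
  · show KNonlin N a k d x p = invSN N a (linPart (T x) p) + invSN N a (quadPart N a p p)
    rw [← map_add]
    show _ = WithLp.toLp 2 _
    rw [KNonlin]
    congr 2
    funext m
    rw [Pi.add_apply]
    show fNonlin N a k d x p m = (∑ n, ∑ i, T x m n i * p i n) +
      2 * ∑ n : Fin N, ∑ l : Fin N, (∑ i, p i n * p i l) *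
        ((∫ α in (-a)..a, Psi a m α * Psi a n α * deriv (Psi a l) α : ℝ) : ℂ)
    rw [fNonlin]
    have e1 : ∀ n : Fin N, (∫ α in (-a)..a, ((Psi a m α * deriv (Psi a n) α : ℝ) : ℂ) *
        (∑ i, p i n * xTilde k d α x i)) = ∑ i,
        (∫ α in (-a)..a, ((Psi a m α * deriv (Psi a n) α : ℝ) : ℂ) * χ i x α) * p i n := fun n => by
      rw [← integral_mul_sum_coefficient hχ (hφ m n)]
      simp only [hχe _ x hx]
    have e2 : ∀ n : Fin N, (∫ α in (-a)..a, ((Psi a m α * Psi a n α : ℝ) : ℂ) *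
        (∑ i, xHat k d α x i * p i n)) = ∑ i,
        (∫ α in (-a)..a, ((Psi a m α * Psi a n α : ℝ) : ℂ) * η i x α) * p i n := fun n => by
      rw [← integral_mul_sum_coefficient hη (hφ' m n)]
      simp only [hηe _ x hx, mul_comm (p _ n)]
    simp only [e1, e2]
    simp only [T, add_mul, Finset.sum_add_distrib, Finset.mul_sum, mul_assoc]
    ring

end ConvexCIP

namespace ConvexCIP

open Filter Topology

variable {R : ℝ} {U V : Set Pt} {i j : Fin 3} {f g f' g' : Pt → ℝ}

/-! ### The operators defining the functional -/

lemma memLp_of_continuous_bounded {E : Type*} [NormedAddCommGroup E] {F : Pt → E}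
    (hF : Continuous F) [SecondCountableTopologyEither Pt E] (p : ENNReal) :
    MemLp F p (cubeMeasure R) := by
  obtain ⟨C, hC⟩ := (isCompact_closure_cube R).exists_bound_of_continuousOn hF.continuousOn
  refine MemLp.of_bound hF.aestronglyMeasurable C ?_
  filter_upwards [ae_mem_cube R] with x hx
  exact hC x (subset_closure hx)

/-- The quasilinear operator as the sum of a bounded linear and a bounded bilinear operator into
`L²`, together with their pointwise expressions. -/
lemma exists_operators (hR : 0 < R) {d : ℝ} (hd : R < d) (N : ℕ) (a k : ℝ) :
    ∃ (A : Pt → Grad N →L[ℝ] Val N) (B : Grad N →L[ℝ] Grad N →L[ℝ] Val N) (C : ℝ)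
      (S : H3 N R →L[ℝ] L2 N R) (Q : H3 N R →L[ℝ] H3 N R →L[ℝ] L2 N R), 0 ≤ C ∧
      (∀ x ∈ cube R, ‖A x‖ ≤ C) ∧
      (∀ V, S V =ᵐ[cubeMeasure R] fun x =>
        (∑ i, wD (MultiIndex.second i) V x) + A x (gradFun V x)) ∧
      (∀ V W, Q V W =ᵐ[cubeMeasure R] fun x => B (gradFun V x) (gradFun W x)) ∧
      ∀ V, LOp a k d V =ᵐ[cubeMeasure R] S V + Q V V := by
  obtain ⟨A, B, hA, hAB⟩ := exists_KNonlin_eq hd N a k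
  obtain ⟨D, hD⟩ := exists_gradient_map hR N
  obtain ⟨C, hC⟩ := (isCompact_closure_cube R).exists_bound_of_continuousOn hA.continuousOn
  -- The continuous coefficient is viewed in L⁴, so the first-order term uses the same 4, 4, 2
  -- Hölder pairing as the quadratic one.
  have hAm : MemLp A 4 (cubeMeasure R) := memLp_of_continuous_bounded hA 4
  let S : H3 N R →L[ℝ] L2 N R := (∑ i, wDL R (MultiIndex.second i)) +
    ((ContinuousLinearMap.id ℝ (Grad N →L[ℝ] Val N)).holderL (cubeMeasure R) 4 4 2
      (hAm.toLp A)) ∘L D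
  let Q : H3 N R →L[ℝ] H3 N R →L[ℝ] L2 N R := (B.holderL (cubeMeasure R) 4 4 2).bilinearComp D D
  have hS : ∀ V, S V =ᵐ[cubeMeasure R] fun x =>
      (∑ i, wD (MultiIndex.second i) V x) + A x (gradFun V x) := fun V => by
    have e : S V = (wD (MultiIndex.second 0) V + wD (MultiIndex.second 1) V +
        wD (MultiIndex.second 2) V) +
        (ContinuousLinearMap.id ℝ (Grad N →L[ℝ] Val N)).holder 2 (hAm.toLp A) (D V) := by
      simp [S, Fin.sum_univ_three, wDL_apply]
    rw [e]
    filter_upwards [Lp.coeFn_add (wD (MultiIndex.second 0) V + wD (MultiIndex.second 1) V +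
        wD (MultiIndex.second 2) V) ((ContinuousLinearMap.id ℝ (Grad N →L[ℝ] Val N)).holder 2
          (hAm.toLp A) (D V)),
      Lp.coeFn_add (wD (MultiIndex.second 0) V + wD (MultiIndex.second 1) V)
        (wD (MultiIndex.second 2) V),
      Lp.coeFn_add (wD (MultiIndex.second 0) V) (wD (MultiIndex.second 1) V),
      (ContinuousLinearMap.id ℝ (Grad N →L[ℝ] Val N)).coeFn_holder (r := 2) (hAm.toLp A) (D V),
      hAm.coeFn_toLp, hD V] with x h1 h2 h3 h4 h5 h6
    rw [h1, Pi.add_apply, h2, Pi.add_apply, h3, Pi.add_apply, h4, h5, h6, Fin.sum_univ_three]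
    rfl
  have hQ : ∀ V W, Q V W =ᵐ[cubeMeasure R] fun x => B (gradFun V x) (gradFun W x) := fun V W => by
    have e : Q V W = B.holder 2 (D V) (D W) := by simp [Q]
    rw [e]
    filter_upwards [B.coeFn_holder (r := 2) (D V) (D W), hD V, hD W] with x h1 h2 h3
    rw [h1, h2, h3]
  refine ⟨A, B, max C 0, S, Q, le_max_right _ _,
    fun x hx => (hC x (subset_closure hx)).trans (le_max_left _ _), hS, hQ, fun V => ?_⟩
  filter_upwards [hS V, hQ V V, ae_mem_cube R] with x h1 h2 hx
  rw [LOp, hAB x hx, Pi.add_apply, h1, h2, add_assoc]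
  rfl

/-- Multiplication by the square root of the Carleman weight. -/
lemma exists_weight_operator (N : ℕ) (R r lam : ℝ) : ∃ T : L2 N R →L[ℝ] L2 N R,
    ∀ u, T u =ᵐ[cubeMeasure R] fun x => halfWeight lam r x • u x := by
  have hm : MemLp (halfWeight lam r) ⊤ (cubeMeasure R) :=
    memLp_of_continuous_bounded (halfWeight_contDiff lam r).continuous ⊤
  refine ⟨(ContinuousLinearMap.lsmul ℝ ℝ : ℝ →L[ℝ] Val N →L[ℝ] Val N).holderL
    (cubeMeasure R) ⊤ 2 2 (hm.toLp _), fun u => ?_⟩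
  filter_upwards [(ContinuousLinearMap.lsmul ℝ ℝ : ℝ →L[ℝ] Val N →L[ℝ] Val N).coeFn_holder (r := 2)
    (hm.toLp _) u, hm.coeFn_toLp] with x h1 h2
  rw [ContinuousLinearMap.holderL_apply_apply, h1, h2]
  rfl

lemma norm_weight_sq {N : ℕ} {r lam : ℝ} {T : L2 N R →L[ℝ] L2 N R}
    (hT : ∀ u, T u =ᵐ[cubeMeasure R] fun x => halfWeight lam r x • u x) (u : L2 N R) :
    (fun x => ‖T u x‖ ^ 2) =ᵐ[cubeMeasure R] fun x => ‖u x‖ ^ 2 * carleman r lam (x 2) := by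
  filter_upwards [hT u] with x hx
  rw [hx, norm_smul, mul_pow, Real.norm_eq_abs, sq_abs, halfWeight_sq, mul_comm]

/-! ### Lower bound for the second-order remainder -/

/-- The pointwise lower bound. -/
lemma half_norm_sq_sub_le {E Y : Type*} [NormedAddCommGroup E] [NormedSpace ℝ E]
    [NormedAddCommGroup Y] [InnerProductSpace ℝ Y] (A : E →L[ℝ] Y) (B : E →L[ℝ] E →L[ℝ] Y) {C : ℝ}
    (hA : ‖A‖ ≤ C) (u v : Y) (p q : E) :
    1 / 2 * ‖u‖ ^ 2 - (3 * C ^ 2 + 17 * ‖B‖ ^ 2 + 2 * ‖B‖ + ‖B‖ * C) *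
        (1 + ‖v‖ + ‖p‖ ^ 2 + ‖q‖ ^ 2) * ‖q‖ ^ 2 ≤
      ‖(u + A q) + B p q + B q p + B q q‖ ^ 2 +
        2 * inner ℝ ((v + A p) + B p p) (B q q) := by
  have hC : 0 ≤ C := (norm_nonneg _).trans hA
  have hAle : ∀ z, ‖A z‖ ≤ C * ‖z‖ := fun z => A.le_of_opNorm_le hA z
  have hBle := B.le_opNorm₂
  have he : ‖A q + B p q + B q p + B q q‖ ≤ (C + 2 * ‖B‖ * ‖p‖ + ‖B‖ * ‖q‖) * ‖q‖ := by
    calc _ ≤ ‖A q‖ + ‖B p q‖ + ‖B q p‖ + ‖B q q‖ := norm_add₄_le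
      _ ≤ C * ‖q‖ + ‖B‖ * ‖p‖ * ‖q‖ + ‖B‖ * ‖q‖ * ‖p‖ + ‖B‖ * ‖q‖ * ‖q‖ := by
        gcongr
        · exact hAle q
        · exact hBle p q
        · exact hBle q p
        · exact hBle q q
      _ = _ := by ring
  have hi : -((‖v‖ + C * ‖p‖ + ‖B‖ * ‖p‖ * ‖p‖) * (‖B‖ * ‖q‖ * ‖q‖)) ≤
      inner ℝ ((v + A p) + B p p) (B q q) := by
    refine (neg_le_neg ?_).trans (neg_le_of_abs_le (abs_real_inner_le_norm _ _))
    gcongr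
    · calc _ ≤ ‖v‖ + ‖A p‖ + ‖B p p‖ := norm_add₃_le
        _ ≤ _ := by
          gcongr
          · exact hAle p
          · exact hBle p p
    · exact hBle q q
  have e : (u + A q) + B p q + B q p + B q q = u + (A q + B p q + B q p + B q q) := by abel
  rw [e, norm_add_sq_real]
  have hue := neg_le_of_abs_le (abs_real_inner_le_norm u (A q + B p q + B q p + B q q))
  generalize A q + B p q + B q p + B q q = w at *
  generalize inner ℝ ((v + A p) + B p p) (B q q) = y at *
  have hw2 : ‖w‖ ^ 2 ≤ ((C + 2 * ‖B‖ * ‖p‖ + ‖B‖ * ‖q‖) * ‖q‖) ^ 2 := by gcongr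
  have hb := norm_nonneg B
  have hp := norm_nonneg p
  have hq := norm_nonneg q
  have hv := norm_nonneg v
  generalize ‖B‖ = b at *
  generalize ‖p‖ = P at *
  generalize ‖q‖ = Q at *
  generalize ‖v‖ = D at *
  -- Young's inequality keeps half of |Δh|²; everything else is quadratic in ∇h, up to coefficients.
  have h1 : 1 / 2 * ‖u‖ ^ 2 - ‖w‖ ^ 2 ≤ ‖u‖ ^ 2 + 2 * inner ℝ u w + ‖w‖ ^ 2 := by
    nlinarith [sq_nonneg (‖u‖ - 2 * ‖w‖)]
  have h2 : (C + 2 * b * P + b * Q) ^ 2 ≤ 3 * (C ^ 2 + 4 * b ^ 2 * P ^ 2 + b ^ 2 * Q ^ 2) := by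
    nlinarith [sq_nonneg (C - 2 * b * P), sq_nonneg (C - b * Q), sq_nonneg (2 * b * P - b * Q)]
  have h3 : 2 * P ≤ 1 + P ^ 2 := by nlinarith [sq_nonneg (P - 1)]
  have h4 : 2 * b * (D + C * P + b * P * P) ≤ 2 * b * D + b * C * (1 + P ^ 2) + 2 * b ^ 2 * P ^ 2 := by
    nlinarith [mul_le_mul_of_nonneg_left h3 (mul_nonneg hb hC)]
  -- The largest multiple of b² needed is 12 + 2 = 14, for P²; 17 leaves room, and t1 to t4 collect
  -- the nonnegative slack.
  have h5 : (C + 2 * b * P + b * Q) ^ 2 + 2 * b * (D + C * P + b * P * P) ≤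
      (3 * C ^ 2 + 17 * b ^ 2 + 2 * b + b * C) * (1 + D + P ^ 2 + Q ^ 2) := by
    have t1 : 0 ≤ 3 * C ^ 2 * (D + P ^ 2 + Q ^ 2) := by positivity
    have t2 : 0 ≤ b ^ 2 * (17 + 17 * D + 3 * P ^ 2 + 14 * Q ^ 2) := by positivity
    have t3 : 0 ≤ 2 * b * (1 + P ^ 2 + Q ^ 2) := by positivity
    have t4 : 0 ≤ b * C * (D + Q ^ 2) := by positivity
    linarith
  have h6 := mul_le_mul_of_nonneg_right h5 (sq_nonneg Q)
  linarith

lemma norm_le_sum_abs_cpt {N : ℕ} (v : Val N) : ‖v‖ ≤ ∑ c, |cpt c v| := by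
  refine le_of_sq_le_sq ?_ (Finset.sum_nonneg fun _ _ => abs_nonneg _)
  rw [← sum_sq_cpt]
  calc ∑ c, cpt c v ^ 2 = ∑ c, |cpt c v| ^ 2 := by simp only [sq_abs]
    _ ≤ _ := Finset.sum_sq_le_sq_sum_of_nonneg fun _ _ => abs_nonneg _

/-- The coefficient of the lower-order terms in the second-order remainder. -/
noncomputable def lowerCoeff {N : ℕ} (V h : H3 N R) (x : Pt) : ℝ :=
  ∑ k : Fin 3 × (Fin N × Bool), (1 + |wDc k.2 (MultiIndex.pair k.1 k.1) V x| +
    wDc k.2 (MultiIndex.first k.1) V x ^ 2 + wDc k.2 (MultiIndex.first k.1) h x ^ 2)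

lemma lowerCoeff_nonneg {N : ℕ} (V h : H3 N R) (x : Pt) : 0 ≤ lowerCoeff V h x :=
  Finset.sum_nonneg fun _ _ => by positivity

lemma le_lowerCoeff {N : ℕ} (hN : 1 ≤ N) (V h : H3 N R) (x : Pt) :
    1 + ‖∑ i, wD (MultiIndex.second i) V x‖ + ‖gradFun V x‖ ^ 2 + ‖gradFun h x‖ ^ 2 ≤
      lowerCoeff V h x := by
  simp only [lowerCoeff, Finset.sum_add_distrib]
  refine add_le_add (add_le_add (add_le_add ?_ ?_) (norm_gradFun_sq_le V x))
    (norm_gradFun_sq_le h x)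
  -- The constant 1 appears once per component and direction, so N ≥ 1 is what makes its total at
  -- least 1.
  · rw [Finset.sum_const, Finset.card_univ, nsmul_eq_mul, mul_one]
    have : Nonempty (Fin 3 × (Fin N × Bool)) := ⟨(0, (⟨0, hN⟩, true))⟩
    exact_mod_cast Fintype.card_pos
  · refine (norm_sum_le _ _).trans ?_
    rw [Fintype.sum_prod_type (α₁ := Fin 3)]
    refine Finset.sum_le_sum fun i _ => ?_
    rw [MultiIndex.second_eq]
    exact norm_le_sum_abs_cpt _

lemma aestronglyMeasurable_lowerCoeff {N : ℕ} (V h : H3 N R) :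
    AEStronglyMeasurable (lowerCoeff V h) (cubeMeasure R) := by
  refine Finset.aestronglyMeasurable_fun_sum _ fun k _ => ?_
  exact ((aestronglyMeasurable_const.add (memLp_wDc _ _ V).1.norm).add
    ((memLp_wDc _ _ V).1.pow 2)).add ((memLp_wDc _ _ h).1.pow 2)

/-- Second derivatives of V are in H¹ ⊂ L⁴, and the squared gradients are in L⁴ because H² ⊂ L⁸. The
bound is uniform on H³ balls. The 64 = 4³ comes from the fourth power of a sum of four terms. -/
lemma exists_lowerCoeff_bound (hR : 0 < R) (N : ℕ) (ρ : ℝ) : ∃ Γ,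
    ∀ V h : H3 N R, ‖V‖ ≤ ρ → ‖h‖ ≤ ρ →
    Integrable (fun x => lowerCoeff V h x ^ 4) (cubeMeasure R) ∧
      ∫ x in cube R, lowerCoeff V h x ^ 4 ≤ Γ := by
  obtain ⟨C₄, hC₄, h4⟩ := exists_four_bound hR
  obtain ⟨C₈, hC₈, h8⟩ := exists_eight_bound hR
  refine ⟨(Fintype.card (Fin 3 × (Fin N × Bool)) : ℝ) ^ 3 * ∑ k : Fin 3 × (Fin N × Bool),
    64 * ((∫ x in cube R, (1 : ℝ)) + C₄ * ρ ^ 4 + C₈ * ρ ^ 8 + C₈ * ρ ^ 8), fun V h hV hh => ?_⟩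
  have b1 := fun k : Fin 3 × (Fin N × Bool) => h4 N V k.2 (MultiIndex.pair k.1 k.1)
    (MultiIndex.triple k.1 k.1) (MultiIndex.isSucc_triple k.1 k.1)
  have b2 := fun k : Fin 3 × (Fin N × Bool) => h8 N V k.2 k.1
  have b3 := fun k : Fin 3 × (Fin N × Bool) => h8 N h k.2 k.1
  have hone : Integrable (fun _ : Pt => (1 : ℝ)) (cubeMeasure R) :=
    memLp_one_iff_integrable.1 (memLp_of_continuous_bounded continuous_const 1)
  have hk := fun k : Fin 3 × (Fin N × Bool) => ((((Integrable.hasInt hone).add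
    (Integrable.hasInt (b1 k).1)).add (Integrable.hasInt (b2 k).1)).add
      (Integrable.hasInt (b3 k).1)).const_mul 64
  have hle : ∀ x, lowerCoeff V h x ^ 4 ≤ (Fintype.card (Fin 3 × (Fin N × Bool)) : ℝ) ^ 3 *
      ∑ k : Fin 3 × (Fin N × Bool), 64 * (1 + wDc k.2 (MultiIndex.pair k.1 k.1) V x ^ 4 +
        wDc k.2 (MultiIndex.first k.1) V x ^ 8 + wDc k.2 (MultiIndex.first k.1) h x ^ 8) := by
    intro x
    refine (pow_four_sum_le _).trans ?_
    gcongr with k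
    have := pow_four_sum_le ![1, |wDc k.2 (MultiIndex.pair k.1 k.1) V x|,
      wDc k.2 (MultiIndex.first k.1) V x ^ 2, wDc k.2 (MultiIndex.first k.1) h x ^ 2]
    simp only [Fin.sum_univ_four, Fintype.card_fin] at this
    have e : |wDc k.2 (MultiIndex.pair k.1 k.1) V x| ^ 4 =
        wDc k.2 (MultiIndex.pair k.1 k.1) V x ^ 4 := Even.pow_abs (by decide) _
    refine this.trans (le_of_eq ?_)
    simp only [Matrix.cons_val]
    rw [e]
    push_cast
    ring
  have hint := (integrable_finsetSum (Finset.univ : Finset (Fin 3 × (Fin N × Bool)))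
    fun k _ => (hk k).1).const_mul ((Fintype.card (Fin 3 × (Fin N × Bool)) : ℝ) ^ 3)
  have h1 : Integrable (fun x => lowerCoeff V h x ^ 4) (cubeMeasure R) :=
    hint.mono' ((aestronglyMeasurable_lowerCoeff V h).pow 4) (Eventually.of_forall fun x => by
      rw [Real.norm_of_nonneg (by positivity)]
      exact hle x)
  refine ⟨h1, (integral_mono h1 hint hle).trans ?_⟩
  rw [integral_const_mul, integral_finsetSum _ fun k _ => (hk k).1]
  gcongr with k
  rw [(hk k).2]
  gcongr
  · exact (b1 k).2.trans (by gcongr)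
  · exact (b2 k).2.trans (by gcongr)
  · exact (b3 k).2.trans (by gcongr)

end ConvexCIP

/-! ### The lower bound for the remainder. -/

namespace ConvexCIP

open Filter Topology

variable {R : ℝ} {U V : Set Pt} {i j : Fin 3} {f g f' g' : Pt → ℝ}

lemma HasInt.sum {ι : Type*} (s : Finset ι) {F : ι → Pt → ℝ} {b : ι → ℝ}
    (h : ∀ k ∈ s, HasInt R (F k) (b k)) : HasInt R (fun x => ∑ k ∈ s, F k x) (∑ k ∈ s, b k) :=
  ⟨integrable_finsetSum s fun k hk => (h k hk).1, by
    rw [integral_finsetSum s fun k hk => (h k hk).1]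
    exact Finset.sum_congr rfl fun k hk => (h k hk).2⟩

lemma HasInt.le_ae {a b : ℝ} (hf : HasInt R f a) (hg : HasInt R g b)
    (h : f ≤ᵐ[cubeMeasure R] g) : a ≤ b := by
  rw [← hf.2, ← hg.2]
  exact integral_mono_ae hf.1 hg.1 h

/-- The weighted integral of the squared Laplacian of a component. -/
noncomputable def laplacianEnergy {N : ℕ} (r lam : ℝ) (h : H3 N R) (c : Fin N × Bool) : ℝ :=
  ∫ x in cube R, (∑ i, wDc c (MultiIndex.pair i i) h x) ^ 2 * carleman r lam (x 2)

lemma laplacianEnergy_nonneg {N : ℕ} (r lam : ℝ) (h : H3 N R) (c : Fin N × Bool) :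
    0 ≤ laplacianEnergy r lam h c :=
  integral_nonneg fun x => by unfold carleman; positivity

lemma hasInt_laplacianEnergy {N : ℕ} (r lam : ℝ) (h : H3 N R) (c : Fin N × Bool) :
    HasInt R (fun x => (∑ i, wDc c (MultiIndex.pair i i) h x) ^ 2 * carleman r lam (x 2))
      (laplacianEnergy r lam h c) := by
  refine ⟨?_, rfl⟩
  have h1 : MemLp (fun x => ∑ i, wDc c (MultiIndex.pair i i) h x) 2 (cubeMeasure R) :=
    memLp_finsetSum _ fun i _ => memLp_wDc c _ h
  have h2 := (memLp_continuous_mul (halfWeight_contDiff lam r).continuous h1).integrable_sq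
  simpa only [mul_pow, halfWeight_sq, mul_comm] using h2

lemma norm_laplacian_sq {N : ℕ} (h : H3 N R) (x : Pt) :
    ‖∑ i, wD (MultiIndex.second i) h x‖ ^ 2 =
      ∑ c, (∑ i, wDc c (MultiIndex.pair i i) h x) ^ 2 := by
  rw [← sum_sq_cpt]
  simp only [map_sum, MultiIndex.second_eq, wDc]

lemma hasInt_remainder {N : ℕ} (T : L2 N R →L[ℝ] L2 N R) (u v w : L2 N R) :
    HasInt R (fun x => ‖T u x‖ ^ 2 + 2 * inner ℝ (T v x) (T w x))
      (‖T u‖ ^ 2 + 2 * inner ℝ (T v) (T w)) := by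
  refine HasInt.add ⟨integrable_norm_sq _, (norm_sq_eq_integral _).symm⟩ (HasInt.const_mul 2 ?_)
  exact ⟨L2.integrable_inner _ _, (L2.inner_def _ _).symm⟩

/-- The second-order remainder of the functional controls the weighted Laplacian. -/
lemma exists_remainder_lower_bound {N : ℕ} (hN : 1 ≤ N) (hR : 0 < R) {r : ℝ} (hr : R < r)
    (ρ : ℝ) {A : Pt → Grad N →L[ℝ] Val N} {B : Grad N →L[ℝ] Grad N →L[ℝ] Val N} {C : ℝ}
    {S : H3 N R →L[ℝ] L2 N R} {Q : H3 N R →L[ℝ] H3 N R →L[ℝ] L2 N R} (hC : 0 ≤ C)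
    (hA : ∀ x ∈ cube R, ‖A x‖ ≤ C)
    (hS : ∀ V, S V =ᵐ[cubeMeasure R] fun x =>
      (∑ i, wD (MultiIndex.second i) V x) + A x (gradFun V x))
    (hQ : ∀ V W, Q V W =ᵐ[cubeMeasure R] fun x => B (gradFun V x) (gradFun W x)) :
    ∃ lam₀, 1 ≤ lam₀ ∧ ∀ lam, lam₀ ≤ lam → ∀ T : L2 N R →L[ℝ] L2 N R,
      (∀ u, T u =ᵐ[cubeMeasure R] fun x => halfWeight lam r x • u x) →
      ∀ V h : H3 N R, ‖V‖ ≤ ρ → ‖h‖ ≤ ρ →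
      (∀ c, DirichletData R (wDc c MultiIndex.zero h) (fun i => wDc c (MultiIndex.first i) h)
        (fun i j => wDc c (MultiIndex.pair i j) h)) →
      1 / 4 * ∑ c, laplacianEnergy r lam h c ≤
        ‖T (S h + Q V h + Q h V + Q h h)‖ ^ 2 + 2 * inner ℝ (T (S V + Q V V)) (T (Q h h)) := by
  obtain ⟨Γ, hΓ⟩ := exists_lowerCoeff_bound hR N ρ
  obtain ⟨C₀, hC₀, hC₀e⟩ : ∃ C₀, 0 ≤ C₀ ∧ 3 * C ^ 2 + 17 * ‖B‖ ^ 2 + 2 * ‖B‖ + ‖B‖ * C = C₀ :=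
    ⟨_, by positivity, rfl⟩
  -- Each component is charged once for each of the three directions, so 3/12 = 1/4 of its Laplacian
  -- energy is spent out of the available 1/2.
  obtain ⟨lam₀, h1, habs⟩ := exists_carleman_absorption hR hr (Γ := C₀ ^ 4 * Γ) (κ := 1 / 12)
    (by norm_num)
  refine ⟨lam₀, h1, fun lam hlam T hT V h hV hh hD => ?_⟩
  obtain ⟨hg, hgΓ⟩ := hΓ V h hV hh
  have hk := fun k : Fin 3 × (Fin N × Bool) => habs lam hlam (fun x => C₀ * lowerCoeff V h x) _ _ _
    (hD k.2) ((aestronglyMeasurable_lowerCoeff V h).const_mul C₀)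
    (fun x => mul_nonneg hC₀ (lowerCoeff_nonneg V h x))
    (by simpa only [mul_pow] using hg.const_mul (C₀ ^ 4))
    (by
      simp only [mul_pow]
      rw [integral_const_mul]
      gcongr) k.1
  have i1 := (HasInt.sum Finset.univ fun c _ => hasInt_laplacianEnergy r lam h c).const_mul (1 / 2)
  have i2 := (HasInt.sum Finset.univ fun k _ => Integrable.hasInt (hk k).1).const_mul (-1)
  have i3 := hasInt_remainder T (S h + Q V h + Q h V + Q h h) (S V + Q V V) (Q h h)
  have hle := (i1.add i2).le_ae i3 ?_
  · have h2 : ∑ k : Fin 3 × (Fin N × Bool), ∫ x in cube R, C₀ * lowerCoeff V h x *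
        (wDc k.2 (MultiIndex.first k.1) h x ^ 2 * carleman r lam (x 2)) ≤
        ∑ k : Fin 3 × (Fin N × Bool), 1 / 12 * laplacianEnergy r lam h k.2 :=
      Finset.sum_le_sum fun k _ => (hk k).2
    have h3 : ∑ k : Fin 3 × (Fin N × Bool), 1 / 12 * laplacianEnergy r lam h k.2 =
        1 / 4 * ∑ c, laplacianEnergy r lam h c := by
      rw [Fintype.sum_prod_type (α₁ := Fin 3), Fin.sum_univ_three]
      simp only [← Finset.mul_sum]
      ring
    linarith
  -- Almost everywhere all L² classes become pointwise values, T contributes a factor w to each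
  -- entry, and the claim is `half_norm_sq_sub_le` multiplied by w².
  · filter_upwards [ae_mem_cube R, hT (S h + Q V h + Q h V + Q h h), hT (S V + Q V V), hT (Q h h),
      hS h, hS V, hQ V h, hQ h V, hQ h h, hQ V V, Lp.coeFn_add (S h + Q V h + Q h V) (Q h h),
      Lp.coeFn_add (S h + Q V h) (Q h V), Lp.coeFn_add (S h) (Q V h), Lp.coeFn_add (S V) (Q V V)]
      with x hx t1 t2 t3 s1 s2 q1 q2 q3 q4 a1 a2 a3 a4
    rw [t1, t2, t3, a1, Pi.add_apply, a2, Pi.add_apply, a3, Pi.add_apply, a4, Pi.add_apply, s1, s2,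
      q1, q2, q3, q4, norm_smul, mul_pow, Real.norm_eq_abs, sq_abs, real_inner_smul_left,
      real_inner_smul_right]
    have hp := half_norm_sq_sub_le (A x) B (hA x hx) (∑ i, wD (MultiIndex.second i) h x)
      (∑ i, wD (MultiIndex.second i) V x) (gradFun V x) (gradFun h x)
    rw [hC₀e, norm_laplacian_sq] at hp
    have hl := le_lowerCoeff hN V h x
    have hl0 := lowerCoeff_nonneg V h x
    have hw : 0 ≤ carleman r lam (x 2) := by unfold carleman; positivity
    have hmul : C₀ * (1 + ‖∑ i, wD (MultiIndex.second i) V x‖ + ‖gradFun V x‖ ^ 2 +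
        ‖gradFun h x‖ ^ 2) * ‖gradFun h x‖ ^ 2 ≤ C₀ * lowerCoeff V h x *
        ∑ k : Fin 3 × (Fin N × Bool), wDc k.2 (MultiIndex.first k.1) h x ^ 2 := by
      gcongr
      exact norm_gradFun_sq_le h x
    have hfin := mul_le_mul_of_nonneg_right ((sub_le_sub_left hmul _).trans hp) hw
    rw [← halfWeight_sq] at hfin ⊢
    simp only [← Finset.sum_mul, ← Finset.mul_sum]
    refine le_trans (le_of_eq ?_) (hfin.trans (le_of_eq ?_)) <;> ring

lemma normH2_sq {N : ℕ} (h : H3 N R) :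
    normH2 h ^ 2 = ∑ β : MultiIndex 3 with β.order ≤ 2, ‖wD β h‖ ^ 2 :=
  Real.sq_sqrt (Finset.sum_nonneg fun _ _ => sq_nonneg _)

lemma exists_normH2_sq_le {r lam : ℝ} (N : ℕ) (hR : 0 < R) (hr : R < r) (h1 : 1 ≤ lam)
    (h2 : 2 ≤ lam * (r - R) ^ 2) : ∃ C, 0 < C ∧ ∀ h : H3 N R,
    (∀ c, DirichletData R (wDc c MultiIndex.zero h) (fun i => wDc c (MultiIndex.first i) h)
        (fun i j => wDc c (MultiIndex.pair i j) h)) →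
    C * normH2 h ^ 2 ≤ ∑ c, laplacianEnergy r lam h c := by
  obtain ⟨C, hC, hle⟩ := DirichletData.exists_sobolev_two_le hR hr h1 h2
  refine ⟨1 / (Fintype.card (MultiIndex 3) * C + 1), by positivity, fun h hD => ?_⟩
  have hX : 0 ≤ ∑ c, laplacianEnergy r lam h c :=
    Finset.sum_nonneg fun c _ => laplacianEnergy_nonneg r lam h c
  have hβ : ∀ β : MultiIndex 3, β.order ≤ 2 →
      ‖wD β h‖ ^ 2 ≤ C * ∑ c, laplacianEnergy r lam h c := fun β hβ => by
    rw [norm_wD_sq, Finset.mul_sum]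
    refine Finset.sum_le_sum fun c _ => ?_
    obtain ⟨l0, l1, l2⟩ := hle _ _ _ (hD c)
    rcases MultiIndex.of_order_le_two β hβ with rfl | ⟨i, rfl⟩ | ⟨i, j, rfl⟩
    · exact l0
    · exact l1 i
    · exact l2 i j
  have hsum : normH2 h ^ 2 ≤ Fintype.card (MultiIndex 3) * (C * ∑ c, laplacianEnergy r lam h c) := by
    rw [normH2_sq]
    calc _ ≤ ∑ β : MultiIndex 3 with β.order ≤ 2, C * ∑ c, laplacianEnergy r lam h c :=
          Finset.sum_le_sum fun β hb => hβ β (Finset.mem_filter.1 hb).2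
      _ ≤ ∑ _β : MultiIndex 3, C * ∑ c, laplacianEnergy r lam h c :=
          Finset.sum_le_sum_of_subset_of_nonneg (Finset.filter_subset _ _)
            fun _ _ _ => mul_nonneg hC.le hX
      _ = _ := by rw [Finset.sum_const, Finset.card_univ, nsmul_eq_mul]
  rw [div_mul_eq_mul_div, one_mul, div_le_iff₀ (by positivity)]
  linarith

/-! ### The admissible set -/

lemma VanishesOn.smul_add_smul {N : ℕ} {u v : L2 N R} {s : Set Pt} (hu : VanishesOn u s)
    (hv : VanishesOn v s) (a b : ℝ) : VanishesOn (a • u + b • v) s := by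
  obtain ⟨F, hF, hFu, hF0⟩ := hu
  obtain ⟨G, hG, hGv, hG0⟩ := hv
  refine ⟨fun x => a • F x + b • G x, (hF.const_smul a).add (hG.const_smul b), ?_, fun x hx => ?_⟩
  · filter_upwards [hFu, hGv, Lp.coeFn_add (a • u) (b • v), Lp.coeFn_smul a u, Lp.coeFn_smul b v]
      with x h1 h2 h3 h4 h5
    rw [h3, Pi.add_apply, h4, h5, Pi.smul_apply, Pi.smul_apply, h1, h2]
  · simp only [hF0 x hx, hG0 x hx, smul_zero, add_zero]

lemma convex_ballZero (N : ℕ) (R ρ : ℝ) : Convex ℝ (ballZero N R ρ) := by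
  intro V hV W hW a b ha hb hab
  refine ⟨?_, ?_, ?_⟩
  · have := convex_ball (0 : H3 N R) ρ (mem_ball_zero_iff.2 hV.1) (mem_ball_zero_iff.2 hW.1)
      ha hb hab
    exact mem_ball_zero_iff.1 this
  · exact hV.2.1.smul_add_smul hW.2.1 a b
  · exact hV.2.2.smul_add_smul hW.2.2 a b

lemma norm_le_of_mem_closure_ballZero {N : ℕ} {ρ : ℝ} {W : H3 N R}
    (hW : W ∈ closure (ballZero N R ρ)) : ‖W‖ ≤ ρ := by
  have hsub : ballZero N R ρ ⊆ Metric.closedBall 0 ρ := fun V hV =>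
    mem_closedBall_zero_iff.2 hV.1.le
  exact mem_closedBall_zero_iff.1 (closure_minimal hsub Metric.isClosed_closedBall hW)

end ConvexCIP

/-! ### The corollary. -/

open ConvexCIP
theorem corollary5p1 (N : ℕ) (hN : 1 ≤ N) (R r a d k M : ℝ) (hR : 0 < R) (hr : R < r)
    (ha : 0 < a) (hd : R < d) (hk : 0 < k) (hM : 0 < M) :
    ∃ lam₃ : ℝ, 1 < lam₃ ∧ ∀ lam : ℝ, lam₃ ≤ lam →
      ∃ C₁ : ℝ, 0 < C₁ ∧ ∀ γ : ℝ, 0 < γ → ∀ G : H3 N R, ‖G‖ < M →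
        (∀ W ∈ closure (ballZero N R (2 * M)),
          IntegrableOn (fun x => ‖LOp a k d (W + G) x‖ ^ 2 * carleman r lam (x 2)) (cube R) ∧
          DifferentiableAt ℝ (IFun a k d r lam γ G) W) ∧
        (∀ W₁ ∈ closure (ballZero N R (2 * M)), ∀ W₂ ∈ closure (ballZero N R (2 * M)),
          IFun a k d r lam γ G W₂ - IFun a k d r lam γ G W₁ -
              fderiv ℝ (IFun a k d r lam γ G) W₁ (W₂ - W₁) ≥
            C₁ * normH2 (W₂ - W₁) ^ 2 + γ * ‖W₂ - W₁‖ ^ 2) ∧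
        StrictConvexOn ℝ (closure (ballZero N R (2 * M))) (IFun a k d r lam γ G) := by
  obtain ⟨A, B, C, S, Q, hC, hA, hS, hQ, hL⟩ := exists_operators hR hd N a k
  -- The radius 4M covers both ‖W₁ + G‖ ≤ 2M + M and ‖W₂ - W₁‖ ≤ 2M + 2M.
  obtain ⟨lam₀, hlam₀, hrem⟩ := exists_remainder_lower_bound hN hR hr (4 * M) hC hA hS hQ
  have hq : 0 < r - R := sub_pos.2 hr
  -- The 2 ensures λ₃ > 1, lam₀ is the absorption threshold, and the last entry is the condition
  -- under which the Carleman estimate was proved.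
  refine ⟨max 2 (max lam₀ (2 / (r - R) ^ 2)), one_lt_two.trans_le (le_max_left _ _),
    fun lam hlam => ?_⟩
  have hlam1 : lam₀ ≤ lam := ((le_max_left _ _).trans (le_max_right _ _)).trans hlam
  have hlam2 : 2 ≤ lam * (r - R) ^ 2 := by
    rw [← div_le_iff₀ (by positivity)]
    exact ((le_max_right _ _).trans (le_max_right _ _)).trans hlam
  obtain ⟨C₂, hC₂, hH2⟩ := exists_normH2_sq_le N hR hr (hlam₀.trans hlam1) hlam2
  obtain ⟨T, hT⟩ := exists_weight_operator N R r lam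
  obtain ⟨κ, hκ, hκe⟩ : ∃ κ, 0 < κ ∧ Real.exp (-2 * lam * (R + r) ^ 2) = κ :=
    ⟨_, Real.exp_pos _, rfl⟩
  -- All three factors are fixed before γ and G: the normalizing exponential, the surviving quarter,
  -- and the H² constant for this λ.
  refine ⟨κ * (1 / 4 * C₂), by positivity, fun γ hγ G hG => ?_⟩
  have hae : ∀ V : H3 N R, (fun x => ‖T (S V + Q V V) x‖ ^ 2) =ᵐ[cubeMeasure R]
      fun x => ‖LOp a k d V x‖ ^ 2 * carleman r lam (x 2) := fun V => by
    filter_upwards [norm_weight_sq hT (S V + Q V V), hL V, Lp.coeFn_add (S V) (Q V V)]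
      with x h1 h2 h3
    rw [h1, h2, h3]
  have hI : ∀ W, IFun a k d r lam γ G W =
      κ * ‖T (S (W + G) + Q (W + G) (W + G))‖ ^ 2 + γ * ‖W + G‖ ^ 2 := fun W => by
    rw [IFun, JFun, hκe, norm_sq_eq_integral (T _), integral_congr_ae (hae (W + G))]
  obtain ⟨F', hF', hexp⟩ := exists_hasFDerivAt_of_eq_quartic T S Q κ γ G hI
  have hconv : ∀ W₁ ∈ closure (ballZero N R (2 * M)), ∀ W₂ ∈ closure (ballZero N R (2 * M)),
      κ * (1 / 4 * C₂) * normH2 (W₂ - W₁) ^ 2 + γ * ‖W₂ - W₁‖ ^ 2 ≤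
        IFun a k d r lam γ G W₂ - IFun a k d r lam γ G W₁ - F' W₁ (W₂ - W₁) := by
    intro W₁ h₁ W₂ h₂
    have n1 := norm_le_of_mem_closure_ballZero h₁
    have n2 := norm_le_of_mem_closure_ballZero h₂
    have hV : ‖W₁ + G‖ ≤ 4 * M := by linarith [norm_add_le W₁ G]
    have hh : ‖W₂ - W₁‖ ≤ 4 * M := by linarith [norm_sub_le W₂ W₁]
    have hD := dirichletData_sub hR h₁ h₂
    have b1 := hrem lam hlam1 T hT (W₁ + G) (W₂ - W₁) hV hh hD
    have b2 := hH2 (W₂ - W₁) hD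
    rw [hexp W₁ W₂]
    have b3 := mul_le_mul_of_nonneg_left b1 hκ.le
    have b4 := mul_le_mul_of_nonneg_left b2 (show 0 ≤ κ * (1 / 4) by positivity)
    linarith
  refine ⟨fun W _ => ⟨(integrable_norm_sq (T (S (W + G) + Q (W + G) (W + G)))).congr
    (hae (W + G)), (hF' W).differentiableAt⟩, fun W₁ h₁ W₂ h₂ => ?_, ?_⟩
  · rw [(hF' W₁).fderiv]
    exact hconv W₁ h₁ W₂ h₂
  · refine strictConvexOn_of_lt_sub (convex_ballZero N R (2 * M)).closure (F' := F')
      fun W₁ h₁ W₂ h₂ hne => (?_ : _ < _).trans_le (hconv W₁ h₁ W₂ h₂)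
    -- Strictness is supplied by the term γ‖W₂ - W₁‖².
    have : 0 < ‖W₂ - W₁‖ := norm_pos_iff.2 (sub_ne_zero.2 hne.symm)
    positivity
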